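/- Let $M$ be a smooth manifold of dimension $n\ge 3$ with a Riemannian metric $g$, let $w,f\in C^\infty(M)$, let $T>0$ and $\alpha_n=\frac{n-1}{n-2}$. Let $(\overline g(t),\overline w(t))_{t\in(-\infty,T)}$ be a shrinking self-similar solution to the extended Ricci flow with initial value $(g,w)$ and potential function $\overline f(t)=f\circ\psi_t$; that is, $$\partial_t\overline g=-2\operatorname{Ric}_{\overline g}+2\alpha_n\,d\overline w\otimes d\overline w,\qquad \partial_t\overline w=\Delta_{\overline g}\overline w,$$ $$\overline g(t)=(T-t)\,\psi_t^*g,\qquad \overline w(t)=w\circ\psi_t,$$ where $(\psi_t)_{t<T}$ is a smooth one-parameter family of diffeomorphisms of $M$ with $\partial_t\psi_t=\frac{1}{T-t}\nabla_gf\circ\psi_t$ and $\psi_{t_0}=\mathrm{id}$ for some $t_0<T$. Let $\Sigma$ be an $(n-1)$-dimensional compact smooth manifold without boundary, and let $x_t:\Sigma\to M$, $t\in[0,T)$, be a smooth family of immersions evolving by mean curvature flow in this background: $\partial_t x_t=H\,e$, where $e(\cdot,t)$ is a unit normal and $H(\cdot,t)$ the corresponding mean curvature (the trace of the second fundamental form,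 with the sign for which $He$ is the mean curvature vector) of $x_t$ in $(M,\overline g(t))$. For $s\in[-\log T,\infty)$ let $\widetilde x_s=\psi_t\circ x_t$ with $s=-\log(T-t)$ (the normalized mean curvature flow in $(M,g)$), let $e_s$ be a unit normal of $\widetilde x_s$ in $(M,g)$, let $H_g(\widetilde x_s)$ be the corresponding mean curvature, and let $dA_{\widetilde x_s^*g}$ be the Riemannian measure of $\widetilde x_s^*g$ on $\Sigma$. Then, for every $s\in[-\log T,\infty)$, $$\frac{d}{ds}\int_\Sigma e^{-f\circ\widetilde x_s}\,dA_{\widetilde x_s^*g}=-\int_\Sigma\bigl(H_g(\widetilde x_s)+e_s(f\circ\widetilde x_s)\bigr)^2e^{-f\circ\widetilde x_s}\,dA_{\widetilde x_s^*g},$$ where $e_s(f\circ\widetilde x_s)=df(e_s)$ along $\widetilde x_s$, and the derivative at the endpoint $s=-\log T$ is the right derivative. -/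

import Mathlib

open scoped Manifold ContDiff
open MeasureTheory Set

noncomputable section

namespace ExtRicciMCF

/-! ## Riemannian metrics in charts

All manifolds are smooth, finite-dimensional and without boundary, modelled on Euclidean spaces.
Mathlib identifies the tangent space at `x` with the model space by means of the preferred chart
`extChartAt (𝓡 n) x` at `x`. Hence the coordinate vector fields of that chart are, at the point `x`
itself, the standard basis vectors, and tensors at `x` can be evaluated in that chart. -/

/-- Smooth Riemannian metrics on an `n`-dimensional smooth manifold `M`. -/
abbrev Metric (n : ℕ) (M : Type*) [TopologicalSpace M] [ChartedSpace (EuclideanSpace ℝ (Fin n)) M]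
    [IsManifold (𝓡 n) ∞ M] :=
  Bundle.ContMDiffRiemannianMetric (𝓡 n) ∞ (EuclideanSpace ℝ (Fin n))
    (fun x : M => TangentSpace (𝓡 n) x)

/-- The standard basis vector `e_i` of `ℝⁿ`. -/
abbrev basisVec {n : ℕ} (i : Fin n) : EuclideanSpace ℝ (Fin n) := EuclideanSpace.single i 1

/-- The `i`-th partial derivative of a real function on `ℝⁿ`. -/
def pd {n : ℕ} (i : Fin n) (u : EuclideanSpace ℝ (Fin n) → ℝ) (y : EuclideanSpace ℝ (Fin n)) : ℝ :=
  fderiv ℝ u y (basisVec i)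

section Manifold

variable {n : ℕ} {M : Type*} [TopologicalSpace M] [ChartedSpace (EuclideanSpace ℝ (Fin n)) M]

/-- The differential of a real function, as a function on tangent vectors. -/
def diff (u : M → ℝ) (x : M) (v : TangentSpace (𝓡 n) x) : ℝ :=
  (mfderiv (𝓡 n) 𝓘(ℝ, ℝ) u x v : ℝ)

/-- The tangent vector at `x` with components `a` in the preferred chart at `x`. -/
def vecOf (x : M) (a : Fin n → ℝ) : TangentSpace (𝓡 n) x :=
  (WithLp.toLp 2 a : EuclideanSpace ℝ (Fin n))

/-- The components of a tangent vector at `x` in the preferred chart at `x`. -/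
def comps {x : M} (v : TangentSpace (𝓡 n) x) (i : Fin n) : ℝ :=
  (show EuclideanSpace ℝ (Fin n) from v) i

variable [IsManifold (𝓡 n) ∞ M] (g : Metric n M)

/-- The pulled-back matrix `(F^* g)_{ij}` at the point with coordinates `y` in the
chart of `S` at `p`: the matrix of scalar products `g(∂_i F, ∂_j F)`. -/
def gram {m : ℕ} {S : Type*} [TopologicalSpace S] [ChartedSpace (EuclideanSpace ℝ (Fin m)) S]
    (F : S → M) (p : S) (y : EuclideanSpace ℝ (Fin m)) : Matrix (Fin m) (Fin m) ℝ :=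
  Matrix.of fun i j =>
    g.inner (F ((extChartAt (𝓡 m) p).symm y))
      (mfderiv (𝓡 m) (𝓡 n) (F ∘ (extChartAt (𝓡 m) p).symm) y (basisVec i))
      (mfderiv (𝓡 m) (𝓡 n) (F ∘ (extChartAt (𝓡 m) p).symm) y (basisVec j))

/-- The matrix `g_{ij}` at the point with coordinates `y` in the chart of `M` at `p`. -/
def coeff (p : M) (y : EuclideanSpace ℝ (Fin n)) : Matrix (Fin n) (Fin n) ℝ := gram g id p y

/-- The Christoffel symbol
`Γ^k_{ij} = ½ ∑_l g^{kl} (∂_i g_{jl} + ∂_j g_{il} - ∂_l g_{ij})` of the Levi-Civita connection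
in the chart at `p`. -/
def christoffel (p : M) (k i j : Fin n) (y : EuclideanSpace ℝ (Fin n)) : ℝ :=
  (1 / 2) * ∑ l, (coeff g p y)⁻¹ k l *
    (pd i (fun z => coeff g p z j l) y + pd j (fun z => coeff g p z i l) y
      - pd l (fun z => coeff g p z i j) y)

/-- The component
`R_{ij} = ∑_k (∂_k Γ^k_{ij} - ∂_j Γ^k_{ik}) + ∑_{k,l} (Γ^k_{kl} Γ^l_{ij} - Γ^k_{jl} Γ^l_{ik})`
of the Ricci tensor in the chart at `p`. -/
def ricciCoeff (p : M) (i j : Fin n) (y : EuclideanSpace ℝ (Fin n)) : ℝ :=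
  (∑ k, (pd k (christoffel g p k i j) y - pd j (christoffel g p k i k) y)) +
    ∑ k, ∑ l, (christoffel g p k k l y * christoffel g p l i j y
      - christoffel g p k j l y * christoffel g p l i k y)

/-- The Ricci tensor `Ric_g`. -/
def ricci (x : M) (u v : TangentSpace (𝓡 n) x) : ℝ :=
  ∑ i, ∑ j, comps u i * comps v j * ricciCoeff g x i j (extChartAt (𝓡 n) x x)

/-- The gradient `∇_g u`, with components `∑_j g^{ij} ∂_j u`. -/
def grad (u : M → ℝ) (x : M) : TangentSpace (𝓡 n) x :=
  vecOf x fun i => ∑ j, (coeff g x (extChartAt (𝓡 n) x x))⁻¹ i j *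
    pd j (u ∘ (extChartAt (𝓡 n) x).symm) (extChartAt (𝓡 n) x x)

/-- The Laplacian `Δ_g u = ∑_{i,j} g^{ij} (∂_i ∂_j u - ∑_k Γ^k_{ij} ∂_k u)`, the trace of the
Hessian `∇_g² u`. -/
def laplacian (u : M → ℝ) (x : M) : ℝ :=
  ∑ i, ∑ j, (coeff g x (extChartAt (𝓡 n) x x))⁻¹ i j *
    (pd i (pd j (u ∘ (extChartAt (𝓡 n) x).symm)) (extChartAt (𝓡 n) x x)
      - ∑ k, christoffel g x k i j (extChartAt (𝓡 n) x x) *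
          pd k (u ∘ (extChartAt (𝓡 n) x).symm) (extChartAt (𝓡 n) x x))

/-! ## Extended Ricci flow and its shrinking self-similar solutions -/

/-- `(gt(t), wt(t))`, `t ∈ J`, is a smooth solution to the extended Ricci flow
`∂_t g = -2 Ric_g + 2 α_n dw ⊗ dw`, `∂_t w = Δ_g w`, where `α_n = (n - 1)/(n - 2)`. -/
structure IsExtendedRicciFlow (gt : ℝ → Metric n M) (wt : ℝ → M → ℝ) (J : Set ℝ) : Prop where
  smooth_metric : ∀ (p : M) (i j : Fin n),
    ContDiffOn ℝ ∞ (fun z : ℝ × EuclideanSpace ℝ (Fin n) => coeff (gt z.1) p z.2 i j)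
      (J ×ˢ (extChartAt (𝓡 n) p).target)
  smooth_function : ContMDiffOn (𝓘(ℝ, ℝ).prod (𝓡 n)) 𝓘(ℝ, ℝ) ∞
    (fun z : ℝ × M => wt z.1 z.2) (J ×ˢ univ)
  metric_eq : ∀ t ∈ J, ∀ (x : M) (u v : TangentSpace (𝓡 n) x),
    HasDerivWithinAt (fun τ => (gt τ).inner x u v)
      (-2 * ricci (gt t) x u v
        + 2 * (((n : ℝ) - 1) / ((n : ℝ) - 2)) * (diff (wt t) x u * diff (wt t) x v)) J t
  function_eq : ∀ t ∈ J, ∀ x : M,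
    HasDerivWithinAt (fun τ => wt τ x) (laplacian (gt t) (wt t) x) J t

/-- `(gbar(t), wbar(t))`, `t ∈ (-∞, T)`, is a shrinking self-similar solution to the extended Ricci
flow with initial value `(g, w)` and potential function `fbar(t) = f ∘ ψ_t`: it solves the extended
Ricci flow, and `gbar(t) = (T - t) ψ_t^* g`, `wbar(t) = ψ_t^* w`, where `ψ_t` is the smooth family
of diffeomorphisms generated from the flow of `∇_g f / (T - t)`. Values at times `t ≥ T` are
irrelevant. -/
structure IsShrinkingSelfSimilarSolution (g : Metric n M) (w f : M → ℝ) (T : ℝ)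
    (ψ : ℝ → Diffeomorph (𝓡 n) (𝓡 n) M M ∞) (gbar : ℝ → Metric n M) (wbar : ℝ → M → ℝ) :
    Prop where
  smooth_w : ContMDiff (𝓡 n) 𝓘(ℝ, ℝ) ∞ w
  smooth_f : ContMDiff (𝓡 n) 𝓘(ℝ, ℝ) ∞ f
  smooth_flow : ContMDiffOn (𝓘(ℝ, ℝ).prod (𝓡 n)) (𝓡 n) ∞ (fun z : ℝ × M => ψ z.1 z.2)
    (Iio T ×ˢ univ)
  /-- the flow starts from the identity at some time `t₀` -/
  flow_id : ∃ t₀ < T, ∀ x : M, ψ t₀ x = x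
  /-- `∂_t ψ_t = (∇_g f / (T - t)) ∘ ψ_t` -/
  flow_eq : ∀ t < T, ∀ x : M,
    mfderiv 𝓘(ℝ, ℝ) (𝓡 n) (fun τ : ℝ => ψ τ x) t (1 : ℝ) = (1 / (T - t)) • grad g f (ψ t x)
  metric_eq : ∀ t < T, ∀ (x : M) (u v : TangentSpace (𝓡 n) x),
    (gbar t).inner x u v = (T - t) *
      g.inner (ψ t x) (mfderiv (𝓡 n) (𝓡 n) (ψ t) x u) (mfderiv (𝓡 n) (𝓡 n) (ψ t) x v)
  function_eq : ∀ t < T, ∀ x : M, wbar t x = w (ψ t x)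
  isFlow : IsExtendedRicciFlow gbar wbar (Iio T)

/-! ## Immersions, unit normals, mean curvature and the induced measure -/

/-- The covariant derivative `∇_{∂_i} ∂_j F` along `F : S → (M, g)` of the coordinate fields of the
preferred chart of `S` at `p`, evaluated at `p`. In the preferred chart of `M` at `F p` its `k`-th
component is `∂_i ∂_j F^k + ∑_{a,b} Γ^k_{ab}(F) ∂_i F^a ∂_j F^b`. -/
def covDeriv {m : ℕ} {S : Type*} [TopologicalSpace S]
    [ChartedSpace (EuclideanSpace ℝ (Fin m)) S] (F : S → M) (p : S) (i j : Fin m) : TangentSpace (𝓡 n) (F p) :=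
  let Fc : Fin n → EuclideanSpace ℝ (Fin m) → ℝ := fun k y =>
    (extChartAt (𝓡 n) (F p) (F ((extChartAt (𝓡 m) p).symm y)) : EuclideanSpace ℝ (Fin n)) k
  let y : EuclideanSpace ℝ (Fin m) := extChartAt (𝓡 m) p p
  vecOf (F p) fun k => pd i (pd j (Fc k)) y +
    ∑ a, ∑ b, christoffel g (F p) k a b (extChartAt (𝓡 n) (F p) (F p)) *
      pd i (Fc a) y * pd j (Fc b) y

/-- The mean curvature at `p` of the immersion `F : S → (M, g)` with respect to a normal vector `e`
at `F p`: the trace, with respect to `F^* g`, of the scalar-valued second fundamental form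
`(∂_i, ∂_j) ↦ g(∇_{∂_i} ∂_j F, e)`. For a unit normal `e` of a hypersurface, the product
`meanCurvature g m F p e • e` is the mean curvature vector, which does not depend on the choice
between `e` and `-e`. -/
def meanCurvature (m : ℕ) {S : Type*} [TopologicalSpace S]
    [ChartedSpace (EuclideanSpace ℝ (Fin m)) S] (F : S → M) (p : S) (e : TangentSpace (𝓡 n) (F p)) : ℝ :=
  ∑ i, ∑ j, (gram g F p (extChartAt (𝓡 m) p p))⁻¹ i j * g.inner (F p) (covDeriv g F p i j) e

/-- `e` is a unit normal vector at `p` of the immersed hypersurface `F : S → (M, g)`. -/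
def IsUnitNormal (m : ℕ) {S : Type*} [TopologicalSpace S]
    [ChartedSpace (EuclideanSpace ℝ (Fin m)) S] (F : S → M) (p : S) (e : TangentSpace (𝓡 n) (F p)) : Prop :=
  g.inner (F p) e e = 1 ∧
    ∀ v : TangentSpace (𝓡 m) p, g.inner (F p) e (mfderiv (𝓡 m) (𝓡 n) F p v) = 0

/-- The measure `√(det (F^* g)_{ij}) dy` in the chart of `S` at `p`, transported to `S`. It is
carried by the domain of that chart. -/
def chartMeasure (m : ℕ) {S : Type*} [TopologicalSpace S]
    [ChartedSpace (EuclideanSpace ℝ (Fin m)) S] [MeasurableSpace S] (F : S → M) (p : S) : Measure S :=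
  Measure.map (extChartAt (𝓡 m) p).symm
    ((volume.restrict (extChartAt (𝓡 m) p).target).withDensity
      fun y => ENNReal.ofReal (Real.sqrt (gram g F p y).det))

/-- The Riemannian measure `dA_{F^* g}` on `S`. The chart measures agree on the overlaps of chart
domains, so their supremum is the Borel measure on `S` that coincides on the domain of each chart
with `√(det (F^* g)_{ij}) dy`. -/
def areaMeasure (m : ℕ) {S : Type*} [TopologicalSpace S]
    [ChartedSpace (EuclideanSpace ℝ (Fin m)) S] [MeasurableSpace S] (F : S → M) : Measure S :=
  ⨆ p : S, chartMeasure g m F p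

/-! ## Mean curvature flow -/

/-- The smooth family of immersions `x_t : S → M`, `t ∈ [0, T)`, evolves by mean curvature,
`∂_t x = H e`, in the ambient metrics `gt(t)`, where `e` is the unit normal and `H` the mean
curvature of `x_t` in `(M, gt(t))`. At `t = 0` the time derivative is one-sided. -/
structure IsMeanCurvatureFlow (m : ℕ) {S : Type*} [TopologicalSpace S]
    [ChartedSpace (EuclideanSpace ℝ (Fin m)) S] (gt : ℝ → Metric n M) (T : ℝ) (x : ℝ → S → M)
    (e : ∀ (t : ℝ) (p : S), TangentSpace (𝓡 n) (x t p)) : Prop where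
  smooth : ContMDiffOn (𝓘(ℝ, ℝ).prod (𝓡 m)) (𝓡 n) ∞ (fun z : ℝ × S => x z.1 z.2)
    (Ico 0 T ×ˢ univ)
  immersion : ∀ t ∈ Ico 0 T, ∀ p : S, Function.Injective (mfderiv (𝓡 m) (𝓡 n) (x t) p)
  unit_normal : ∀ t ∈ Ico 0 T, ∀ p : S, IsUnitNormal (gt t) m (x t) p (e t p)
  evolution : ∀ t ∈ Ico 0 T, ∀ p : S,
    mfderivWithin 𝓘(ℝ, ℝ) (𝓡 n) (fun τ : ℝ => x τ p) (Ico 0 T) t (1 : ℝ)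
      = meanCurvature (gt t) m (x t) p (e t p) • e t p

/-- The normalized mean curvature flow `x̃_s = ψ_t ∘ x_t`, where `s = -log (T - t)`, that is,
`t = T - exp (-s)`. -/
def normalizedFlow {S : Type*} (T : ℝ) (ψ : ℝ → Diffeomorph (𝓡 n) (𝓡 n) M M ∞) (x : ℝ → S → M) (s : ℝ) :
    S → M :=
  fun p => ψ (T - Real.exp (-s)) (x (T - Real.exp (-s)) p)

end Manifold

end ExtRicciMCF

end

/-! The normalized flow `X s = ψ_t ∘ x_t` is a mean curvature flow with drift in the fixed metric
`g`. Since `dt/ds = exp (-s) = T - t`, the chain rule gives the velocity `∇f + (T - t) • H̄ •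
dψ_t(e)`. As `gbar t = (T - t) ψ_t^* g`, the vector `dψ_t(e)` is normal and equals `c • ν` with `(T
- t) c² = 1`. Mean curvature scales so that `H̄ = c H`, hence the velocity is `∇f + H ν`
(`normalizedFlow_evolution`). The sign of `c` occurs twice and cancels.

The rest is a first variation formula for such drifted flows. In a chart of the hypersurface let `G`
be the Gram matrix, `h` the second fundamental form, `U = f ∘ X`, `q = df(ν)` and `D = exp (-U)
√(det G)`. The tangential part of the velocity is the gradient of `U`, the normal part is `(H + q)
ν`. The Koszul formula for the metric pulled back to time × space (`koszul_pairing`) gives `∂_s G =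
2 Hess U - 2 (H + q) h`, and `∂_s U = |∇U|² + (H + q) q`. Taking the trace, `∂_s D = D (ΔU - |∇U|²)
- (H + q)² D`, and the first term is the coordinate divergence `∑ ∂_i (D G^{ij} ∂_j U)`
(`fderiv_weightedDensity_eq_divergence`, `fderiv_familyDensity`).

Globally, the integrals are split by a partition of unity `ρ k`. Integration by parts turns the
divergence terms into integrals of `exp (-U) ⟨∇ρ k, ∇U⟩`, whose sum vanishes because `∑ ρ k = 1`
(`sum_integral_fderiv_chartCutoff_eq_zero`).

Two points need care. The normal `ν` is chosen pointwise, with no regularity, so `(H + q)²` is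
rewritten as the squared velocity minus its squared tangential part (`normalSpeedSq_eq`), which is
manifestly smooth. At the initial time, area and its derivative are continuous up to the endpoint,
and the right derivative is obtained as a limit. -/

noncomputable section

namespace ExtRicciMCF

/-! ### Pullbacks of the metric and their smoothness. -/

section Pairing

variable {n : ℕ} {M : Type*} [TopologicalSpace M] [ChartedSpace (EuclideanSpace ℝ (Fin n)) M]
  [IsManifold (𝓡 n) ∞ M] (g : Metric n M)
  {P : Type*} [NormedAddCommGroup P] [NormedSpace ℝ P]
  {P' : Type*} [NormedAddCommGroup P'] [NormedSpace ℝ P']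

/-- The pullback of the metric along `Y : P → M` relative to the set `s`. -/
def pairingWithin (Y : P → M) (s : Set P) (z : P) (α β : P) : ℝ :=
  g.inner (Y z) (mfderivWithin 𝓘(ℝ, P) (𝓡 n) Y s z α) (mfderivWithin 𝓘(ℝ, P) (𝓡 n) Y s z β)

/-- The pullback of the metric along `Y : P → M`. -/
def pairing (Y : P → M) (z : P) (α β : P) : ℝ :=
  g.inner (Y z) (mfderiv 𝓘(ℝ, P) (𝓡 n) Y z α) (mfderiv 𝓘(ℝ, P) (𝓡 n) Y z β)

lemma two_le_infty : (2 : WithTop ℕ∞) ≤ ∞ := by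
  have : ((2 : ℕ∞) : WithTop ℕ∞) ≤ ((⊤ : ℕ∞) : WithTop ℕ∞) := WithTop.coe_le_coe.2 le_top
  exact this

lemma one_add_one_le_infty : (1 : WithTop ℕ∞) + 1 ≤ ∞ := by
  rw [one_add_one_eq_two]; exact two_le_infty

/-- The derivative of `Y` in a constant direction is the tangent map composed with a constant
section, so both arguments of the metric are smooth fields along `Y`. The version relative to `s` is
what survives at the initial time of the flow. -/
lemma contDiffOn_pairingWithin {Y : P → M} {s : Set P} (hs : UniqueDiffOn ℝ s)
    (hY : ContMDiffOn 𝓘(ℝ, P) (𝓡 n) ∞ Y s) (α β : P) :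
    ContDiffOn ℝ ∞ (fun z => pairingWithin g Y s z α β) s := by
  have key : ∀ γ : P, ContMDiffOn 𝓘(ℝ, P) (𝓡 n).tangent ∞
      (fun z => (⟨Y z, mfderivWithin 𝓘(ℝ, P) (𝓡 n) Y s z γ⟩ : TangentBundle (𝓡 n) M)) s := by
    intro γ
    have h1 := hY.contMDiffOn_tangentMapWithin (m := ∞) (by simp) hs.uniqueMDiffOn
    have h2 : ContMDiff 𝓘(ℝ, P) 𝓘(ℝ, P).tangent ∞
        (fun z => (⟨z, γ⟩ : TangentBundle 𝓘(ℝ, P) P)) :=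
      contMDiff_vectorSpace_iff_contDiff.2 contDiff_const
    exact h1.comp h2.contMDiffOn (fun z hz => hz)
  intro z hz
  have hg := g.contMDiff
  have this : ContMDiffWithinAt 𝓘(ℝ, P) ((𝓡 n).prod 𝓘(ℝ)) ∞
      (fun z ↦ Bundle.TotalSpace.mk' ℝ (E := Bundle.Trivial M ℝ) (Y z)
        (pairingWithin g Y s z α β)) s z := by
    apply ContMDiffWithinAt.clm_bundle_apply₂ (F₁ := EuclideanSpace ℝ (Fin n))
      (F₂ := EuclideanSpace ℝ (Fin n))
    · exact ContMDiffAt.comp_contMDiffWithinAt z hg.contMDiffAt (hY z hz)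
    · exact key α z hz
    · exact key β z hz
  rw [Bundle.contMDiffWithinAt_totalSpace] at this
  exact this.2.contDiffWithinAt

lemma contDiffOn_pairing {Y : P → M} {s : Set P} (hs : IsOpen s)
    (hY : ContMDiffOn 𝓘(ℝ, P) (𝓡 n) ∞ Y s) (α β : P) :
    ContDiffOn ℝ ∞ (fun z => pairing g Y z α β) s := by
  refine (contDiffOn_pairingWithin g hs.uniqueDiffOn hY α β).congr fun z hz => ?_
  simp only [pairing, pairingWithin, mfderivWithin_of_isOpen hs hz]

/-- The metric of `M` in the chart at `q`, as a function with values in the bilinear forms. -/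
def chartForm (q : M) (z : EuclideanSpace ℝ (Fin n)) :
    EuclideanSpace ℝ (Fin n) →L[ℝ] EuclideanSpace ℝ (Fin n) →L[ℝ] ℝ :=
  ContinuousLinearMap.bilinearComp
    (show EuclideanSpace ℝ (Fin n) →L[ℝ] EuclideanSpace ℝ (Fin n) →L[ℝ] ℝ from
      g.inner ((extChartAt (𝓡 n) q).symm z))
    (mfderiv 𝓘(ℝ, EuclideanSpace ℝ (Fin n)) (𝓡 n) (extChartAt (𝓡 n) q).symm z)
    (mfderiv 𝓘(ℝ, EuclideanSpace ℝ (Fin n)) (𝓡 n) (extChartAt (𝓡 n) q).symm z)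

lemma chartForm_apply (q : M) (z u v : EuclideanSpace ℝ (Fin n)) :
    chartForm g q z u v = pairing g (extChartAt (𝓡 n) q).symm z u v := rfl

lemma chartForm_basisVec (q : M) (z : EuclideanSpace ℝ (Fin n)) (i j : Fin n) :
    chartForm g q z (basisVec i) (basisVec j) = coeff g q z i j := rfl

lemma chartForm_symm (q : M) (z u v : EuclideanSpace ℝ (Fin n)) :
    chartForm g q z u v = chartForm g q z v u := g.symm _ _ _

lemma contDiffOn_chartForm (q : M) :
    ContDiffOn ℝ ∞ (chartForm g q) (extChartAt (𝓡 n) q).target := by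
  rw [contDiffOn_clm_apply]
  intro u
  rw [contDiffOn_clm_apply]
  intro v
  exact contDiffOn_pairing g (isOpen_extChartAt_target q) (contMDiffOn_extChartAt_symm q) u v

/-- The tangent space at `q` is identified with the model space through this very chart, so the
inverse chart has identity derivative at the centre. -/
lemma mfderiv_extChartAt_symm_self (q : M) (v : EuclideanSpace ℝ (Fin n)) :
    mfderiv 𝓘(ℝ, EuclideanSpace ℝ (Fin n)) (𝓡 n) (extChartAt (𝓡 n) q).symm
      (extChartAt (𝓡 n) q q) v = v := by
  have := mfderivWithin_range_extChartAt_symm (I := 𝓡 n) (x := q)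
  simp only [ModelWithCorners.range_eq_univ, mfderivWithin_univ] at this
  rw [this]; rfl

lemma chartForm_self (q : M) (u v : EuclideanSpace ℝ (Fin n)) :
    chartForm g q (extChartAt (𝓡 n) q q) u v =
      g.inner q (u : TangentSpace (𝓡 n) q) (v : TangentSpace (𝓡 n) q) := by
  rw [chartForm_apply, pairing, mfderiv_extChartAt_symm_self, mfderiv_extChartAt_symm_self]
  rw [extChartAt_to_inv]

end Pairing

/-! ### Christoffel symbols at the centre of a chart. -/

section Koszul

variable {n : ℕ} {M : Type*} [TopologicalSpace M] [ChartedSpace (EuclideanSpace ℝ (Fin n)) M]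
  [IsManifold (𝓡 n) ∞ M] (g : Metric n M)
  {P : Type*} [NormedAddCommGroup P] [NormedSpace ℝ P]
  {P' : Type*} [NormedAddCommGroup P'] [NormedSpace ℝ P']

lemma map_eq_sum_basisVec {n : ℕ} {W : Type*} [NormedAddCommGroup W] [NormedSpace ℝ W]
    (L : EuclideanSpace ℝ (Fin n) →L[ℝ] W) (u : EuclideanSpace ℝ (Fin n)) :
    L u = ∑ i, u i • L (basisVec i) := by
  conv_lhs => rw [← (EuclideanSpace.basisFun (Fin n) ℝ).sum_repr u]
  simp

lemma posDef_of_linearIndependent {V ι : Type*} [Fintype ι] [DecidableEq ι]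
    [NormedAddCommGroup V] [NormedSpace ℝ V] (B : V →L[ℝ] V →L[ℝ] ℝ) (hs : ∀ u v, B u v = B v u)
    (hp : ∀ u, u ≠ 0 → 0 < B u u) {v : ι → V} (hv : LinearIndependent ℝ v) :
    (Matrix.of fun i j => B (v i) (v j)).PosDef := by
  refine Matrix.PosDef.of_dotProduct_mulVec_pos ?_ fun x hx => ?_
  · ext i j
    simp [Matrix.conjTranspose_apply, hs (v j)]
  · have h : star x ⬝ᵥ ((Matrix.of fun i j => B (v i) (v j)).mulVec x)
        = B (∑ i, x i • v i) (∑ j, x j • v j) := by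
      simp only [map_sum, map_smul, _root_.sum_apply, _root_.smul_apply, dotProduct,
        Matrix.mulVec, Matrix.of_apply, Finset.mul_sum, smul_eq_mul, star_trivial]
      refine Finset.sum_congr rfl fun i _ => Finset.sum_congr rfl fun j _ => ?_
      rw [hs (v j)]; ring
    rw [h]
    refine hp _ fun h0 => hx ?_
    ext i
    exact Fintype.linearIndependent_iff.1 hv x h0 i

lemma fderiv_chartForm (q : M) {z : EuclideanSpace ℝ (Fin n)}
    (hz : z ∈ (extChartAt (𝓡 n) q).target) (i j l : Fin n) :
    pd i (fun y => coeff g q y j l) z =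
      fderiv ℝ (chartForm g q) z (basisVec i) (basisVec j) (basisVec l) := by
  have hd : HasFDerivAt (chartForm g q) (fderiv ℝ (chartForm g q) z) z :=
    (((contDiffOn_chartForm g q).contDiffAt
      ((isOpen_extChartAt_target q).mem_nhds hz)).differentiableAt (by simp)).hasFDerivAt
  have h2 := (hd.clm_apply (hasFDerivAt_const (basisVec j) z)).clm_apply
    (hasFDerivAt_const (basisVec l) z)
  rw [pd]
  have : (fun y => coeff g q y j l) = fun y => chartForm g q y (basisVec j) (basisVec l) := rfl
  rw [this, h2.fderiv]
  simp

lemma isUnit_det_coeff (q : M) : IsUnit (coeff g q (extChartAt (𝓡 n) q q)).det := by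
  have hB := posDef_of_linearIndependent (chartForm g q (extChartAt (𝓡 n) q q))
    (fun u v => chartForm_symm g q _ u v)
    (fun u hu => by
      rw [chartForm_self]
      exact g.pos q _ hu)
    (EuclideanSpace.basisFun (Fin n) ℝ).toBasis.linearIndependent
  have : coeff g q (extChartAt (𝓡 n) q q) = Matrix.of fun i j =>
      chartForm g q (extChartAt (𝓡 n) q q) ((EuclideanSpace.basisFun (Fin n) ℝ).toBasis i)
        ((EuclideanSpace.basisFun (Fin n) ℝ).toBasis j) := by
    ext i j
    simp [← chartForm_basisVec]
  rw [this]
  exact hB.det_pos.ne'.isUnit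

/-- The Christoffel symbols in the chart at `q`, as a vector-valued bilinear map. -/
def christoffelVec (q : M) (z u v : EuclideanSpace ℝ (Fin n)) : EuclideanSpace ℝ (Fin n) :=
  WithLp.toLp 2 fun k => ∑ a, ∑ b, christoffel g q k a b z * u a * v b

/-- Lowering the upper index cancels the inverse matrix in the definition of the Christoffel symbol.
-/
lemma sum_christoffel_mul_coeff (q : M) (a b r : Fin n) :
    ∑ k, christoffel g q k a b (extChartAt (𝓡 n) q q) * coeff g q (extChartAt (𝓡 n) q q) k r =
      (1 / 2) * (pd a (fun z => coeff g q z b r) (extChartAt (𝓡 n) q q)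
        + pd b (fun z => coeff g q z a r) (extChartAt (𝓡 n) q q)
        - pd r (fun z => coeff g q z a b) (extChartAt (𝓡 n) q q)) := by
  set z := extChartAt (𝓡 n) q q
  set K : Fin n → ℝ := fun l => pd a (fun z => coeff g q z b l) z
        + pd b (fun z => coeff g q z a l) z - pd l (fun z => coeff g q z a b) z with hK
  have h1 : ∀ k, christoffel g q k a b z * coeff g q z k r =
      (1 / 2) * ∑ l, K l * (coeff g q z r k * (coeff g q z)⁻¹ k l) := by
    intro k
    have : coeff g q z k r = coeff g q z r k := chartForm_symm g q z _ _
    rw [christoffel, this, mul_assoc, Finset.sum_mul]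
    congr 1
    refine Finset.sum_congr rfl fun l _ => ?_
    simp only [hK]; ring
  simp_rw [h1]
  rw [← Finset.mul_sum, Finset.sum_comm]
  congr 1
  have h2 : ∀ l, ∑ k, coeff g q z r k * (coeff g q z)⁻¹ k l = if r = l then 1 else 0 := by
    intro l
    rw [← Matrix.mul_apply, Matrix.mul_nonsing_inv _ (isUnit_det_coeff g q), Matrix.one_apply]
  simp_rw [← Finset.mul_sum, h2]
  simp [hK]

/-- Both sides are trilinear in `u`, `v`, `w`; on basis vectors this is `sum_christoffel_mul_coeff`.
-/
lemma chartForm_christoffelVec (q : M) (u v w : EuclideanSpace ℝ (Fin n)) :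
    2 * chartForm g q (extChartAt (𝓡 n) q q) (christoffelVec g q (extChartAt (𝓡 n) q q) u v) w =
      fderiv ℝ (chartForm g q) (extChartAt (𝓡 n) q q) u v w
      + fderiv ℝ (chartForm g q) (extChartAt (𝓡 n) q q) v u w
      - fderiv ℝ (chartForm g q) (extChartAt (𝓡 n) q q) w u v := by
  have hz := mem_extChartAt_target (I := 𝓡 n) q
  set z := extChartAt (𝓡 n) q q with hz'
  set D := fderiv ℝ (chartForm g q) z with hD
  have tri : ∀ x y t, D x y t = ∑ a, ∑ b, ∑ r, x a * y b * t r *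
      D (basisVec a) (basisVec b) (basisVec r) := by
    intro x y t
    rw [map_eq_sum_basisVec (W := EuclideanSpace ℝ (Fin n) →L[ℝ] EuclideanSpace ℝ (Fin n) →L[ℝ] ℝ) D x, _root_.sum_apply, _root_.sum_apply]
    refine Finset.sum_congr rfl fun a _ => ?_
    rw [_root_.smul_apply, _root_.smul_apply,
      map_eq_sum_basisVec (W := EuclideanSpace ℝ (Fin n) →L[ℝ] ℝ)
        (D (basisVec a)) y, _root_.sum_apply, Finset.smul_sum]
    refine Finset.sum_congr rfl fun b _ => ?_
    rw [_root_.smul_apply,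
      map_eq_sum_basisVec (D (basisVec a) (basisVec b)) t, Finset.smul_sum, Finset.smul_sum]
    refine Finset.sum_congr rfl fun r _ => ?_
    simp only [smul_eq_mul]; ring
  have lhs : chartForm g q z (christoffelVec g q z u v) w =
      ∑ a, ∑ b, ∑ r, u a * v b * w r * ∑ k, christoffel g q k a b z * coeff g q z k r := by
    rw [map_eq_sum_basisVec (W := EuclideanSpace ℝ (Fin n) →L[ℝ] ℝ) (chartForm g q z), _root_.sum_apply]
    simp_rw [_root_.smul_apply]
    have : ∀ k, (christoffelVec g q z u v) k • (chartForm g q z (basisVec k)) w =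
        ∑ a, ∑ b, ∑ r, u a * v b * w r * (christoffel g q k a b z * coeff g q z k r) := by
      intro k
      rw [map_eq_sum_basisVec (chartForm g q z (basisVec k)) w]
      simp only [christoffelVec, smul_eq_mul, Finset.sum_mul]
      refine Finset.sum_congr rfl fun a _ => Finset.sum_congr rfl fun b _ => ?_
      rw [Finset.mul_sum]
      refine Finset.sum_congr rfl fun r _ => ?_
      rw [chartForm_basisVec]; ring
    simp_rw [this, Finset.mul_sum]
    rw [Finset.sum_comm]
    refine Finset.sum_congr rfl fun a _ => ?_
    rw [Finset.sum_comm]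
    refine Finset.sum_congr rfl fun b _ => ?_
    rw [Finset.sum_comm]
  rw [lhs]
  simp_rw [hz', sum_christoffel_mul_coeff, ← hz', fderiv_chartForm g q hz, ← hD]
  rw [tri u v w, tri v u w, tri w u v]
  rw [Finset.sum_comm (f := fun a b => ∑ r, v a * u b * w r * _)]
  have e3 : (∑ a, ∑ b, ∑ r, w a * u b * v r * D (basisVec a) (basisVec b) (basisVec r)) =
      ∑ a, ∑ b, ∑ r, u a * v b * w r * D (basisVec r) (basisVec a) (basisVec b) := by
    rw [Finset.sum_comm]
    refine Finset.sum_congr rfl fun a _ => ?_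
    rw [Finset.sum_comm]
    refine Finset.sum_congr rfl fun b _ => Finset.sum_congr rfl fun r _ => ?_
    ring
  rw [e3]
  simp_rw [Finset.mul_sum, ← Finset.sum_add_distrib, ← Finset.sum_sub_distrib]
  refine Finset.sum_congr rfl fun a _ => Finset.sum_congr rfl fun b _ =>
    Finset.sum_congr rfl fun r _ => ?_
  ring

end Koszul

/-! ### Covariant derivatives along maps and the Koszul formula. -/

section PullbackKoszul

open Filter Topology

variable {n : ℕ} {M : Type*} [TopologicalSpace M] [ChartedSpace (EuclideanSpace ℝ (Fin n)) M]
  {P : Type*} [NormedAddCommGroup P] [NormedSpace ℝ P]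
  {P' : Type*} [NormedAddCommGroup P'] [NormedSpace ℝ P']

/-- The representation of `Y : P → M` in the chart of `M` at `q`. -/
def chartRep (n : ℕ) {M : Type*} [TopologicalSpace M]
    [ChartedSpace (EuclideanSpace ℝ (Fin n)) M] {P : Type*} (q : M) (Y : P → M) (z : P) : EuclideanSpace ℝ (Fin n) := extChartAt (𝓡 n) q (Y z)

variable [IsManifold (𝓡 n) ∞ M] (g : Metric n M)

/-- The covariant derivative along `Y : P → M` at `z`, in the direction `α`, of the field
`dY(β)`. -/
def secondCov (Y : P → M) (z : P) (α β : P) : EuclideanSpace ℝ (Fin n) :=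
  fderiv ℝ (fun y => fderiv ℝ (chartRep n (Y z) Y) y β) z α +
    christoffelVec g (Y z) (extChartAt (𝓡 n) (Y z) (Y z))
      (fderiv ℝ (chartRep n (Y z) Y) z α) (fderiv ℝ (chartRep n (Y z) Y) z β)

lemma contDiffAt_chartRep {q : M} {Y : P → M} {z : P}
    (hY : ContMDiffAt 𝓘(ℝ, P) (𝓡 n) ∞ Y z) (hq : Y z ∈ (extChartAt (𝓡 n) q).source) :
    ContDiffAt ℝ ∞ (chartRep n q Y) z := by
  rw [extChartAt_source] at hq
  exact ((contMDiffAt_extChartAt' hq).comp z hY).contDiffAt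

lemma mfderiv_eq_chart {q : M} {Y : P → M} {z : P}
    (hY : ContMDiffAt 𝓘(ℝ, P) (𝓡 n) ∞ Y z) (hq : Y z ∈ (extChartAt (𝓡 n) q).source) (α : P) :
    mfderiv 𝓘(ℝ, P) (𝓡 n) Y z α =
      mfderiv 𝓘(ℝ, EuclideanSpace ℝ (Fin n)) (𝓡 n) (extChartAt (𝓡 n) q).symm (chartRep n q Y z)
        (fderiv ℝ (chartRep n q Y) z α) := by
  have hev : Y =ᶠ[𝓝 z] (extChartAt (𝓡 n) q).symm ∘ chartRep n q Y := by
    filter_upwards [hY.continuousAt.preimage_mem_nhds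
      ((isOpen_extChartAt_source q).mem_nhds hq)] with y hy
    exact ((extChartAt (𝓡 n) q).left_inv hy).symm
  have h1 : MDifferentiableAt 𝓘(ℝ, P) 𝓘(ℝ, EuclideanSpace ℝ (Fin n)) (chartRep n q Y) z :=
    ((contDiffAt_chartRep hY hq).differentiableAt (by simp)).mdifferentiableAt
  have h2 : MDifferentiableAt 𝓘(ℝ, EuclideanSpace ℝ (Fin n)) (𝓡 n) (extChartAt (𝓡 n) q).symm
      (chartRep n q Y z) := by
    refine ((contMDiffOn_extChartAt_symm (n := ∞) q).contMDiffAt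
      ((isOpen_extChartAt_target q).mem_nhds ?_)).mdifferentiableAt (by simp)
    exact (extChartAt (𝓡 n) q).map_source hq
  rw [hev.mfderiv_eq, mfderiv_comp z h2 h1, mfderiv_eq_fderiv]
  rfl

lemma mfderiv_eq_fderiv_chartRep {Y : P → M} {z : P}
    (hY : ContMDiffAt 𝓘(ℝ, P) (𝓡 n) ∞ Y z) (α : P) :
    mfderiv 𝓘(ℝ, P) (𝓡 n) Y z α = fderiv ℝ (chartRep n (Y z) Y) z α := by
  rw [mfderiv_eq_chart hY (mem_extChartAt_source (Y z)), chartRep, mfderiv_extChartAt_symm_self]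

lemma pairing_eq_chartForm {q : M} {Y : P → M} {z : P}
    (hY : ContMDiffAt 𝓘(ℝ, P) (𝓡 n) ∞ Y z) (hq : Y z ∈ (extChartAt (𝓡 n) q).source) (α β : P) :
    pairing g Y z α β = chartForm g q (chartRep n q Y z) (fderiv ℝ (chartRep n q Y) z α)
      (fderiv ℝ (chartRep n q Y) z β) := by
  rw [chartForm_apply, pairing, pairing, mfderiv_eq_chart hY hq, mfderiv_eq_chart hY hq]
  have : (extChartAt (𝓡 n) q).symm (chartRep n q Y z) = Y z := (extChartAt (𝓡 n) q).left_inv hq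
  rw [this]

lemma pairing_eventuallyEq_chartForm {Y : P → M} {z : P}
    (hY : ∀ᶠ y in 𝓝 z, ContMDiffAt 𝓘(ℝ, P) (𝓡 n) ∞ Y y) (α β : P) :
    (fun y => pairing g Y y α β) =ᶠ[𝓝 z] fun y => chartForm g (Y z) (chartRep n (Y z) Y y)
      (fderiv ℝ (chartRep n (Y z) Y) y α) (fderiv ℝ (chartRep n (Y z) Y) y β) := by
  filter_upwards [hY, hY.self_of_nhds.continuousAt.preimage_mem_nhds
      ((isOpen_extChartAt_source (I := 𝓡 n) (Y z)).mem_nhds (mem_extChartAt_source (Y z)))]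
    with y hy hy'
  exact pairing_eq_chartForm g hy hy' α β

/-- Product rule for the metric coefficients and the two first derivatives of `Y`, all read in the
chart at `Y z`. -/
lemma hasFDerivAt_pairing {Y : P → M} {z : P}
    (hY : ∀ᶠ y in 𝓝 z, ContMDiffAt 𝓘(ℝ, P) (𝓡 n) ∞ Y y) (α β γ : P) :
    fderiv ℝ (fun y => pairing g Y y α β) z γ =
      fderiv ℝ (chartForm g (Y z)) (extChartAt (𝓡 n) (Y z) (Y z))
          (fderiv ℝ (chartRep n (Y z) Y) z γ)
          (fderiv ℝ (chartRep n (Y z) Y) z α) (fderiv ℝ (chartRep n (Y z) Y) z β)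
        + chartForm g (Y z) (extChartAt (𝓡 n) (Y z) (Y z))
          (fderiv ℝ (fderiv ℝ (chartRep n (Y z) Y)) z γ α) (fderiv ℝ (chartRep n (Y z) Y) z β)
        + chartForm g (Y z) (extChartAt (𝓡 n) (Y z) (Y z))
          (fderiv ℝ (chartRep n (Y z) Y) z α) (fderiv ℝ (fderiv ℝ (chartRep n (Y z) Y)) z γ β) := by
  have hΦ := contDiffAt_chartRep hY.self_of_nhds (mem_extChartAt_source (I := 𝓡 n) (Y z))
  set Φ := chartRep n (Y z) Y
  have hB : DifferentiableAt ℝ (chartForm g (Y z)) (Φ z) :=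
    ((contDiffOn_chartForm g (Y z)).contDiffAt
      ((isOpen_extChartAt_target (Y z)).mem_nhds (mem_extChartAt_target _))).differentiableAt
        (by simp)
  have hΦ1 : HasFDerivAt Φ (fderiv ℝ Φ z) z := (hΦ.differentiableAt (by simp)).hasFDerivAt
  have hΦ2 : HasFDerivAt (fderiv ℝ Φ) (fderiv ℝ (fderiv ℝ Φ) z) z :=
    ((hΦ.fderiv_right (m := 1) one_add_one_le_infty).differentiableAt (by simp)).hasFDerivAt
  have h0 : HasFDerivAt (fun y => chartForm g (Y z) (Φ y))
      ((fderiv ℝ (chartForm g (Y z)) (Φ z)).comp (fderiv ℝ Φ z)) z :=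
    HasFDerivAt.comp (g := chartForm g (Y z)) (g' := fderiv ℝ (chartForm g (Y z)) (Φ z)) z
      hB.hasFDerivAt hΦ1
  have hα : HasFDerivAt (fun y => fderiv ℝ Φ y α) ((fderiv ℝ (fderiv ℝ Φ) z).flip α) z := by
    simpa using hΦ2.clm_apply (hasFDerivAt_const α z)
  have hβ : HasFDerivAt (fun y => fderiv ℝ Φ y β) ((fderiv ℝ (fderiv ℝ Φ) z).flip β) z := by
    simpa using hΦ2.clm_apply (hasFDerivAt_const β z)
  have h := (h0.clm_apply hα).clm_apply hβ
  rw [(pairing_eventuallyEq_chartForm g hY α β).fderiv_eq, h.fderiv]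
  simp only [_root_.add_apply, ContinuousLinearMap.comp_apply, ContinuousLinearMap.flip_apply]
  have : Φ z = extChartAt (𝓡 n) (Y z) (Y z) := rfl
  rw [← this]; ring

lemma secondCov_eq {Y : P → M} {z : P} (hY : ContMDiffAt 𝓘(ℝ, P) (𝓡 n) ∞ Y z) (α β : P) :
    secondCov g Y z α β = fderiv ℝ (fderiv ℝ (chartRep n (Y z) Y)) z α β +
    christoffelVec g (Y z) (extChartAt (𝓡 n) (Y z) (Y z))
      (fderiv ℝ (chartRep n (Y z) Y) z α) (fderiv ℝ (chartRep n (Y z) Y) z β) := by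
  have hΦ := contDiffAt_chartRep hY (mem_extChartAt_source (I := 𝓡 n) (Y z))
  have hΦ2 : DifferentiableAt ℝ (fderiv ℝ (chartRep n (Y z) Y)) z :=
    ((hΦ.fderiv_right (m := 1) one_add_one_le_infty).differentiableAt (by simp))
  have h := (hΦ2.hasFDerivAt.clm_apply (hasFDerivAt_const β z)).fderiv
  rw [secondCov, h]
  simp

lemma fderiv_fderiv_chartRep_symm {Y : P → M} {z : P}
    (hY : ContMDiffAt 𝓘(ℝ, P) (𝓡 n) ∞ Y z) (α β : P) :
    fderiv ℝ (fderiv ℝ (chartRep n (Y z) Y)) z α β =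
      fderiv ℝ (fderiv ℝ (chartRep n (Y z) Y)) z β α := by
  have hΦ := contDiffAt_chartRep hY (mem_extChartAt_source (I := 𝓡 n) (Y z))
  exact (hΦ.isSymmSndFDerivAt (by simpa using two_le_infty)).eq α β

/-- The Koszul formula for the pullback of the metric along `Y`. -/
lemma koszul_pairing {Y : P → M} {z : P}
    (hY : ∀ᶠ y in 𝓝 z, ContMDiffAt 𝓘(ℝ, P) (𝓡 n) ∞ Y y) (α β γ : P) :
    2 * g.inner (Y z) (secondCov g Y z α β : TangentSpace (𝓡 n) (Y z))
        (mfderiv 𝓘(ℝ, P) (𝓡 n) Y z γ) =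
      fderiv ℝ (fun y => pairing g Y y β γ) z α + fderiv ℝ (fun y => pairing g Y y α γ) z β
        - fderiv ℝ (fun y => pairing g Y y α β) z γ := by
  have hY0 := hY.self_of_nhds
  -- In the alternating sum the second derivatives in the directions `α, γ` and `β, γ` cancel by
  -- symmetry, the one in `α, β` appears twice, and the derivatives of the metric combine to the
  -- Christoffel term.
  rw [hasFDerivAt_pairing g hY, hasFDerivAt_pairing g hY, hasFDerivAt_pairing g hY,
    mfderiv_eq_fderiv_chartRep hY0, ← chartForm_self, secondCov_eq g hY0, map_add,
    _root_.add_apply, mul_add, chartForm_christoffelVec,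
    fderiv_fderiv_chartRep_symm hY0 β α, fderiv_fderiv_chartRep_symm hY0 γ α,
    fderiv_fderiv_chartRep_symm hY0 γ β,
    chartForm_symm g _ _ (fderiv ℝ (fderiv ℝ (chartRep n (Y z) Y)) z α γ)
      (fderiv ℝ (chartRep n (Y z) Y) z β)]
  ring

lemma secondCov_congr {Y Y' : P → M} {z : P} (h : Y =ᶠ[𝓝 z] Y') (α β : P) :
    secondCov g Y z α β = secondCov g Y' z α β := by
  have h0 := h.self_of_nhds
  have h1 : chartRep n (Y' z) Y =ᶠ[𝓝 z] chartRep n (Y' z) Y' := by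
    filter_upwards [h] with y hy
    simp [chartRep, hy]
  simp only [secondCov, h0]
  rw [h1.fderiv_eq, EventuallyEq.fderiv_eq (h1.fderiv.mono fun y hy => by rw [hy])]

/-- The failure of tensoriality is the image under `dY` of the second derivative of `τ`. It
disappears against a normal vector, and also when `τ` is affine; these are the two uses. -/
lemma secondCov_comp {Y : P → M} {τ : P' → P} {z : P'}
    (hY : ContMDiffAt 𝓘(ℝ, P) (𝓡 n) ∞ Y (τ z)) (hτ : ContDiffAt ℝ ∞ τ z) (α β : P') :
    secondCov g (Y ∘ τ) z α β = secondCov g Y (τ z) (fderiv ℝ τ z α) (fderiv ℝ τ z β) +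
      fderiv ℝ (chartRep n (Y (τ z)) Y) (τ z) (fderiv ℝ (fderiv ℝ τ) z α β) := by
  have hYτ : ContMDiffAt 𝓘(ℝ, P') (𝓡 n) ∞ (Y ∘ τ) z := hY.comp z hτ.contMDiffAt
  rw [secondCov_eq g hYτ, secondCov_eq g hY]
  have hΦ := contDiffAt_chartRep hY (mem_extChartAt_source (I := 𝓡 n) (Y (τ z)))
  have hc : chartRep n ((Y ∘ τ) z) (Y ∘ τ) = chartRep n (Y (τ z)) Y ∘ τ := rfl
  rw [hc]
  set Φ := chartRep n (Y (τ z)) Y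
  have d1 : ∀ v, fderiv ℝ (Φ ∘ τ) z v = fderiv ℝ Φ (τ z) (fderiv ℝ τ z v) := fun v => by
    rw [fderiv_comp z (hΦ.differentiableAt (by simp)) (hτ.differentiableAt (by simp))]; rfl
  have hev : fderiv ℝ (Φ ∘ τ) =ᶠ[𝓝 z] fun y => (fderiv ℝ Φ (τ y)).comp (fderiv ℝ τ y) := by
    have e1 : ∀ᶠ y in 𝓝 z, ContDiffAt ℝ 1 τ y :=
      (hτ.of_le (by simp)).eventually (by simp)
    have e2 : ∀ᶠ y in 𝓝 z, ContDiffAt ℝ 1 Φ (τ y) :=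
      hτ.continuousAt.eventually ((hΦ.of_le (by simp)).eventually (by simp))
    filter_upwards [e1, e2] with y h1 h2
    exact fderiv_comp y (h2.differentiableAt (by simp)) (h1.differentiableAt (by simp))
  have a1 : HasFDerivAt (fderiv ℝ Φ) (fderiv ℝ (fderiv ℝ Φ) (τ z)) (τ z) :=
    ((hΦ.fderiv_right (m := 1) one_add_one_le_infty).differentiableAt (by simp)).hasFDerivAt
  have a2 : HasFDerivAt (fderiv ℝ τ) (fderiv ℝ (fderiv ℝ τ) z) z :=
    ((hτ.fderiv_right (m := 1) one_add_one_le_infty).differentiableAt (by simp)).hasFDerivAt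
  have a3 : HasFDerivAt τ (fderiv ℝ τ z) z := (hτ.differentiableAt (by simp)).hasFDerivAt
  have d2 := ((a1.comp z a3).clm_comp a2).fderiv
  rw [hev.fderiv_eq]
  rw [show (fun y => (fderiv ℝ Φ (τ y)).comp (fderiv ℝ τ y)) =
    fun y => ((fderiv ℝ Φ ∘ τ) y).comp (fderiv ℝ τ y) from rfl, d2]
  simp only [Function.comp_apply, d1]
  simp
  abel

end PullbackKoszul

/-! ### Traces with respect to a Gram matrix and change of basis. -/

section Contraction

variable {m : ℕ}

/-- The contraction of the bilinear form `h` with the inverse of `G`. -/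
def contraction (G h : Matrix (Fin m) (Fin m) ℝ) : ℝ := ∑ i, ∑ j, G⁻¹ i j * h i j

lemma contraction_eq_trace (G h : Matrix (Fin m) (Fin m) ℝ) :
    contraction G h = (G⁻¹ * h.transpose).trace := by
  simp [contraction, Matrix.trace, Matrix.mul_apply, Matrix.diag]

/-- The contraction is a trace, so the claim is cyclic invariance; invertibility of the conjugated
matrix already forces that of `J`. -/
lemma contraction_conj (G h J : Matrix (Fin m) (Fin m) ℝ)
    (hJ : IsUnit (J.transpose * G * J).det) :
    contraction (J.transpose * G * J) (J.transpose * h * J) = contraction G h := by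
  have hJ' : IsUnit J.det := by
    rw [Matrix.det_mul] at hJ
    exact isUnit_of_mul_isUnit_right hJ
  have hJt : IsUnit J.transpose.det := by rwa [Matrix.det_transpose]
  rw [contraction_eq_trace, contraction_eq_trace, Matrix.mul_inv_rev, Matrix.mul_inv_rev,
    Matrix.transpose_mul, Matrix.transpose_mul, Matrix.transpose_transpose]
  have : J⁻¹ * (G⁻¹ * J.transpose⁻¹) * (J.transpose * (h.transpose * J)) =
      J⁻¹ * (G⁻¹ * h.transpose * J) := by
    rw [Matrix.mul_assoc, Matrix.mul_assoc, ← Matrix.mul_assoc J.transpose⁻¹,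
      Matrix.nonsing_inv_mul _ hJt, Matrix.one_mul, Matrix.mul_assoc]
  rw [this, Matrix.trace_mul_comm, Matrix.mul_assoc, Matrix.mul_nonsing_inv _ hJ', Matrix.mul_one]

/-- The matrix of a linear endomorphism of `ℝᵐ`. -/
def jacobian (D : EuclideanSpace ℝ (Fin m) →L[ℝ] EuclideanSpace ℝ (Fin m)) :
    Matrix (Fin m) (Fin m) ℝ := Matrix.of fun k i => D (basisVec i) k

lemma matrix_comp_eq_conj
    (B : EuclideanSpace ℝ (Fin m) →ₗ[ℝ] EuclideanSpace ℝ (Fin m) →ₗ[ℝ] ℝ)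
    (D : EuclideanSpace ℝ (Fin m) →L[ℝ] EuclideanSpace ℝ (Fin m)) :
    (Matrix.of fun i j => B (D (basisVec i)) (D (basisVec j))) =
      (jacobian D).transpose * (Matrix.of fun i j => B (basisVec i) (basisVec j)) * jacobian D := by
  have hb : ∀ u : EuclideanSpace ℝ (Fin m), u = ∑ i, u i • basisVec i := fun u => by
    simpa using map_eq_sum_basisVec (ContinuousLinearMap.id ℝ _) u
  ext i j
  simp only [Matrix.of_apply, Matrix.mul_apply, Matrix.transpose_apply, jacobian]
  conv_lhs => rw [hb (D (basisVec i)), hb (D (basisVec j))]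
  simp only [map_sum, map_smul, LinearMap.sum_apply, LinearMap.smul_apply, smul_eq_mul,
    Finset.sum_mul, Finset.mul_sum]
  refine Finset.sum_congr rfl fun a _ => Finset.sum_congr rfl fun b _ => ?_
  ring

lemma det_jacobian (D : EuclideanSpace ℝ (Fin m) →L[ℝ] EuclideanSpace ℝ (Fin m)) :
    (jacobian D).det = D.det := by
  rw [ContinuousLinearMap.det, ← LinearMap.det_toMatrix (EuclideanSpace.basisFun (Fin m) ℝ).toBasis]
  congr 1

end Contraction

/-! ### First and second fundamental forms of parametrizations. -/

section Parametrized

open Filter Topology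

variable {n m : ℕ} {M : Type*} [TopologicalSpace M] [ChartedSpace (EuclideanSpace ℝ (Fin n)) M]
  [IsManifold (𝓡 n) ∞ M] (g : Metric n M)
  {P : Type*} [NormedAddCommGroup P] [NormedSpace ℝ P]
  {P' : Type*} [NormedAddCommGroup P'] [NormedSpace ℝ P']

lemma pairing_comp {Y : P → M} {τ : P' → P} {z : P'}
    (hY : MDifferentiableAt 𝓘(ℝ, P) (𝓡 n) Y (τ z)) (hτ : DifferentiableAt ℝ τ z) (α β : P') :
    pairing g (Y ∘ τ) z α β = pairing g Y (τ z) (fderiv ℝ τ z α) (fderiv ℝ τ z β) := by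
  simp only [pairing, mfderiv_comp z hY hτ.mdifferentiableAt, mfderiv_eq_fderiv]
  rfl

lemma pairing_congr {Y Y' : P → M} {z : P} (h : Y =ᶠ[𝓝 z] Y') (α β : P) :
    pairing g Y z α β = pairing g Y' z α β := by
  unfold pairing
  rw [h.mfderiv_eq, h.self_of_nhds]

/-- The metric at `q` as a bilinear form on the model space. -/
def innerBilin (q : M) :
    EuclideanSpace ℝ (Fin n) →ₗ[ℝ] EuclideanSpace ℝ (Fin n) →ₗ[ℝ] ℝ :=
  LinearMap.mk₂ ℝ (fun u v => g.inner q u v)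
    (fun a b c => congrArg (fun L => L c) ((g.inner q).map_add a b))
    (fun r a c => congrArg (fun L => L c) ((g.inner q).map_smul r a))
    (fun a b c => (g.inner q a).map_add b c)
    (fun r a c => (g.inner q a).map_smul r c)

/-- `pairing` as a bilinear map. -/
def pairingBilin (Y : P → M) (z : P) : P →ₗ[ℝ] P →ₗ[ℝ] ℝ :=
  (innerBilin g (Y z)).compl₁₂ (mfderiv 𝓘(ℝ, P) (𝓡 n) Y z).toLinearMap
    (mfderiv 𝓘(ℝ, P) (𝓡 n) Y z).toLinearMap

/-- `christoffelVec` as a bilinear map. -/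
def christoffelBilin (q : M) (z : EuclideanSpace ℝ (Fin n)) :
    EuclideanSpace ℝ (Fin n) →ₗ[ℝ] EuclideanSpace ℝ (Fin n) →ₗ[ℝ] EuclideanSpace ℝ (Fin n) :=
  LinearMap.mk₂ ℝ (christoffelVec g q z)
    (by intros; ext k; simp [christoffelVec, mul_add, add_mul, Finset.sum_add_distrib])
    (by
      intros; ext k
      simp only [christoffelVec, PiLp.smul_apply, smul_eq_mul, Finset.mul_sum]
      refine Finset.sum_congr rfl fun a _ => Finset.sum_congr rfl fun b _ => ?_
      ring)
    (by intros; ext k; simp [christoffelVec, mul_add, Finset.sum_add_distrib])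
    (by
      intros; ext k
      simp only [christoffelVec, PiLp.smul_apply, smul_eq_mul, Finset.mul_sum]
      refine Finset.sum_congr rfl fun a _ => Finset.sum_congr rfl fun b _ => ?_
      ring)

/-- The matrix of the pullback of the metric along a parametrization. -/
def paramGram (Y : EuclideanSpace ℝ (Fin m) → M) (y : EuclideanSpace ℝ (Fin m)) :
    Matrix (Fin m) (Fin m) ℝ :=
  Matrix.of fun i j => pairing g Y y (basisVec i) (basisVec j)

/-- The second fundamental form of a parametrization, in the direction of `e`. -/
def paramSecond (Y : EuclideanSpace ℝ (Fin m) → M) (y : EuclideanSpace ℝ (Fin m))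
    (e : TangentSpace (𝓡 n) (Y y)) : Matrix (Fin m) (Fin m) ℝ :=
  Matrix.of fun i j => g.inner (Y y)
    (secondCov g Y y (basisVec i) (basisVec j) : TangentSpace (𝓡 n) (Y y)) e

lemma paramGram_comp {Y : EuclideanSpace ℝ (Fin m) → M}
    {τ : EuclideanSpace ℝ (Fin m) → EuclideanSpace ℝ (Fin m)} {z : EuclideanSpace ℝ (Fin m)}
    (hY : MDifferentiableAt (𝓡 m) (𝓡 n) Y (τ z)) (hτ : DifferentiableAt ℝ τ z) :
    paramGram g (Y ∘ τ) z =
      (jacobian (fderiv ℝ τ z)).transpose * paramGram g Y (τ z) * jacobian (fderiv ℝ τ z) := by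
  rw [paramGram, paramGram]
  simp_rw [pairing_comp g hY hτ]
  exact matrix_comp_eq_conj (pairingBilin g Y (τ z)) (fderiv ℝ τ z)

/-- By `secondCov_comp` the second fundamental form changes by a vector in the image of `dY`, which
is orthogonal to `e`; only the tensorial part remains. -/
lemma paramSecond_comp {Y : EuclideanSpace ℝ (Fin m) → M}
    {τ : EuclideanSpace ℝ (Fin m) → EuclideanSpace ℝ (Fin m)} {z : EuclideanSpace ℝ (Fin m)}
    (hY : ContMDiffAt (𝓡 m) (𝓡 n) ∞ Y (τ z)) (hτ : ContDiffAt ℝ ∞ τ z)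
    (e : TangentSpace (𝓡 n) (Y (τ z)))
    (he : ∀ v, g.inner (Y (τ z)) (mfderiv (𝓡 m) (𝓡 n) Y (τ z) v) e = 0) :
    paramSecond g (Y ∘ τ) z e =
      (jacobian (fderiv ℝ τ z)).transpose * paramSecond g Y (τ z) e
        * jacobian (fderiv ℝ τ z) := by
  have h1 : ∀ α β, g.inner (Y (τ z)) (secondCov g (Y ∘ τ) z α β : TangentSpace (𝓡 n) (Y (τ z))) e =
      g.inner (Y (τ z)) (secondCov g Y (τ z) (fderiv ℝ τ z α) (fderiv ℝ τ z β) :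
        TangentSpace (𝓡 n) (Y (τ z))) e := by
    intro α β
    have h2 := he (fderiv ℝ (fderiv ℝ τ) z α β)
    rw [mfderiv_eq_fderiv_chartRep hY] at h2
    have h3 := (g.inner (Y (τ z))).map_add (secondCov g Y (τ z) (fderiv ℝ τ z α) (fderiv ℝ τ z β))
      (fderiv ℝ (chartRep n (Y (τ z)) Y) (τ z) (fderiv ℝ (fderiv ℝ τ) z α β))
    have h4 := congrArg (fun L => L e) h3
    simp only [_root_.add_apply] at h4
    rw [h2, add_zero] at h4
    rw [← h4, secondCov_comp g hY hτ]
    rfl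
  set Φ := chartRep n (Y (τ z)) Y with hΦ
  set C : EuclideanSpace ℝ (Fin m) →ₗ[ℝ] EuclideanSpace ℝ (Fin m) →ₗ[ℝ] EuclideanSpace ℝ (Fin n) :=
    LinearMap.mk₂ ℝ (fun α β => fderiv ℝ (fderiv ℝ Φ) (τ z) α β +
      christoffelBilin g (Y (τ z)) (extChartAt (𝓡 n) (Y (τ z)) (Y (τ z)))
        (fderiv ℝ Φ (τ z) α) (fderiv ℝ Φ (τ z) β))
      (by intros; simp; abel) (by intros; simp) (by intros; simp; abel) (by intros; simp) with hC
  have hCe : ∀ α β, secondCov g Y (τ z) α β = C α β := fun α β => secondCov_eq g hY α β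
  let ℓ : EuclideanSpace ℝ (Fin n) →ₗ[ℝ] ℝ := (innerBilin g (Y (τ z))).flip e
  have h5 := matrix_comp_eq_conj (C.compr₂ ℓ) (fderiv ℝ τ z)
  have e1 : paramSecond g (Y ∘ τ) z e = Matrix.of fun i j =>
      C.compr₂ ℓ (fderiv ℝ τ z (basisVec i)) (fderiv ℝ τ z (basisVec j)) := by
    ext i j
    have := h1 (basisVec i) (basisVec j)
    rw [hCe] at this
    exact this
  have e2 : paramSecond g Y (τ z) e = Matrix.of fun i j =>
      C.compr₂ ℓ (basisVec i) (basisVec j) := by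
    ext i j
    have := hCe (basisVec i) (basisVec j)
    exact congrArg ℓ this
  rw [e1, e2, h5]

end Parametrized

/-! ### Transition maps between charts of the hypersurface. -/

section Transition

open Filter Topology

variable {m : ℕ} {S : Type*} [TopologicalSpace S] [ChartedSpace (EuclideanSpace ℝ (Fin m)) S]

/-- The transition map from the chart at `p` to the chart at `q`. -/
def transition (m : ℕ) {S : Type*} [TopologicalSpace S]
    [ChartedSpace (EuclideanSpace ℝ (Fin m)) S] (p q : S) (y : EuclideanSpace ℝ (Fin m)) :
    EuclideanSpace ℝ (Fin m) :=
  extChartAt (𝓡 m) q ((extChartAt (𝓡 m) p).symm y)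

lemma continuousAt_chart_symm {p : S} {y : EuclideanSpace ℝ (Fin m)}
    (hy : y ∈ (extChartAt (𝓡 m) p).target) : ContinuousAt (extChartAt (𝓡 m) p).symm y :=
  (continuousOn_extChartAt_symm p).continuousAt ((isOpen_extChartAt_target p).mem_nhds hy)

lemma comp_chart_symm_eventuallyEq {W : Type*} (F : S → W) {p q : S} {y : EuclideanSpace ℝ (Fin m)}
    (hy : y ∈ (extChartAt (𝓡 m) p).target)
    (hq : (extChartAt (𝓡 m) p).symm y ∈ (extChartAt (𝓡 m) q).source) :
    F ∘ (extChartAt (𝓡 m) p).symm =ᶠ[𝓝 y]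
      (F ∘ (extChartAt (𝓡 m) q).symm) ∘ transition m p q := by
  filter_upwards [(continuousAt_chart_symm hy).preimage_mem_nhds
    ((isOpen_extChartAt_source q).mem_nhds hq)] with z hz
  simp only [Function.comp_apply, transition]
  rw [(extChartAt (𝓡 m) q).left_inv hz]

lemma transition_mem_target {p q : S} {y : EuclideanSpace ℝ (Fin m)}
    (hq : (extChartAt (𝓡 m) p).symm y ∈ (extChartAt (𝓡 m) q).source) :
    transition m p q y ∈ (extChartAt (𝓡 m) q).target :=
  (extChartAt (𝓡 m) q).map_source hq

lemma chart_symm_transition {p q : S} {y : EuclideanSpace ℝ (Fin m)}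
    (hq : (extChartAt (𝓡 m) p).symm y ∈ (extChartAt (𝓡 m) q).source) :
    (extChartAt (𝓡 m) q).symm (transition m p q y) = (extChartAt (𝓡 m) p).symm y :=
  (extChartAt (𝓡 m) q).left_inv hq

variable [IsManifold (𝓡 m) ∞ S]

lemma contMDiffAt_chart_symm {p : S} {y : EuclideanSpace ℝ (Fin m)}
    (hy : y ∈ (extChartAt (𝓡 m) p).target) :
    ContMDiffAt (𝓡 m) (𝓡 m) ∞ (extChartAt (𝓡 m) p).symm y :=
  (contMDiffOn_extChartAt_symm p).contMDiffAt ((isOpen_extChartAt_target p).mem_nhds hy)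

lemma contDiffAt_transition {p q : S} {y : EuclideanSpace ℝ (Fin m)}
    (hy : y ∈ (extChartAt (𝓡 m) p).target)
    (hq : (extChartAt (𝓡 m) p).symm y ∈ (extChartAt (𝓡 m) q).source) :
    ContDiffAt ℝ ∞ (transition m p q) y := by
  rw [extChartAt_source] at hq
  exact ((contMDiffAt_extChartAt' hq).comp y (contMDiffAt_chart_symm hy)).contDiffAt

lemma contMDiffAt_comp_chart_symm {n : ℕ} {M : Type*} [TopologicalSpace M]
    [ChartedSpace (EuclideanSpace ℝ (Fin n)) M] {F : S → M} {p : S} {y : EuclideanSpace ℝ (Fin m)}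
    (hy : y ∈ (extChartAt (𝓡 m) p).target) (hF : ContMDiff (𝓡 m) (𝓡 n) ∞ F) :
    ContMDiffAt (𝓡 m) (𝓡 n) ∞ (F ∘ (extChartAt (𝓡 m) p).symm) y :=
  hF.contMDiffAt.comp y (contMDiffAt_chart_symm hy)

/-- The partial derivatives of a function on `S` in the chart at `p`. -/
def partials (u : S → ℝ) (p : S) (y : EuclideanSpace ℝ (Fin m)) (i : Fin m) : ℝ :=
  pd i (u ∘ (extChartAt (𝓡 m) p).symm) y

lemma contDiffAt_comp_chart_symm {u : S → ℝ} {p : S} {y : EuclideanSpace ℝ (Fin m)}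
    (hy : y ∈ (extChartAt (𝓡 m) p).target) (hu : ContMDiff (𝓡 m) 𝓘(ℝ, ℝ) ∞ u) :
    ContDiffAt ℝ ∞ (u ∘ (extChartAt (𝓡 m) p).symm) y :=
  (hu.contMDiffAt.comp y (contMDiffAt_chart_symm hy)).contDiffAt

lemma partials_change {u : S → ℝ} {p q : S} {y : EuclideanSpace ℝ (Fin m)}
    (hy : y ∈ (extChartAt (𝓡 m) p).target)
    (hq : (extChartAt (𝓡 m) p).symm y ∈ (extChartAt (𝓡 m) q).source)
    (hu : ContMDiff (𝓡 m) 𝓘(ℝ, ℝ) ∞ u) (i : Fin m) :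
    partials u p y i =
      ∑ k, jacobian (fderiv ℝ (transition m p q) y) k i * partials u q (transition m p q y) k := by
  have hu' := contDiffAt_comp_chart_symm (transition_mem_target hq) hu
  rw [partials, pd, (comp_chart_symm_eventuallyEq u hy hq).fderiv_eq,
    fderiv_comp y (hu'.differentiableAt (by simp))
      ((contDiffAt_transition hy hq).differentiableAt (by simp)), ContinuousLinearMap.comp_apply,
    map_eq_sum_basisVec (fderiv ℝ (u ∘ (extChartAt (𝓡 m) q).symm) (transition m p q y))]
  rfl

lemma outer_partials_change {u v : S → ℝ} {p q : S} {y : EuclideanSpace ℝ (Fin m)}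
    (hy : y ∈ (extChartAt (𝓡 m) p).target)
    (hq : (extChartAt (𝓡 m) p).symm y ∈ (extChartAt (𝓡 m) q).source)
    (hu : ContMDiff (𝓡 m) 𝓘(ℝ, ℝ) ∞ u) (hv : ContMDiff (𝓡 m) 𝓘(ℝ, ℝ) ∞ v) :
    (Matrix.of fun i j => partials u p y i * partials v p y j) =
      (jacobian (fderiv ℝ (transition m p q) y)).transpose *
        (Matrix.of fun i j => partials u q (transition m p q y) i *
          partials v q (transition m p q y) j) *
        jacobian (fderiv ℝ (transition m p q) y) := by
  ext i j
  simp only [Matrix.of_apply, Matrix.mul_apply, Matrix.transpose_apply,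
    partials_change hy hq hu, partials_change hy hq hv, Finset.sum_mul, Finset.mul_sum]
  refine Finset.sum_congr rfl fun a _ => Finset.sum_congr rfl fun b _ => ?_
  ring

lemma mfderiv_comp_chart_symm {n : ℕ} {M : Type*} [TopologicalSpace M]
    [ChartedSpace (EuclideanSpace ℝ (Fin n)) M] {F : S → M} {p : S} {y : EuclideanSpace ℝ (Fin m)}
    (hy : y ∈ (extChartAt (𝓡 m) p).target) (hF : ContMDiff (𝓡 m) (𝓡 n) ∞ F)
    (v : EuclideanSpace ℝ (Fin m)) :
    mfderiv (𝓡 m) (𝓡 n) (F ∘ (extChartAt (𝓡 m) p).symm) y v =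
      mfderiv (𝓡 m) (𝓡 n) F ((extChartAt (𝓡 m) p).symm y)
        (mfderiv (𝓡 m) (𝓡 m) (extChartAt (𝓡 m) p).symm y v) := by
  rw [mfderiv_comp y (hF.mdifferentiableAt (by simp))
    ((contMDiffAt_chart_symm hy).mdifferentiableAt (by simp))]
  rfl

lemma mfderiv_chart_symm_injective {p : S} {y : EuclideanSpace ℝ (Fin m)}
    (hy : y ∈ (extChartAt (𝓡 m) p).target) :
    Function.Injective (mfderiv (𝓡 m) (𝓡 m) (extChartAt (𝓡 m) p).symm y) := by
  have h := isInvertible_mfderivWithin_extChartAt_symm (I := 𝓡 m) hy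
  simp only [ModelWithCorners.range_eq_univ, mfderivWithin_univ] at h
  exact h.bijective.injective

end Transition

/-! ### Gram matrix and mean curvature in an arbitrary chart. -/

section Gram

open Filter Topology

variable {n m : ℕ} {M : Type*} [TopologicalSpace M] [ChartedSpace (EuclideanSpace ℝ (Fin n)) M]
  [IsManifold (𝓡 n) ∞ M] (g : Metric n M)
  {S : Type*} [TopologicalSpace S] [ChartedSpace (EuclideanSpace ℝ (Fin m)) S]

lemma paramGram_posDef {Y : EuclideanSpace ℝ (Fin m) → M} {y : EuclideanSpace ℝ (Fin m)}
    (h : Function.Injective (mfderiv (𝓡 m) (𝓡 n) Y y)) : (paramGram g Y y).PosDef := by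
  let d : EuclideanSpace ℝ (Fin m) →ₗ[ℝ] EuclideanSpace ℝ (Fin n) :=
    (mfderiv (𝓡 m) (𝓡 n) Y y).toLinearMap
  have hd : LinearIndependent ℝ fun i => d (basisVec i) := by
    have h1 := (EuclideanSpace.basisFun (Fin m) ℝ).toBasis.linearIndependent.map' d
      (LinearMap.ker_eq_bot.2 h)
    have h2 : (d ∘ (EuclideanSpace.basisFun (Fin m) ℝ).toBasis) = fun i => d (basisVec i) := by
      ext i : 1
      simp
    rw [h2] at h1
    exact h1
  have hB := posDef_of_linearIndependent (chartForm g (Y y) (extChartAt (𝓡 n) (Y y) (Y y)))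
    (fun u v => chartForm_symm g _ _ u v)
    (fun u hu => by
      rw [chartForm_self]
      exact g.pos _ _ hu) hd
  convert hB using 1
  ext i j
  simp only [Matrix.of_apply, chartForm_self]
  rfl

lemma gram_eq_paramGram (F : S → M) (p : S) (y : EuclideanSpace ℝ (Fin m)) :
    gram g F p y = paramGram g (F ∘ (extChartAt (𝓡 m) p).symm) y := rfl

variable [IsManifold (𝓡 m) ∞ S]

lemma gram_posDef {F : S → M} {p : S} {y : EuclideanSpace ℝ (Fin m)}
    (hy : y ∈ (extChartAt (𝓡 m) p).target) (hF : ContMDiff (𝓡 m) (𝓡 n) ∞ F)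
    (hi : ∀ p, Function.Injective (mfderiv (𝓡 m) (𝓡 n) F p)) : (gram g F p y).PosDef := by
  rw [gram_eq_paramGram]
  apply paramGram_posDef
  intro v w hvw
  have hv := mfderiv_comp_chart_symm hy hF v
  have hw := mfderiv_comp_chart_symm hy hF w
  exact mfderiv_chart_symm_injective hy (hi _ (hv.symm.trans (hvw.trans hw)))

lemma gram_change {F : S → M} {p q : S} {y : EuclideanSpace ℝ (Fin m)}
    (hy : y ∈ (extChartAt (𝓡 m) p).target)
    (hq : (extChartAt (𝓡 m) p).symm y ∈ (extChartAt (𝓡 m) q).source)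
    (hF : ContMDiff (𝓡 m) (𝓡 n) ∞ F) :
    gram g F p y = (jacobian (fderiv ℝ (transition m p q) y)).transpose *
      gram g F q (transition m p q y) * jacobian (fderiv ℝ (transition m p q) y) := by
  rw [gram_eq_paramGram, gram_eq_paramGram, ← paramGram_comp g
    ((contMDiffAt_comp_chart_symm (transition_mem_target hq) hF).mdifferentiableAt (by simp))
    ((contDiffAt_transition hy hq).differentiableAt (by simp))]
  ext i j
  exact pairing_congr g (comp_chart_symm_eventuallyEq F hy hq) _ _

lemma contraction_partials_change {F : S → M} {p q : S} {y : EuclideanSpace ℝ (Fin m)}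
    (hy : y ∈ (extChartAt (𝓡 m) p).target)
    (hq : (extChartAt (𝓡 m) p).symm y ∈ (extChartAt (𝓡 m) q).source)
    (hF : ContMDiff (𝓡 m) (𝓡 n) ∞ F)
    (hi : ∀ p, Function.Injective (mfderiv (𝓡 m) (𝓡 n) F p)) {u v : S → ℝ}
    (hu : ContMDiff (𝓡 m) 𝓘(ℝ, ℝ) ∞ u) (hv : ContMDiff (𝓡 m) 𝓘(ℝ, ℝ) ∞ v) :
    contraction (gram g F p y) (Matrix.of fun i j => partials u p y i * partials v p y j) =
      contraction (gram g F q (transition m p q y)) (Matrix.of fun i j =>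
        partials u q (transition m p q y) i * partials v q (transition m p q y) j) := by
  have hd := (gram_posDef g hy hF hi).det_pos.ne'.isUnit
  rw [outer_partials_change hy hq hu hv, gram_change g hy hq hF] at *
  exact contraction_conj _ _ _ hd

/-- This is the factor in the change of variables formula, and is what makes the chart measures
agree. -/
lemma sqrt_det_gram_change {F : S → M} {p q : S} {y : EuclideanSpace ℝ (Fin m)}
    (hy : y ∈ (extChartAt (𝓡 m) p).target)
    (hq : (extChartAt (𝓡 m) p).symm y ∈ (extChartAt (𝓡 m) q).source)
    (hF : ContMDiff (𝓡 m) (𝓡 n) ∞ F) :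
    √(gram g F p y).det =
      |(fderiv ℝ (transition m p q) y).det| * √(gram g F q (transition m p q y)).det := by
  rw [gram_change g hy hq hF, Matrix.det_mul, Matrix.det_mul, Matrix.det_transpose, det_jacobian,
    mul_right_comm, Real.sqrt_mul (mul_self_nonneg _), Real.sqrt_mul_self_eq_abs]

/-- One side differentiates the components of `F`, the other the vector-valued map. Coordinate
projections commute with derivatives, but this is needed on a neighbourhood before differentiating a
second time. -/
lemma covDeriv_eq {F : S → M} (hF : ContMDiff (𝓡 m) (𝓡 n) ∞ F) (p : S) (i j : Fin m) :
    covDeriv g F p i j = secondCov g (F ∘ (extChartAt (𝓡 m) p).symm) (extChartAt (𝓡 m) p p)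
      (basisVec i) (basisVec j) := by
  set y := extChartAt (𝓡 m) p p with hy
  have hyt : y ∈ (extChartAt (𝓡 m) p).target := mem_extChartAt_target p
  have hY := contMDiffAt_comp_chart_symm hyt hF
  have hFy : (F ∘ (extChartAt (𝓡 m) p).symm) y = F p := by
    simp only [Function.comp_apply]
    rw [hy, extChartAt_to_inv]
  have hΦ := contDiffAt_chartRep hY (q := F p) (by rw [hFy]; exact mem_extChartAt_source _)
  rw [secondCov, hFy]
  set Φ := chartRep n (F p) (F ∘ (extChartAt (𝓡 m) p).symm)
  have hd1 : ∀ᶠ z in 𝓝 y, ∀ (k : Fin n) (v : EuclideanSpace ℝ (Fin m)),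
      fderiv ℝ (fun z' => Φ z' k) z v = fderiv ℝ Φ z v k := by
    filter_upwards [(hΦ.of_le (m := 1) (by simp)).eventually (by simp)] with z hz k v
    have := ((EuclideanSpace.proj (𝕜 := ℝ) k).hasFDerivAt.comp z
      (hz.differentiableAt (by simp)).hasFDerivAt).fderiv
    exact congrArg (fun L => L v) this
  have hd2 : ∀ (k : Fin n) (u v : EuclideanSpace ℝ (Fin m)),
      fderiv ℝ (fun z => fderiv ℝ (fun z' => Φ z' k) z v) y u =
        fderiv ℝ (fun z => fderiv ℝ Φ z v) y u k := by
    intro k u v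
    have e1 : (fun z => fderiv ℝ (fun z' => Φ z' k) z v) =ᶠ[𝓝 y] fun z => fderiv ℝ Φ z v k := by
      filter_upwards [hd1] with z hz using hz k v
    rw [e1.fderiv_eq]
    have hdiff : DifferentiableAt ℝ (fun z => fderiv ℝ Φ z v) y :=
      (((hΦ.fderiv_right (m := 1) one_add_one_le_infty).differentiableAt (by simp)).clm_apply
        (differentiableAt_const v))
    have := ((EuclideanSpace.proj (𝕜 := ℝ) k).hasFDerivAt.comp y hdiff.hasFDerivAt).fderiv
    exact congrArg (fun L => L u) this
  have hd1' := hd1.self_of_nhds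
  refine (WithLp.ofLp_injective 2) (funext fun k => ?_ :
    (covDeriv g F p i j : EuclideanSpace ℝ (Fin n)).ofLp = _)
  rw [PiLp.add_apply, ← hd2, christoffelVec]
  simp only [← hd1']
  rfl

/-- The mean curvature can be computed in any chart. -/
lemma meanCurvature_eq_contraction {F : S → M} (hF : ContMDiff (𝓡 m) (𝓡 n) ∞ F)
    (hi : ∀ p, Function.Injective (mfderiv (𝓡 m) (𝓡 n) F p)) {p q : S}
    (hpq : p ∈ (extChartAt (𝓡 m) q).source) (e : EuclideanSpace ℝ (Fin n))
    (he : ∀ v, innerBilin g (F p) e (mfderiv (𝓡 m) (𝓡 n) F p v) = 0) :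
    meanCurvature g m F p e = contraction (gram g F q (extChartAt (𝓡 m) q p))
      (paramSecond g (F ∘ (extChartAt (𝓡 m) q).symm) (extChartAt (𝓡 m) q p) e) := by
  set y := extChartAt (𝓡 m) q p with hy_def
  have hy : y ∈ (extChartAt (𝓡 m) q).target := (extChartAt (𝓡 m) q).map_source hpq
  have hyp : (extChartAt (𝓡 m) q).symm y = p := (extChartAt (𝓡 m) q).left_inv hpq
  have hpp : (extChartAt (𝓡 m) q).symm y ∈ (extChartAt (𝓡 m) p).source := by
    rw [hyp]; exact mem_extChartAt_source p
  have hτ := contDiffAt_transition hy hpp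
  have hty : transition m q p y = extChartAt (𝓡 m) p p := by rw [transition, hyp]
  have hmem : transition m q p y ∈ (extChartAt (𝓡 m) p).target := transition_mem_target hpp
  have hY := contMDiffAt_comp_chart_symm hmem hF
  have hinv : (extChartAt (𝓡 m) p).symm (transition m q p y) = p := by
    rw [hty, extChartAt_to_inv]
  have hYp : (F ∘ (extChartAt (𝓡 m) p).symm) (transition m q p y) = F p := congrArg F hinv
  have hH : meanCurvature g m F p e = contraction (gram g F p (transition m q p y))
      (paramSecond g (F ∘ (extChartAt (𝓡 m) p).symm) (transition m q p y) e) := by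
    have hH0 : meanCurvature g m F p e =
        ∑ i, ∑ j, (gram g F p (extChartAt (𝓡 m) p p))⁻¹ i j *
          innerBilin g (F p) (covDeriv g F p i j) e := rfl
    rw [hH0, contraction]
    simp only [← hty]
    refine Finset.sum_congr rfl fun i _ => Finset.sum_congr rfl fun j _ => ?_
    have h1 : paramSecond g (F ∘ (extChartAt (𝓡 m) p).symm) (transition m q p y) e i j =
      innerBilin g ((F ∘ (extChartAt (𝓡 m) p).symm) (transition m q p y))
        (secondCov g (F ∘ (extChartAt (𝓡 m) p).symm) (transition m q p y)
          (basisVec i) (basisVec j)) e := rfl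
    rw [h1, hYp, hty, ← covDeriv_eq g hF]
  have hnorm : ∀ v, g.inner ((F ∘ (extChartAt (𝓡 m) p).symm) (transition m q p y))
      (mfderiv (𝓡 m) (𝓡 n) (F ∘ (extChartAt (𝓡 m) p).symm) (transition m q p y) v) e = 0 := by
    intro v
    have : ∀ p', p' = p → ∀ w : EuclideanSpace ℝ (Fin m),
        innerBilin g (F p') (mfderiv (𝓡 m) (𝓡 n) F p' w) e = 0 := by
      rintro p' rfl w
      exact (g.symm _ _ _).trans (he w)
    have h2 := this _ hinv
      (mfderiv (𝓡 m) (𝓡 m) (extChartAt (𝓡 m) p).symm (transition m q p y) v)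
    have h3 := mfderiv_comp_chart_symm hmem hF v
    exact (congrArg (fun a => innerBilin g
      ((F ∘ (extChartAt (𝓡 m) p).symm) (transition m q p y)) a e) h3).trans h2
  have hd := (gram_posDef g hy hF hi).det_pos.ne'.isUnit
  have hsec : paramSecond g (F ∘ (extChartAt (𝓡 m) q).symm) y e =
      paramSecond g ((F ∘ (extChartAt (𝓡 m) p).symm) ∘ transition m q p) y e := by
    have hev := comp_chart_symm_eventuallyEq F hy hpp
    ext i j
    change innerBilin g ((F ∘ (extChartAt (𝓡 m) q).symm) y)
        (secondCov g (F ∘ (extChartAt (𝓡 m) q).symm) y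
      (basisVec i) (basisVec j)) e = innerBilin g
        (((F ∘ (extChartAt (𝓡 m) p).symm) ∘ transition m q p) y)
        (secondCov g ((F ∘ (extChartAt (𝓡 m) p).symm) ∘ transition m q p) y
      (basisVec i) (basisVec j)) e
    rw [secondCov_congr g hev, hev.self_of_nhds]
  -- Both fundamental forms are conjugated by the same Jacobian, that of the transition from the
  -- chart at `q` to the chart at `p`.
  rw [hH, hsec, paramSecond_comp g hY hτ e hnorm, gram_change g hy hpp hF] at *
  exact (contraction_conj _ _ _ hd).symm

end Gram

/-! ### The area measure and integration in a chart. -/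

section Area

open Filter Topology

variable {n m : ℕ} {M : Type*} [TopologicalSpace M] [ChartedSpace (EuclideanSpace ℝ (Fin n)) M]
  [IsManifold (𝓡 n) ∞ M] (g : Metric n M)
  {S : Type*} [TopologicalSpace S] [ChartedSpace (EuclideanSpace ℝ (Fin m)) S]
  [IsManifold (𝓡 m) ∞ S]

lemma continuousOn_gram {F : S → M} (hF : ContMDiff (𝓡 m) (𝓡 n) ∞ F) (p : S) (i j : Fin m) :
    ContinuousOn (fun y => gram g F p y i j) (extChartAt (𝓡 m) p).target :=
  (contDiffOn_pairing g (isOpen_extChartAt_target p)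
    (fun _ hy => (contMDiffAt_comp_chart_symm hy hF).contMDiffWithinAt) _ _).continuousOn

lemma continuousOn_sqrt_det_gram {F : S → M} (hF : ContMDiff (𝓡 m) (𝓡 n) ∞ F) (p : S) :
    ContinuousOn (fun y => √(gram g F p y).det) (extChartAt (𝓡 m) p).target := by
  refine Real.continuous_sqrt.comp_continuousOn ?_
  simp only [Matrix.det_apply]
  refine continuousOn_finsetSum _ fun σ _ => ContinuousOn.const_smul ?_ _
  exact continuousOn_finsetProd _ fun i _ => continuousOn_gram g hF p _ _

variable [MeasurableSpace S] [BorelSpace S]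

lemma measurableSet_target_inter_preimage (p : S) {B : Set S} (hB : MeasurableSet B) :
    MeasurableSet ((extChartAt (𝓡 m) p).target ∩ (extChartAt (𝓡 m) p).symm ⁻¹' B) := by
  have h := (continuousOn_iff_continuous_domRestrict.1
    (continuousOn_extChartAt_symm (I := 𝓡 m) p)).measurable hB
  have h' := (isOpen_extChartAt_target (I := 𝓡 m) p).measurableSet.subtype_image h
  convert h' using 1
  ext y
  simp [and_comm]

lemma aemeasurable_chart_symm (p : S) (ρ : EuclideanSpace ℝ (Fin m) → ENNReal) :
    AEMeasurable (extChartAt (𝓡 m) p).symm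
      ((volume.restrict (extChartAt (𝓡 m) p).target).withDensity ρ) :=
  ((continuousOn_extChartAt_symm p).aemeasurable
    (isOpen_extChartAt_target p).measurableSet).mono_ac (withDensity_absolutelyContinuous _ _)

lemma chartMeasure_apply (F : S → M) (p : S) {B : Set S} (hB : MeasurableSet B) :
    chartMeasure g m F p B =
      ∫⁻ y in (extChartAt (𝓡 m) p).target ∩ (extChartAt (𝓡 m) p).symm ⁻¹' B,
        ENNReal.ofReal √(gram g F p y).det := by
  rw [chartMeasure, Measure.map_apply_of_aemeasurable (aemeasurable_chart_symm p _) hB,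
    withDensity_apply', Measure.restrict_restrict' (isOpen_extChartAt_target p).measurableSet,
    inter_comm]

lemma chartMeasure_compl_source (F : S → M) (p : S) :
    chartMeasure g m F p (extChartAt (𝓡 m) p).sourceᶜ = 0 := by
  rw [chartMeasure_apply g F p (isOpen_extChartAt_source p).measurableSet.compl]
  have : (extChartAt (𝓡 m) p).target ∩
      (extChartAt (𝓡 m) p).symm ⁻¹' (extChartAt (𝓡 m) p).sourceᶜ = ∅ := by
    ext y
    simp only [mem_inter_iff, mem_preimage, mem_compl_iff, mem_empty_iff_false, iff_false, not_and,
      not_not]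
    exact fun hy => (extChartAt (𝓡 m) p).map_target hy
  rw [this, Measure.restrict_empty, lintegral_zero_measure]

/-- The chart measures agree on overlaps. -/
lemma chartMeasure_eq_of_subset {F : S → M} (hF : ContMDiff (𝓡 m) (𝓡 n) ∞ F) (p q : S) {B : Set S}
    (hB : MeasurableSet B) (hp : B ⊆ (extChartAt (𝓡 m) p).source)
    (hq : B ⊆ (extChartAt (𝓡 m) q).source) :
    chartMeasure g m F p B = chartMeasure g m F q B := by
  rw [chartMeasure_apply g F p hB, chartMeasure_apply g F q hB]
  set s := (extChartAt (𝓡 m) p).target ∩ (extChartAt (𝓡 m) p).symm ⁻¹' B with hs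
  have himage : transition m p q '' s =
      (extChartAt (𝓡 m) q).target ∩ (extChartAt (𝓡 m) q).symm ⁻¹' B := by
    ext z
    constructor
    · rintro ⟨y, ⟨hy, hyB⟩, rfl⟩
      refine ⟨transition_mem_target (hq hyB), ?_⟩
      rw [mem_preimage, chart_symm_transition (hq hyB)]
      exact hyB
    · rintro ⟨hz, hzB⟩
      refine ⟨extChartAt (𝓡 m) p ((extChartAt (𝓡 m) q).symm z),
        ⟨(extChartAt (𝓡 m) p).map_source (hp hzB), ?_⟩, ?_⟩
      · rw [mem_preimage, (extChartAt (𝓡 m) p).left_inv (hp hzB)]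
        exact hzB
      · rw [transition, (extChartAt (𝓡 m) p).left_inv (hp hzB), (extChartAt (𝓡 m) q).right_inv hz]
  have hsm : MeasurableSet s := measurableSet_target_inter_preimage p hB
  have hinj : InjOn (transition m p q) s := by
    intro y hy z hz h
    have h1 : (extChartAt (𝓡 m) p).symm y = (extChartAt (𝓡 m) p).symm z :=
      (extChartAt (𝓡 m) q).injOn (hq hy.2) (hq hz.2) h
    exact (extChartAt (𝓡 m) p).symm.injOn hy.1 hz.1 h1
  -- Change of variables along the transition map, which carries one coordinate image of `B`
  -- bijectively onto the other.
  rw [← himage, lintegral_image_eq_lintegral_abs_det_fderiv_mul volume hsm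
    (f' := fderiv ℝ (transition m p q)) (fun y hy =>
      ((contDiffAt_transition hy.1 (hq hy.2)).differentiableAt (by simp)).hasFDerivAt.hasFDerivWithinAt)
    hinj]
  refine setLIntegral_congr_fun hsm fun y hy => ?_
  rw [sqrt_det_gram_change g hy.1 (hq hy.2) hF, ENNReal.ofReal_mul (abs_nonneg _)]

/-- The supremum runs over all points, so it is controlled by exhibiting an upper bound: on the
chart domain no other chart measure exceeds the one at `p`, since the two agree on overlaps and each
vanishes off its own domain. -/
lemma areaMeasure_restrict_source {F : S → M} (hF : ContMDiff (𝓡 m) (𝓡 n) ∞ F) (p : S) :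
    (areaMeasure g m F).restrict (extChartAt (𝓡 m) p).source = chartMeasure g m F p := by
  set U := (extChartAt (𝓡 m) p).source with hU
  have hUm : MeasurableSet U := (isOpen_extChartAt_source p).measurableSet
  have hp : (chartMeasure g m F p).restrict U = chartMeasure g m F p :=
    Measure.restrict_eq_self_of_ae_mem (by
      rw [ae_iff]
      exact chartMeasure_compl_source g F p)
  -- Nothing needs to be known outside `U`, so the bound there is the largest measure, which the
  -- restriction to `U` then removes.
  have hub : areaMeasure g m F ≤ chartMeasure g m F p + (⊤ : Measure S).restrict Uᶜ := by
    refine iSup_le fun q => Measure.le_iff.2 fun B hB => ?_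
    set V := (extChartAt (𝓡 m) q).source
    have hVm : MeasurableSet V := (isOpen_extChartAt_source q).measurableSet
    rw [Measure.add_apply, Measure.restrict_apply hB, ← measure_inter_add_sdiff B hUm]
    refine add_le_add ?_ ((le_top : chartMeasure g m F q ≤ ⊤) _)
    calc chartMeasure g m F q (B ∩ U) ≤
          chartMeasure g m F q (B ∩ U ∩ V) + chartMeasure g m F q ((B ∩ U) \ V) :=
          (measure_inter_add_sdiff _ hVm).ge
      _ = chartMeasure g m F q (B ∩ U ∩ V) := by
          rw [measure_mono_null (s := (B ∩ U) \ V) (t := Vᶜ) (fun _ h => h.2) (chartMeasure_compl_source g F q),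
            add_zero]
      _ = chartMeasure g m F p (B ∩ U ∩ V) :=
          chartMeasure_eq_of_subset g hF q p ((hB.inter hUm).inter hVm) inter_subset_right
            fun _ h => h.1.2
      _ ≤ chartMeasure g m F p B := measure_mono fun _ h => h.1.1
  refine le_antisymm ?_ ?_
  · refine (Measure.restrict_mono le_rfl hub).trans ?_
    rw [Measure.restrict_add, hp, Measure.restrict_restrict hUm, inter_compl_self,
      Measure.restrict_empty, add_zero]
  · conv_lhs => rw [← hp]
    exact Measure.restrict_mono le_rfl (le_iSup (fun q => chartMeasure g m F q) p)

lemma aestronglyMeasurable_chartMeasure {F : S → M} (hF : ContMDiff (𝓡 m) (𝓡 n) ∞ F) {p : S}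
    {φ : S → ℝ} (hφ : ContinuousOn φ (extChartAt (𝓡 m) p).source) :
    AEStronglyMeasurable φ (chartMeasure g m F p) := by
  rw [← areaMeasure_restrict_source g hF p]
  refine (hφ.aemeasurable (isOpen_extChartAt_source p).measurableSet).aestronglyMeasurable

lemma aemeasurable_density {F : S → M} (hF : ContMDiff (𝓡 m) (𝓡 n) ∞ F) (p : S) :
    AEMeasurable (fun y => ENNReal.ofReal √(gram g F p y).det)
      (volume.restrict (extChartAt (𝓡 m) p).target) :=
  ((continuousOn_sqrt_det_gram g hF p).aemeasurable
    (isOpen_extChartAt_target p).measurableSet).ennreal_ofReal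

lemma integral_areaMeasure_eq {F : S → M} (hF : ContMDiff (𝓡 m) (𝓡 n) ∞ F) {p : S} {φ : S → ℝ}
    (hφ : ContinuousOn φ (extChartAt (𝓡 m) p).source)
    (h0 : ∀ x ∉ (extChartAt (𝓡 m) p).source, φ x = 0) :
    ∫ x, φ x ∂(areaMeasure g m F) = ∫ y in (extChartAt (𝓡 m) p).target,
      φ ((extChartAt (𝓡 m) p).symm y) * √(gram g F p y).det := by
  rw [← setIntegral_eq_integral_of_forall_compl_eq_zero h0, areaMeasure_restrict_source g hF p]
  have hm := aestronglyMeasurable_chartMeasure g hF hφ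
  rw [chartMeasure] at hm ⊢
  rw [integral_map (aemeasurable_chart_symm p _) hm,
    integral_withDensity_eq_integral_toReal_smul₀ (aemeasurable_density g hF p)
      (Eventually.of_forall fun _ => ENNReal.ofReal_lt_top)]
  refine integral_congr_ae (Eventually.of_forall fun y => ?_)
  simp only [smul_eq_mul]
  rw [ENNReal.toReal_ofReal (Real.sqrt_nonneg _), mul_comm]

lemma integrable_areaMeasure_iff {F : S → M} (hF : ContMDiff (𝓡 m) (𝓡 n) ∞ F) {p : S} {φ : S → ℝ}
    (hφ : ContinuousOn φ (extChartAt (𝓡 m) p).source)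
    (h0 : ∀ x ∉ (extChartAt (𝓡 m) p).source, φ x = 0) :
    Integrable φ (areaMeasure g m F) ↔ IntegrableOn (fun y =>
      φ ((extChartAt (𝓡 m) p).symm y) * √(gram g F p y).det) (extChartAt (𝓡 m) p).target := by
  have hsupp : Function.support φ ⊆ (extChartAt (𝓡 m) p).source := fun x hx => by
    by_contra h
    exact hx (h0 x h)
  rw [← integrableOn_iff_integrable_of_support_subset hsupp, IntegrableOn,
    areaMeasure_restrict_source g hF p]
  have hm := aestronglyMeasurable_chartMeasure g hF hφ
  rw [chartMeasure] at hm ⊢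
  rw [integrable_map_measure hm (aemeasurable_chart_symm p _),
    integrable_withDensity_iff_integrable_smul₀' (aemeasurable_density g hF p)
      (Eventually.of_forall fun _ => ENNReal.ofReal_lt_top), IntegrableOn]
  refine integrable_congr (Eventually.of_forall fun y => ?_)
  simp only [smul_eq_mul, Function.comp_apply]
  rw [ENNReal.toReal_ofReal (Real.sqrt_nonneg _), mul_comm]

end Area

/-! ### Derivatives of determinants and inverse matrices. -/

section MatrixCalculus

open Filter Topology

variable {m : ℕ} {P : Type*} [NormedAddCommGroup P] [NormedSpace ℝ P]

lemma contDiffOn_det {G : P → Matrix (Fin m) (Fin m) ℝ} {s : Set P} {k : WithTop ℕ∞}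
    (hG : ∀ i j, ContDiffOn ℝ k (fun z => G z i j) s) : ContDiffOn ℝ k (fun z => (G z).det) s := by
  simp only [Matrix.det_apply]
  exact ContDiffOn.sum fun σ _ => ContDiffOn.const_smul _ (contDiffOn_prod fun i _ => hG _ _)

/-- By Cramer's rule an entry of the inverse is a quotient of two determinants, hence a rational
function of the entries. -/
lemma contDiffOn_inv_apply {G : P → Matrix (Fin m) (Fin m) ℝ} {s : Set P} {k : WithTop ℕ∞}
    (hG : ∀ i j, ContDiffOn ℝ k (fun z => G z i j) s) (hdet : ∀ z ∈ s, (G z).det ≠ 0)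
    (i j : Fin m) : ContDiffOn ℝ k (fun z => (G z)⁻¹ i j) s := by
  have h : (fun z => (G z)⁻¹ i j) =
      fun z => ((G z).det)⁻¹ * ((G z).updateRow j (Pi.single i 1)).det := by
    ext z
    rw [Matrix.inv_def, Matrix.smul_apply, Matrix.adjugate_apply, Ring.inverse_eq_inv', smul_eq_mul]
  rw [h]
  refine ((contDiffOn_det hG).inv hdet).mul (contDiffOn_det fun a b => ?_)
  by_cases hab : a = j
  · subst hab
    simp only [Matrix.updateRow_self]
    exact contDiffOn_const
  · simp only [Matrix.updateRow_ne hab]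
    exact hG a b

lemma det_updateRow_eq_sum (A : Matrix (Fin m) (Fin m) ℝ) (hA : A.det ≠ 0) (i : Fin m)
    (b : Fin m → ℝ) : (A.updateRow i b).det = A.det * ∑ j, A⁻¹ j i * b j := by
  rw [← Matrix.cramer_transpose_apply, Matrix.cramer_eq_adjugate_mulVec,
    ← Matrix.adjugate_transpose, Matrix.mulVec, dotProduct, Finset.mul_sum]
  refine Finset.sum_congr rfl fun j _ => ?_
  rw [Matrix.inv_def, Matrix.smul_apply, Ring.inverse_eq_inv', smul_eq_mul, Matrix.transpose_apply]
  field_simp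

/-- Jacobi's formula. -/
lemma hasFDerivAt_det {G : P → Matrix (Fin m) (Fin m) ℝ} {G' : Fin m → Fin m → P →L[ℝ] ℝ} {z : P}
    (hG : ∀ i j, HasFDerivAt (fun z => G z i j) (G' i j) z) (hdet : (G z).det ≠ 0) :
    HasFDerivAt (fun z => (G z).det)
      ((G z).det • ∑ i, ∑ j, (G z)⁻¹ j i • G' i j) z := by
  let f : ContinuousMultilinearMap ℝ (fun _ : Fin m => Fin m → ℝ) ℝ :=
    { Matrix.detRowAlternating.toMultilinearMap with
      cont := by
        change Continuous fun A : Matrix (Fin m) (Fin m) ℝ => A.det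
        exact continuous_id.matrix_det }
  have hrow : ∀ i, HasFDerivAt (fun z => G z i) (ContinuousLinearMap.pi fun j => G' i j) z :=
    fun i => hasFDerivAt_pi.2 fun j => hG i j
  have h := HasFDerivAt.multilinear_comp f hrow
  refine h.congr_fderiv ?_
  ext v
  simp only [_root_.sum_apply, ContinuousLinearMap.comp_apply, _root_.smul_apply, Finset.smul_sum]
  refine Finset.sum_congr rfl fun i _ => ?_
  have h1 : (f.toContinuousLinearMap (fun i => G z i) i) (ContinuousLinearMap.pi (fun j => G' i j) v)
      = ((G z).updateRow i fun j => G' i j v).det := rfl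
  rw [h1, det_updateRow_eq_sum _ hdet, Finset.mul_sum]
  rfl

/-- Differentiate `G * G⁻¹ = 1`, valid near `z`, and multiply by `G⁻¹` from the left. -/
lemma fderiv_inv_apply {G : P → Matrix (Fin m) (Fin m) ℝ} {z : P} (hG : ∀ i j, DifferentiableAt ℝ (fun z => G z i j) z)
    (hK : ∀ i j, DifferentiableAt ℝ (fun z => (G z)⁻¹ i j) z)
    (hdet : ∀ᶠ y in 𝓝 z, (G y).det ≠ 0) (i j : Fin m) (v : P) :
    fderiv ℝ (fun y => (G y)⁻¹ i j) z v =
      -∑ k, ∑ l, (G z)⁻¹ i k * fderiv ℝ (fun y => G y k l) z v * (G z)⁻¹ l j := by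
  have h1 : ∀ k, ∑ l, (fderiv ℝ (fun y => G y k l) z v * (G z)⁻¹ l j
      + G z k l * fderiv ℝ (fun y => (G y)⁻¹ l j) z v) = 0 := by
    intro k
    have e : (fun y => ∑ l, G y k l * (G y)⁻¹ l j) =ᶠ[𝓝 z]
        fun _ => (1 : Matrix (Fin m) (Fin m) ℝ) k j := by
      filter_upwards [hdet] with y hy
      rw [← Matrix.mul_apply, Matrix.mul_nonsing_inv _ hy.isUnit]
    have d : HasFDerivAt (fun y => ∑ l, G y k l * (G y)⁻¹ l j)
        (∑ l, (G z k l • fderiv ℝ (fun y => (G y)⁻¹ l j) z +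
          (G z)⁻¹ l j • fderiv ℝ (fun y => G y k l) z)) z :=
      HasFDerivAt.fun_sum fun l _ => (hG k l).hasFDerivAt.mul (hK l j).hasFDerivAt
    have h := e.fderiv_eq.symm.trans d.fderiv
    have h' := congrArg (fun L => L v) h
    simp only [fderiv_fun_const, Pi.zero_apply, _root_.zero_apply, _root_.sum_apply,
      _root_.add_apply, _root_.smul_apply, smul_eq_mul] at h'
    rw [h']
    refine Finset.sum_congr rfl fun l _ => ?_
    ring
  have h2 : ∑ k, (G z)⁻¹ i k * ∑ l, (fderiv ℝ (fun y => G y k l) z v * (G z)⁻¹ l j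
      + G z k l * fderiv ℝ (fun y => (G y)⁻¹ l j) z v) = 0 := by
    simp [h1]
  have h3 : ∑ k, (G z)⁻¹ i k * ∑ l, G z k l * fderiv ℝ (fun y => (G y)⁻¹ l j) z v =
      fderiv ℝ (fun y => (G y)⁻¹ i j) z v := by
    simp_rw [Finset.mul_sum, ← mul_assoc]
    rw [Finset.sum_comm]
    simp_rw [← Finset.sum_mul, ← Matrix.mul_apply,
      Matrix.nonsing_inv_mul _ hdet.self_of_nhds.isUnit]
    simp [Matrix.one_apply]
  simp_rw [Finset.sum_add_distrib, mul_add] at h2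
  rw [Finset.sum_add_distrib, h3] at h2
  rw [eq_neg_iff_add_eq_zero, add_comm, ← h2]
  simp_rw [Finset.mul_sum, mul_assoc]

end MatrixCalculus

/-! ### The pointwise evolution of the weighted area density. -/

section WeightedDensity

open Filter Topology

variable {m : ℕ} {P : Type*} [NormedAddCommGroup P] [NormedSpace ℝ P]

/-- With `K = G⁻¹` and `B i k l = ∂_i G_{kl}` this is the algebra behind `∂_i (√(det G) G^{ij}) =
-√(det G) G^{kl} Γ^j_{kl}`: the left side comes from Jacobi's formula and the derivative of the
inverse, the right side is the traced Christoffel symbol. -/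
lemma divergence_sum_identity (K : Fin m → Fin m → ℝ) (hK : ∀ i j, K i j = K j i) (U : Fin m → ℝ)
    (B : Fin m → Fin m → Fin m → ℝ) :
    ∑ i, ∑ j, ((1 / 2 * ∑ k, ∑ l, K k l * B i k l) * (K i j * U j)
        - (∑ k, ∑ l, K i k * B i k l * K l j) * U j) =
      -∑ i, ∑ j, K i j * ∑ k, ∑ l, K k l * (1 / 2 * (B i j k + B j i k - B k i j)) * U l := by
  set a : Fin m → ℝ := fun i => ∑ l, K i l * U l with ha
  have e1 : ∀ i, ∑ j, ((1 / 2 * ∑ k, ∑ l, K k l * B i k l) * (K i j * U j)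
        - (∑ k, ∑ l, K i k * B i k l * K l j) * U j) =
      1 / 2 * (∑ k, ∑ l, K k l * B i k l) * a i - ∑ k, ∑ l, K i k * B i k l * a l := by
    intro i
    rw [Finset.sum_sub_distrib, ← Finset.mul_sum]
    congr 1
    simp_rw [Finset.sum_mul]
    rw [Finset.sum_comm]
    refine Finset.sum_congr rfl fun k _ => ?_
    rw [Finset.sum_comm]
    refine Finset.sum_congr rfl fun l _ => ?_
    rw [ha, Finset.mul_sum]
    refine Finset.sum_congr rfl fun j _ => ?_
    ring
  have e2 : ∀ i j, K i j * ∑ k, ∑ l, K k l * (1 / 2 * (B i j k + B j i k - B k i j)) * U l =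
      ∑ k, (1 / 2 * (K i j * B i j k * a k) + 1 / 2 * (K j i * B j i k * a k)
        - 1 / 2 * (K i j * B k i j * a k)) := by
    intro i j
    rw [Finset.mul_sum]
    refine Finset.sum_congr rfl fun k _ => ?_
    have : ∑ l, K k l * (1 / 2 * (B i j k + B j i k - B k i j)) * U l =
        1 / 2 * (B i j k + B j i k - B k i j) * a k := by
      rw [ha, Finset.mul_sum]
      refine Finset.sum_congr rfl fun l _ => ?_
      ring
    rw [this, hK j i]; ring
  simp_rw [e1, e2, Finset.sum_sub_distrib, Finset.sum_add_distrib, ← Finset.mul_sum]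
  have e3 : ∑ i, ∑ j, ∑ k, K j i * B j i k * a k = ∑ i, ∑ j, ∑ k, K i j * B i j k * a k :=
    Finset.sum_comm
  have e4 : ∑ i, ∑ j, ∑ k, K i j * B k i j * a k =
      ∑ i, (∑ k, ∑ l, K k l * B i k l) * a i := by
    simp_rw [Finset.sum_mul]
    rw [← Finset.sum_comm_cycle, Finset.sum_comm]
    exact Finset.sum_congr rfl fun _ _ => Finset.sum_comm
  rw [e3, e4]
  simp_rw [mul_assoc (1 / 2 : ℝ), ← Finset.mul_sum]
  ring

/-- The density `exp (-U) * √(det G)`. -/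
def weightedDensity (G : P → Matrix (Fin m) (Fin m) ℝ) (U : P → ℝ) (z : P) : ℝ :=
  Real.exp (-U z) * √(G z).det

lemma contDiffOn_weightedDensity {G : P → Matrix (Fin m) (Fin m) ℝ} {U : P → ℝ} {s : Set P}
    {k : WithTop ℕ∞} (hG : ∀ i j, ContDiffOn ℝ k (fun z => G z i j) s) (hU : ContDiffOn ℝ k U s)
    (hdet : ∀ z ∈ s, (G z).det ≠ 0) : ContDiffOn ℝ k (weightedDensity G U) s :=
  hU.neg.exp.mul ((contDiffOn_det hG).sqrt hdet)

/-- The logarithmic derivative of the density is `-dU + ½ tr (G⁻¹ dG)`, by Jacobi's formula. -/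
lemma fderiv_weightedDensity {G : P → Matrix (Fin m) (Fin m) ℝ} {U : P → ℝ} {z : P}
    (hG : ∀ i j, DifferentiableAt ℝ (fun z => G z i j) z) (hU : DifferentiableAt ℝ U z)
    (hdet : 0 < (G z).det) (v : P) :
    fderiv ℝ (weightedDensity G U) z v = weightedDensity G U z * (-fderiv ℝ U z v +
      1 / 2 * ∑ i, ∑ j, (G z)⁻¹ j i * fderiv ℝ (fun y => G y i j) z v) := by
  have h1 := (hasFDerivAt_det (fun i j => (hG i j).hasFDerivAt) hdet.ne').sqrt hdet.ne'
  have h2 := hU.hasFDerivAt.neg.exp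
  have h := (h2.mul h1).fderiv
  change fderiv ℝ (fun y => Real.exp (-U y) * √(G y).det) z v = _
  refine (congrArg (fun L => L v) h).trans ?_
  simp only [_root_.add_apply, _root_.smul_apply, smul_eq_mul, _root_.sum_apply,
    _root_.neg_apply, Pi.neg_apply, weightedDensity]
  have hs : √(G z).det ≠ 0 := (Real.sqrt_pos.2 hdet).ne'
  have hs2 : (G z).det = √(G z).det * √(G z).det := (Real.mul_self_sqrt hdet.le).symm
  have : 1 / (2 * √(G z).det) * (G z).det = 1 / 2 * √(G z).det := by
    rw [hs2, Real.sqrt_mul_self (Real.sqrt_nonneg _)]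
    field_simp
  rw [← mul_assoc (1 / (2 * √(G z).det)), this]
  ring

/-- The evolution of a weighted area density under a flow with speed `H + q` in normal direction,
where `q` is the normal derivative of the weight. -/
lemma fderiv_weightedDensity_eq_divergence {G : P → Matrix (Fin m) (Fin m) ℝ} {U : P → ℝ}
    {s : Set P} {z : P} (hs : s ∈ 𝓝 z) (hG : ∀ i j, ContDiffOn ℝ ∞ (fun z => G z i j) s)
    (hU : ContDiffOn ℝ ∞ U s) (hdet : ∀ z ∈ s, 0 < (G z).det)
    (hsymm : (G z)⁻¹.IsSymm) (t : P) (E : Fin m → P) (c : Fin m → Fin m → Fin m → ℝ)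
    (hc : ∀ i j k, c i j k = 1 / 2 * (fderiv ℝ (fun y => G y j k) z (E i)
      + fderiv ℝ (fun y => G y i k) z (E j) - fderiv ℝ (fun y => G y i j) z (E k)))
    (h : Fin m → Fin m → ℝ) (H q : ℝ) (hH : H = ∑ i, ∑ j, (G z)⁻¹ i j * h i j)
    (hUt : fderiv ℝ U z t =
      (∑ i, ∑ j, (G z)⁻¹ i j * (fderiv ℝ U z (E i) * fderiv ℝ U z (E j))) + (q + H) * q)
    (hGt : ∀ i j, fderiv ℝ (fun y => G y i j) z t =
      2 * fderiv ℝ (fun y => fderiv ℝ U y (E j)) z (E i) -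
        2 * (∑ k, ∑ l, (G z)⁻¹ k l * c i j k * fderiv ℝ U z (E l)) - 2 * (q + H) * h i j) :
    fderiv ℝ (weightedDensity G U) z t = -(H + q) ^ 2 * weightedDensity G U z +
      ∑ i, fderiv ℝ (fun y => weightedDensity G U y *
        ∑ j, (G y)⁻¹ i j * fderiv ℝ U y (E j)) z (E i) := by
  have hz := mem_of_mem_nhds hs
  have hdet' : ∀ z ∈ s, (G z).det ≠ 0 := fun z hz => (hdet z hz).ne'
  have dG : ∀ i j, DifferentiableAt ℝ (fun z => G z i j) z := fun i j =>
    ((hG i j).contDiffAt hs).differentiableAt (by simp)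
  have dK : ∀ i j, DifferentiableAt ℝ (fun z => (G z)⁻¹ i j) z := fun i j =>
    ((contDiffOn_inv_apply hG hdet' i j).contDiffAt hs).differentiableAt (by simp)
  have dU : DifferentiableAt ℝ U z := (hU.contDiffAt hs).differentiableAt (by simp)
  have dU2 : ∀ v, DifferentiableAt ℝ (fun y => fderiv ℝ U y v) z := fun v =>
    (((hU.contDiffAt hs).fderiv_right (m := 1) one_add_one_le_infty).differentiableAt
      (by simp)).clm_apply (differentiableAt_const v)
  have dD : DifferentiableAt ℝ (weightedDensity G U) z :=
    ((contDiffOn_weightedDensity hG hU hdet').contDiffAt hs).differentiableAt (by simp)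
  set K : Fin m → Fin m → ℝ := fun i j => (G z)⁻¹ i j with hKdef
  have hK : ∀ i j, K i j = K j i := fun i j => (hsymm.apply i j).symm
  set B : Fin m → Fin m → Fin m → ℝ := fun i k l => fderiv ℝ (fun y => G y k l) z (E i) with hB
  set D := weightedDensity G U z with hD
  set u : Fin m → ℝ := fun i => fderiv ℝ U z (E i) with hu
  set u2 : Fin m → Fin m → ℝ := fun i j => fderiv ℝ (fun y => fderiv ℝ U y (E j)) z (E i) with hu2
  -- The summands are, in order, the parts of `-|∇U|²`, of the coordinate Hessian trace, and of the
  -- terms with derivatives of `G`. The last ones become the Christoffel correction of the Laplacian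
  -- by `divergence_sum_identity`.
  have hdiv : ∀ i, fderiv ℝ (fun y => weightedDensity G U y *
        ∑ j, (G y)⁻¹ i j * fderiv ℝ U y (E j)) z (E i) =
      D * ∑ j, (-(K i j * (u i * u j)) + K i j * u2 i j +
        ((1 / 2 * ∑ k, ∑ l, K k l * B i k l) * (K i j * u j)
        - (∑ k, ∑ l, K i k * B i k l * K l j) * u j)) := by
    intro i
    have d1 : HasFDerivAt (fun y => ∑ j, (G y)⁻¹ i j * fderiv ℝ U y (E j))
        (∑ j, ((G z)⁻¹ i j • fderiv ℝ (fun y => fderiv ℝ U y (E j)) z +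
          fderiv ℝ U z (E j) • fderiv ℝ (fun y => (G y)⁻¹ i j) z)) z :=
      HasFDerivAt.fun_sum fun j _ => (dK i j).hasFDerivAt.mul (dU2 (E j)).hasFDerivAt
    have d2 := (dD.hasFDerivAt.mul d1).fderiv
    refine (congrArg (fun L => L (E i)) d2).trans ?_
    simp only [_root_.add_apply, _root_.smul_apply, smul_eq_mul, _root_.sum_apply]
    rw [fderiv_weightedDensity dG dU (hdet z hz), ← hD]
    have hKK : ∑ k, ∑ l, (G z)⁻¹ l k * fderiv ℝ (fun y => G y k l) z (E i) =
        ∑ k, ∑ l, K k l * B i k l :=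
      Finset.sum_congr rfl fun k _ => Finset.sum_congr rfl fun l _ => by
        rw [show (G z)⁻¹ l k = K l k from rfl, hK l k]
    rw [hKK, mul_comm (∑ j, (G z)⁻¹ i j * fderiv ℝ U z (E j)), mul_assoc, ← mul_add]
    congr 1
    rw [Finset.mul_sum, ← Finset.sum_add_distrib]
    refine Finset.sum_congr rfl fun j _ => ?_
    rw [fderiv_inv_apply dG dK (Filter.mem_of_superset hs hdet')]
    simp only [hKdef, hu, hu2, hB]
    ring
  simp_rw [hdiv, ← Finset.mul_sum, Finset.sum_add_distrib]
  rw [divergence_sum_identity K hK u B, fderiv_weightedDensity dG dU (hdet z hz), ← hD]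
  -- The trace of `∂_t G` is `2 ΔU - 2 (q + H) H`. Half of it, together with the term `-(q + H) q`
  -- of `-∂_t U`, produces the square `-(H + q)²`.
  have hGt' : ∑ i, ∑ j, (G z)⁻¹ j i * fderiv ℝ (fun y => G y i j) z t =
      2 * ∑ i, ∑ j, K i j * u2 i j - 2 * (∑ i, ∑ j, K i j * ∑ k, ∑ l, K k l *
        (1 / 2 * (B i j k + B j i k - B k i j)) * u l) - 2 * (q + H) * H := by
    have hterm : ∀ i j, (G z)⁻¹ j i * fderiv ℝ (fun y => G y i j) z t =
        2 * (K i j * u2 i j) - 2 * (K i j * ∑ k, ∑ l, K k l *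
          (1 / 2 * (B i j k + B j i k - B k i j)) * u l) - 2 * (q + H) * (K i j * h i j) := by
      intro i j
      have hsum : ∑ k, ∑ l, (G z)⁻¹ k l * c i j k * fderiv ℝ U z (E l) =
          ∑ k, ∑ l, K k l * (1 / 2 * (B i j k + B j i k - B k i j)) * u l := by
        simp only [hc]
        rfl
      rw [hGt, hsum, show (G z)⁻¹ j i = K i j from hK j i]
      simp only [hu2]
      ring
    simp_rw [hterm, Finset.sum_sub_distrib, ← Finset.mul_sum]
    rw [show ∑ i, ∑ j, K i j * h i j = H from hH.symm]
  rw [hGt', hUt]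
  have : ∑ i, ∑ j, -(K i j * (u i * u j)) = -∑ i, ∑ j, K i j * (u i * u j) := by
    simp
  rw [this]
  ring

end WeightedDensity

/-! ### Expansion in an adapted frame. -/

section Frame

/-- Expansion of a vector in a frame consisting of tangent vectors and a unit normal. -/
lemma frame_expansion {m : ℕ} {V : Type*} [AddCommGroup V] [Module ℝ V]
    (hV : Module.finrank ℝ V = m + 1) (B : V →ₗ[ℝ] V →ₗ[ℝ] ℝ) (hs : ∀ u v, B u v = B v u)
    (hp : ∀ u, u ≠ 0 → 0 < B u u) {d : Fin m → V} (hd : LinearIndependent ℝ d) {ν : V}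
    (hν : B ν ν = 1) (hνd : ∀ i, B ν (d i) = 0)
    (hG : (Matrix.of fun i j => B (d i) (d j)).det ≠ 0) (X : V) :
    X = (∑ k, ∑ l, ((Matrix.of fun i j => B (d i) (d j))⁻¹ k l * B X (d k)) • d l)
      + B X ν • ν := by
  set G : Matrix (Fin m) (Fin m) ℝ := Matrix.of fun i j => B (d i) (d j) with hGdef
  set Z := (∑ k, ∑ l, (G⁻¹ k l * B X (d k)) • d l) + B X ν • ν with hZ
  have hspan : ν ∉ Submodule.span ℝ (Set.range d) := by
    intro h
    have h1 : Submodule.span ℝ (Set.range d) ≤ LinearMap.ker (B ν) := by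
      rw [Submodule.span_le]
      rintro _ ⟨i, rfl⟩
      exact hνd i
    have h2 : B ν ν = 0 := h1 h
    rw [hν] at h2
    exact one_ne_zero h2
  have hli : LinearIndependent ℝ (Fin.cons ν d : Fin (m + 1) → V) :=
    linearIndependent_finCons.2 ⟨hd, hspan⟩
  let b := basisOfLinearIndependentOfCardEqFinrank hli (by rw [hV, Fintype.card_fin])
  have hb : ∀ i, b i = (Fin.cons ν d : Fin (m + 1) → V) i := fun i => by
    simp [b]
  have hdν : ∀ i, B (d i) ν = 0 := fun i => by rw [hs, hνd]
  -- The normal and the tangent vectors form a basis, so it suffices to pair the difference with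
  -- each of them; positive definiteness then forces it to vanish.
  have hzero : B (X - Z) = 0 := by
    refine b.ext fun i => ?_
    rw [hb]
    refine Fin.cases ?_ (fun r => ?_) i
    · simp only [Fin.cons_zero, map_sub, LinearMap.sub_apply, hZ, map_add, map_sum, map_smul,
        LinearMap.add_apply, LinearMap.sum_apply, LinearMap.smul_apply, smul_eq_mul, hdν, hν]
      simp
    · simp only [Fin.cons_succ, map_sub, LinearMap.sub_apply, hZ, map_add, map_sum, map_smul,
        LinearMap.add_apply, LinearMap.sum_apply, LinearMap.smul_apply, smul_eq_mul, hνd]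
      have h1 : ∀ k, ∑ l, G⁻¹ k l * B X (d k) * B (d l) (d r) =
          (1 : Matrix (Fin m) (Fin m) ℝ) k r * B X (d k) := by
        intro k
        rw [← Matrix.nonsing_inv_mul G hG.isUnit, Matrix.mul_apply, Finset.sum_mul]
        refine Finset.sum_congr rfl fun l _ => ?_
        rw [hGdef, Matrix.of_apply]; ring
      simp_rw [h1]
      simp [Matrix.one_apply]
  by_contra hne
  have := hp (X - Z) (sub_ne_zero.2 hne)
  rw [hzero] at this
  simp at this

end Frame

/-! ### Evolution of the metric and the weight for velocity `∇f + H ν`. -/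

section Flow

open Filter Topology

variable {n m : ℕ} {M : Type*} [TopologicalSpace M] [ChartedSpace (EuclideanSpace ℝ (Fin n)) M]
  [IsManifold (𝓡 n) ∞ M] (g : Metric n M)
  {P : Type*} [NormedAddCommGroup P] [NormedSpace ℝ P]

lemma fderiv_comp_eq_diff {f : M → ℝ} (hf : ContMDiff (𝓡 n) 𝓘(ℝ, ℝ) ∞ f) {Y : P → M} {z : P}
    (hY : MDifferentiableAt 𝓘(ℝ, P) (𝓡 n) Y z) (v : P) :
    fderiv ℝ (f ∘ Y) z v = diff f (Y z) (mfderiv 𝓘(ℝ, P) (𝓡 n) Y z v) := by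
  rw [← mfderiv_eq_fderiv, mfderiv_comp z (hf.mdifferentiableAt (by simp)) hY]
  rfl

/-- `diff` as a linear form on the model space. -/
def diffLin (f : M → ℝ) (q : M) : EuclideanSpace ℝ (Fin n) →ₗ[ℝ] ℝ :=
  (mfderiv (𝓡 n) 𝓘(ℝ, ℝ) f q).toLinearMap

/-- The pullback of the metric to the fields `E i`. -/
def frameGram (Y : P → M) (E : Fin m → P) (z : P) : Matrix (Fin m) (Fin m) ℝ :=
  Matrix.of fun i j => pairing g Y z (E i) (E j)

lemma innerBilin_symm (q : M) (u v : EuclideanSpace ℝ (Fin n)) :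
    innerBilin g q u v = innerBilin g q v u := g.symm q u v

/-- The evolution of the weighted area density of a family of hypersurfaces moving with velocity
`∇ f + H ν` modulo tangential terms. -/
lemma fderiv_weightedDensity_frameGram (hn : n = m + 1) {f : M → ℝ}
    (hf : ContMDiff (𝓡 n) 𝓘(ℝ, ℝ) ∞ f) {Y : P → M} {s : Set P} (hs : IsOpen s) {z : P} (hz : z ∈ s)
    (hY : ContMDiffOn 𝓘(ℝ, P) (𝓡 n) ∞ Y s) (t : P) (E : Fin m → P)
    (hdet : ∀ z ∈ s, (frameGram g Y E z).PosDef)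
    (hli : LinearIndependent ℝ fun i =>
      (mfderiv 𝓘(ℝ, P) (𝓡 n) Y z (E i) : EuclideanSpace ℝ (Fin n)))
    (htan : ∀ z ∈ s, ∀ i, pairing g Y z (E i) t = fderiv ℝ (f ∘ Y) z (E i))
    (ν : EuclideanSpace ℝ (Fin n)) (hν : innerBilin g (Y z) ν ν = 1)
    (hνd : ∀ i, innerBilin g (Y z) ν (mfderiv 𝓘(ℝ, P) (𝓡 n) Y z (E i)) = 0) (H : ℝ)
    (hH : H = contraction (frameGram g Y E z)
      (Matrix.of fun i j => innerBilin g (Y z) (secondCov g Y z (E i) (E j)) ν))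
    (hev : ∀ w, innerBilin g (Y z) (mfderiv 𝓘(ℝ, P) (𝓡 n) Y z t) w =
      diffLin f (Y z) w + H * innerBilin g (Y z) ν w) :
    fderiv ℝ (weightedDensity (frameGram g Y E) (f ∘ Y)) z t =
      -(H + diffLin f (Y z) ν) ^ 2 * weightedDensity (frameGram g Y E) (f ∘ Y) z +
      ∑ i, fderiv ℝ (fun y => weightedDensity (frameGram g Y E) (f ∘ Y) y *
        ∑ j, (frameGram g Y E y)⁻¹ i j * fderiv ℝ (f ∘ Y) y (E j)) z (E i) := by
  have hsz : s ∈ 𝓝 z := hs.mem_nhds hz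
  have hYat : ∀ y ∈ s, ContMDiffAt 𝓘(ℝ, P) (𝓡 n) ∞ Y y := fun y hy =>
    hY.contMDiffAt (hs.mem_nhds hy)
  have hYev : ∀ᶠ y in 𝓝 z, ContMDiffAt 𝓘(ℝ, P) (𝓡 n) ∞ Y y := by
    filter_upwards [hsz] with y hy using hYat y hy
  have hU : ContDiffOn ℝ ∞ (f ∘ Y) s := (hf.comp_contMDiffOn hY).contDiffOn
  set B := innerBilin g (Y z) with hB
  let d : P → EuclideanSpace ℝ (Fin n) := fun v => mfderiv 𝓘(ℝ, P) (𝓡 n) Y z v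
  have hUd : ∀ v, fderiv ℝ (f ∘ Y) z v =
      diffLin f (Y z) (d v) := fun v =>
    fderiv_comp_eq_diff hf ((hYat z hz).mdifferentiableAt (by simp)) v
  set q := diffLin f (Y z) ν
  have hGz : frameGram g Y E z = Matrix.of fun i j => B (d (E i)) (d (E j)) := rfl
  have hexp := fun X => congrArg (diffLin f (Y z)) (frame_expansion (by simp [hn]) B
    (innerBilin_symm g (Y z)) (fun u hu => g.pos (Y z) u hu) (d := fun i => d (E i)) hli hν hνd
    (by have := (hdet z hz).det_pos.ne'; rwa [hGz] at this) X)
  simp only [map_add, map_sum, map_smul, smul_eq_mul] at hexp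
  have hev' : ∀ w, B (d t) w = diffLin f (Y z) w + H * B ν w := hev
  -- Applying `df` to the frame expansion: tangential derivatives of `f` are derivatives of `f ∘ Y`,
  -- and the normal one is `q`.
  have hexp' : ∀ X, diffLin f (Y z) X = (∑ k, ∑ l, (frameGram g Y E z)⁻¹ k l * B X (d (E k)) *
      fderiv ℝ (f ∘ Y) z (E l)) + B X ν * q := fun X => by
    rw [hexp X]
    simp only [hUd, hGz]
    rfl
  have hu2 : ∀ v w, fderiv ℝ (fun y => fderiv ℝ (f ∘ Y) y v) z w =
      fderiv ℝ (fderiv ℝ (f ∘ Y)) z w v := fun v w => by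
    have h1 : DifferentiableAt ℝ (fderiv ℝ (f ∘ Y)) z :=
      ((hU.contDiffAt hsz).fderiv_right (m := 1) one_add_one_le_infty).differentiableAt (by simp)
    have h2 := (h1.hasFDerivAt.clm_apply (hasFDerivAt_const v z)).fderiv
    rw [h2]
    simp
  have hsymm : ∀ v w, fderiv ℝ (fderiv ℝ (f ∘ Y)) z w v = fderiv ℝ (fderiv ℝ (f ∘ Y)) z v w :=
    fun v w => ((hU.contDiffAt hsz).isSymmSndFDerivAt (by simpa using two_le_infty)).eq w v
  -- The tangential components of the velocity are differentiated below, so their identification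
  -- with `d(f ∘ Y)` is needed near `z` and not only at `z`.
  have htan' : ∀ i, (fun y => pairing g Y y (E i) t) =ᶠ[𝓝 z] fun y => fderiv ℝ (f ∘ Y) y (E i) :=
    fun i => by filter_upwards [hsz] with y hy using htan y hy i
  have hWk : ∀ k, B (d t) (d (E k)) = fderiv ℝ (f ∘ Y) z (E k) := fun k => by
    rw [hB, innerBilin_symm]; exact htan z hz k
  refine fderiv_weightedDensity_eq_divergence (G := frameGram g Y E) hsz
    (fun i j => contDiffOn_pairing g hs hY (E i) (E j)) hU (fun y hy => (hdet y hy).det_pos)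
    ?_ t E (fun i j k => B (secondCov g Y z (E i) (E j)) (d (E k))) ?_
    (fun i j => B (secondCov g Y z (E i) (E j)) ν) H q hH ?_ ?_
  · have h := (hdet z hz).isHermitian.inv
    have : (frameGram g Y E z)⁻¹.transpose = (frameGram g Y E z)⁻¹ := by
      simpa [Matrix.IsHermitian, Matrix.conjTranspose_eq_transpose_of_trivial] using h
    exact this
  · intro i j k
    have h := koszul_pairing g hYev (E i) (E j) (E k)
    have h' : 2 * B (secondCov g Y z (E i) (E j)) (d (E k)) = _ := h
    change _ = 1 / 2 * (fderiv ℝ (fun y => pairing g Y y (E j) (E k)) z (E i) +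
      fderiv ℝ (fun y => pairing g Y y (E i) (E k)) z (E j) -
      fderiv ℝ (fun y => pairing g Y y (E i) (E j)) z (E k))
    rw [← h']; ring
  -- The time derivative of the weight is `df` of the velocity, whose tangential components are
  -- those of `d(f ∘ Y)` and whose normal component is `q + H`.
  · rw [hUd, hexp', hev' ν, hν]
    congr 1
    · refine Finset.sum_congr rfl fun k _ => Finset.sum_congr rfl fun l _ => ?_
      rw [hWk]; ring
    · ring
  -- The Koszul formula with third vector `t` is solved for the time derivative of the Gram matrix.
  -- Its first two terms are equal mixed second derivatives of `f ∘ Y`, and pairing the acceleration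
  -- with the velocity uses `hev` and the frame expansion.
  · intro i j
    have h := koszul_pairing g hYev (E i) (E j) t
    rw [(htan' i).fderiv_eq, (htan' j).fderiv_eq, hu2 (E i) (E j), hsymm, ← hu2] at h
    have h' : 2 * B (secondCov g Y z (E i) (E j)) (d t) = _ := h
    rw [hB, innerBilin_symm, ← hB, hev', hexp', hB, innerBilin_symm g (Y z) ν, ← hB] at h'
    change fderiv ℝ (fun y => pairing g Y y (E i) (E j)) z t = _
    linarith

end Flow

/-! ### Gradients, and mean curvature under homotheties. -/

section Isometry

open Filter Topology

variable {n m : ℕ} {M : Type*} [TopologicalSpace M] [ChartedSpace (EuclideanSpace ℝ (Fin n)) M]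
  [IsManifold (𝓡 n) ∞ M] (g g' : Metric n M)
  {P : Type*} [NormedAddCommGroup P] [NormedSpace ℝ P]

lemma innerBilin_grad {f : M → ℝ} (hf : ContMDiff (𝓡 n) 𝓘(ℝ, ℝ) ∞ f) (q : M)
    (w : EuclideanSpace ℝ (Fin n)) : innerBilin g q (grad g f q) w = diffLin f q w := by
  set z := extChartAt (𝓡 n) q q with hz
  have hzt : z ∈ (extChartAt (𝓡 n) q).target := mem_extChartAt_target q
  have hdf : ∀ j, pd j (f ∘ (extChartAt (𝓡 n) q).symm) z = diffLin f q (basisVec j) := by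
    intro j
    have h := fderiv_comp_eq_diff hf
      ((contMDiffAt_chart_symm hzt).mdifferentiableAt (by simp)) (basisVec j)
    rw [pd, h, hz, mfderiv_extChartAt_symm_self, extChartAt_to_inv]
    rfl
  have hlin : ∀ (L : EuclideanSpace ℝ (Fin n) →ₗ[ℝ] ℝ) (u : EuclideanSpace ℝ (Fin n)),
      L u = ∑ i, u i * L (basisVec i) := fun L u => by
    simpa using map_eq_sum_basisVec (LinearMap.toContinuousLinearMap L) u
  have hc : ∀ i r, innerBilin g q (basisVec i) (basisVec r) = coeff g q z r i := fun i r => by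
    rw [innerBilin_symm, ← chartForm_basisVec, chartForm_self]
    rfl
  obtain ⟨G, hG⟩ : ∃ G : EuclideanSpace ℝ (Fin n), G = grad g f q := ⟨_, rfl⟩
  have hgr : ∀ i, G i = ∑ j, (coeff g q z)⁻¹ i j * diffLin f q (basisVec j) := fun i => by
    rw [hG]
    simp_rw [← hdf]
    rfl
  suffices goal : innerBilin g q G w = diffLin f q w by
    rw [hG] at goal
    exact goal
  rw [hlin (innerBilin g q G) w, hlin (diffLin f q) w]
  refine Finset.sum_congr rfl fun r _ => ?_
  congr 1
  have h2 : innerBilin g q G (basisVec r) =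
      ∑ i, G i * innerBilin g q (basisVec i) (basisVec r) :=
    hlin ((innerBilin g q).flip (basisVec r)) G
  rw [h2]
  simp_rw [hgr, hc, Finset.sum_mul]
  rw [Finset.sum_comm]
  have h3 : ∀ j, ∑ i, (coeff g q z)⁻¹ i j * diffLin f q (basisVec j) * coeff g q z r i =
      (if r = j then 1 else 0) * diffLin f q (basisVec j) := by
    intro j
    rw [← Matrix.one_apply, ← Matrix.mul_nonsing_inv _ (isUnit_det_coeff g q), Matrix.mul_apply,
      Finset.sum_mul]
    refine Finset.sum_congr rfl fun i _ => ?_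
    ring
  simp_rw [h3]
  simp

/-- Invariance of the covariant derivative under homotheties. -/
lemma innerBilin_secondCov_homothety {ψ : M → M} (hψ : ContMDiff (𝓡 n) (𝓡 n) ∞ ψ) {c : ℝ}
    (hiso : ∀ q u v, innerBilin g' q u v = c *
      innerBilin g (ψ q) (mfderiv (𝓡 n) (𝓡 n) ψ q u) (mfderiv (𝓡 n) (𝓡 n) ψ q v))
    {Y : P → M} {y : P} (hY : ∀ᶠ x in 𝓝 y, ContMDiffAt 𝓘(ℝ, P) (𝓡 n) ∞ Y x) (α β : P)
    (w : EuclideanSpace ℝ (Fin n)) :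
    innerBilin g' (Y y) (secondCov g' Y y α β) w =
      c * innerBilin g (ψ (Y y)) (secondCov g (ψ ∘ Y) y α β)
        (mfderiv (𝓡 n) (𝓡 n) ψ (Y y) w) := by
  set κ := extChartAt (𝓡 n) (Y y) with hκ
  have hY0 := hY.self_of_nhds
  -- The Koszul formula only sees vectors in the image of the derivative. An additional parameter
  -- moving `Y` in the direction `w` brings an arbitrary `w` into that image.
  let V : ℝ × P → EuclideanSpace ℝ (Fin n) := fun z => κ (Y z.2) + z.1 • w
  let Z : ℝ × P → M := fun z => κ.symm (V z)
  let ι : P →L[ℝ] ℝ × P := ContinuousLinearMap.inr ℝ ℝ P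
  have hι : ∀ x, ι x = (0, x) := fun x => rfl
  have hV0 : V (ι y) = κ (Y y) := by simp [V, hι]
  have hV : ∀ᶠ z in 𝓝 (ι y), ContDiffAt ℝ ∞ V z := by
    have h1 : ∀ᶠ x in 𝓝 y, ContDiffAt ℝ ∞ (chartRep n (Y y) Y) x := by
      filter_upwards [hY, hY0.continuousAt.preimage_mem_nhds
        ((isOpen_extChartAt_source (I := 𝓡 n) (Y y)).mem_nhds (mem_extChartAt_source (Y y)))]
        with x hx hx' using contDiffAt_chartRep hx hx'
    have h2 : ∀ᶠ z : ℝ × P in 𝓝 (ι y), ContDiffAt ℝ ∞ (chartRep n (Y y) Y) z.2 :=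
      (continuous_snd.tendsto (ι y)).eventually h1
    filter_upwards [h2] with z hz
    exact (hz.comp z contDiffAt_snd).add (contDiffAt_fst.smul contDiffAt_const)
  have hZ : ∀ᶠ z in 𝓝 (ι y), ContMDiffAt 𝓘(ℝ, ℝ × P) (𝓡 n) ∞ Z z := by
    have h1 : ∀ᶠ z in 𝓝 (ι y), V z ∈ κ.target := by
      refine hV.self_of_nhds.continuousAt.preimage_mem_nhds ?_
      rw [hV0]
      exact (isOpen_extChartAt_target _).mem_nhds (mem_extChartAt_target _)
    filter_upwards [hV, h1] with z hz hz'
    exact (contMDiffAt_chart_symm hz').comp z hz.contMDiffAt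
  have hZ0 := hZ.self_of_nhds
  have hZι : Z ∘ ι =ᶠ[𝓝 y] Y := by
    filter_upwards [hY0.continuousAt.preimage_mem_nhds
        ((isOpen_extChartAt_source (I := 𝓡 n) (Y y)).mem_nhds (mem_extChartAt_source (Y y)))]
        with x hx
    simp only [Function.comp_apply, Z, V, hι, zero_smul, add_zero]
    exact κ.left_inv hx
  have hZy : Z (ι y) = Y y := hZι.self_of_nhds
  have hψZ : ∀ᶠ z in 𝓝 (ι y), ContMDiffAt 𝓘(ℝ, ℝ × P) (𝓡 n) ∞ (ψ ∘ Z) z := by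
    filter_upwards [hZ] with z hz using hψ.contMDiffAt.comp z hz
  have hιd : fderiv ℝ ι y = ι := ι.fderiv
  have hιdd : fderiv ℝ (fderiv ℝ ι) y α β = 0 := by
    have : fderiv ℝ ι = fun _ => ι := by ext1 x; exact ι.fderiv
    rw [this]; simp
  have e1 : secondCov g' Y y α β = secondCov g' Z (ι y) (ι α) (ι β) := by
    rw [secondCov_congr g' hZι.symm, secondCov_comp g' hZ0 ι.contDiff.contDiffAt, hιdd, hιd]
    simp
  have e2 : secondCov g (ψ ∘ Y) y α β = secondCov g (ψ ∘ Z) (ι y) (ι α) (ι β) := by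
    have hc : ψ ∘ Y =ᶠ[𝓝 y] (ψ ∘ Z) ∘ ι := by
      filter_upwards [hZι] with x hx
      simp only [Function.comp_apply] at hx ⊢
      rw [hx]
    rw [secondCov_congr g hc, secondCov_comp g hψZ.self_of_nhds ι.contDiff.contDiffAt, hιdd, hιd]
    simp
  have hψd : ∀ z, ContMDiffAt 𝓘(ℝ, ℝ × P) (𝓡 n) ∞ Z z → ∀ v : ℝ × P,
      mfderiv 𝓘(ℝ, ℝ × P) (𝓡 n) (ψ ∘ Z) z v =
        mfderiv (𝓡 n) (𝓡 n) ψ (Z z) (mfderiv 𝓘(ℝ, ℝ × P) (𝓡 n) Z z v) := by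
    intro z hz v
    rw [mfderiv_comp z (hψ.mdifferentiableAt (by simp)) (hz.mdifferentiableAt (by simp))]
    rfl
  have hp : ∀ a b : ℝ × P, (fun z => pairing g' Z z a b) =ᶠ[𝓝 (ι y)]
      fun z => c * pairing g (ψ ∘ Z) z a b := by
    intro a b
    filter_upwards [hZ] with z hz
    rw [pairing, pairing, hψd z hz, hψd z hz]
    exact hiso (Z z) _ _
  -- The pullbacks of the two metrics to the enlarged parameter space differ by the constant factor
  -- `c`, and so do the right sides of their Koszul formulas.
  have hpd : ∀ a b v : ℝ × P, fderiv ℝ (fun z => pairing g' Z z a b) (ι y) v =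
      c * fderiv ℝ (fun z => pairing g (ψ ∘ Z) z a b) (ι y) v := by
    intro a b v
    have h := fderiv_const_smul_field (𝕜 := ℝ) (f := fun z => pairing g (ψ ∘ Z) z a b) c
    rw [(hp a b).fderiv_eq]
    exact congrArg (fun L => L (ι y) v) h
  have hw : (mfderiv 𝓘(ℝ, ℝ × P) (𝓡 n) Z (ι y) (1, 0) : EuclideanSpace ℝ (Fin n)) = w := by
    have h1 := mfderiv_eq_chart hZ0 (q := Y y)
      (by rw [hZy]; exact mem_extChartAt_source _) ((1, 0) : ℝ × P)
    have h2 : chartRep n (Y y) Z =ᶠ[𝓝 (ι y)] V := by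
      have h3 : ∀ᶠ z in 𝓝 (ι y), V z ∈ κ.target := by
        refine hV.self_of_nhds.continuousAt.preimage_mem_nhds ?_
        rw [hV0]
        exact (isOpen_extChartAt_target _).mem_nhds (mem_extChartAt_target _)
      filter_upwards [h3] with z hz using κ.right_inv hz
    rw [h2.fderiv_eq, h2.self_of_nhds, hV0, mfderiv_extChartAt_symm_self] at h1
    refine Eq.trans h1 ?_
    have h4 : HasFDerivAt V ((fderiv ℝ (chartRep n (Y y) Y) y).comp (ContinuousLinearMap.snd ℝ ℝ P)
        + (ContinuousLinearMap.fst ℝ ℝ P).smulRight w) (ι y) := by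
      have h5 : HasFDerivAt (chartRep n (Y y) Y) (fderiv ℝ (chartRep n (Y y) Y) y) ((ι y).2) :=
        ((contDiffAt_chartRep hY0 (mem_extChartAt_source _)).differentiableAt
          (by simp)).hasFDerivAt
      exact (h5.comp (ι y) hasFDerivAt_snd).add
        ((ContinuousLinearMap.fst ℝ ℝ P).hasFDerivAt.smul_const w)
    rw [h4.fderiv]
    simp
    rfl
  have k1 := koszul_pairing g' hZ (ι α) (ι β) (1, 0)
  have k2 := koszul_pairing g hψZ (ι α) (ι β) (1, 0)
  have k1' : 2 * innerBilin g' (Z (ι y)) (secondCov g' Z (ι y) (ι α) (ι β))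
    (mfderiv 𝓘(ℝ, ℝ × P) (𝓡 n) Z (ι y) (1, 0)) = _ := k1
  have k2' : 2 * innerBilin g (ψ (Z (ι y))) (secondCov g (ψ ∘ Z) (ι y) (ι α) (ι β))
    (mfderiv 𝓘(ℝ, ℝ × P) (𝓡 n) (ψ ∘ Z) (ι y) (1, 0)) = _ := k2
  rw [hpd, hpd, hpd, hw, hZy, ← e1] at k1'
  rw [hψd _ hZ0, hw, ← e2, hZy] at k2'
  linear_combination (1 / 2) * k1' - c / 2 * k2'

/-- Behaviour of the mean curvature under homotheties. -/
lemma meanCurvature_homothety {S : Type*} [TopologicalSpace S]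
    [ChartedSpace (EuclideanSpace ℝ (Fin m)) S] [IsManifold (𝓡 m) ∞ S]
    {ψ : M → M} (hψ : ContMDiff (𝓡 n) (𝓡 n) ∞ ψ) {c : ℝ} (hc : 0 < c)
    (hiso : ∀ q u v, innerBilin g' q u v = c *
      innerBilin g (ψ q) (mfderiv (𝓡 n) (𝓡 n) ψ q u) (mfderiv (𝓡 n) (𝓡 n) ψ q v))
    {F : S → M} (hF : ContMDiff (𝓡 m) (𝓡 n) ∞ F)
    (p : S) (e : EuclideanSpace ℝ (Fin n)) :
    meanCurvature g m (ψ ∘ F) p (mfderiv (𝓡 n) (𝓡 n) ψ (F p) e) = meanCurvature g' m F p e := by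
  set y := extChartAt (𝓡 m) p p with hy
  have hyt : y ∈ (extChartAt (𝓡 m) p).target := mem_extChartAt_target p
  have hFy : (F ∘ (extChartAt (𝓡 m) p).symm) y = F p := by
    simp only [Function.comp_apply]
    rw [hy, extChartAt_to_inv]
  have hYev : ∀ᶠ z in 𝓝 y,
      ContMDiffAt (𝓡 m) (𝓡 n) ∞ (F ∘ (extChartAt (𝓡 m) p).symm) z := by
    filter_upwards [(isOpen_extChartAt_target p).mem_nhds hyt] with z hz
      using contMDiffAt_comp_chart_symm hz hF
  have hG : gram g' F p y = c • gram g (ψ ∘ F) p y := by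
    ext i j
    have hd : ∀ v : EuclideanSpace ℝ (Fin m),
        mfderiv (𝓡 m) (𝓡 n) (ψ ∘ F ∘ (extChartAt (𝓡 m) p).symm) y v =
          mfderiv (𝓡 n) (𝓡 n) ψ ((F ∘ (extChartAt (𝓡 m) p).symm) y)
            (mfderiv (𝓡 m) (𝓡 n) (F ∘ (extChartAt (𝓡 m) p).symm) y v) := by
      intro v
      rw [mfderiv_comp y (hψ.mdifferentiableAt (by simp))
        (hYev.self_of_nhds.mdifferentiableAt (by simp))]
      rfl
    have h1 := hiso ((F ∘ (extChartAt (𝓡 m) p).symm) y)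
      (mfderiv (𝓡 m) (𝓡 n) (F ∘ (extChartAt (𝓡 m) p).symm) y (basisVec i))
      (mfderiv (𝓡 m) (𝓡 n) (F ∘ (extChartAt (𝓡 m) p).symm) y (basisVec j))
    have h2 : (c • gram g (ψ ∘ F) p y) i j = c * innerBilin g
      (ψ ((F ∘ (extChartAt (𝓡 m) p).symm) y))
      (mfderiv (𝓡 m) (𝓡 n) (ψ ∘ F ∘ (extChartAt (𝓡 m) p).symm) y (basisVec i))
      (mfderiv (𝓡 m) (𝓡 n) (ψ ∘ F ∘ (extChartAt (𝓡 m) p).symm) y (basisVec j)) := rfl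
    rw [h2]
    refine Eq.trans h1 ?_
    congr 1
    rw [← hd, ← hd]
  have hGi : (gram g' F p y)⁻¹ = c⁻¹ • (gram g (ψ ∘ F) p y)⁻¹ := by
    rw [hG]
    -- No immersion hypothesis is made here: if the Gram matrix is singular, both inverses are zero
    -- by convention.
    by_cases hdet : IsUnit (gram g (ψ ∘ F) p y).det
    · have := invertibleOfNonzero hc.ne'
      rw [Matrix.inv_smul _ _ hdet]
      simp
    · rw [Matrix.nonsing_inv_apply_not_isUnit _ hdet, Matrix.nonsing_inv_apply_not_isUnit, smul_zero]
      rw [Matrix.det_smul, IsUnit.mul_iff]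
      tauto
  have l : meanCurvature g m (ψ ∘ F) p (mfderiv (𝓡 n) (𝓡 n) ψ (F p) e) =
      ∑ i, ∑ j, (gram g (ψ ∘ F) p y)⁻¹ i j * innerBilin g (ψ (F p)) (covDeriv g (ψ ∘ F) p i j)
        (mfderiv (𝓡 n) (𝓡 n) ψ (F p) e) := rfl
  have r : meanCurvature g' m F p e =
      ∑ i, ∑ j, (gram g' F p y)⁻¹ i j * innerBilin g' (F p) (covDeriv g' F p i j) e := rfl
  rw [l, r, hGi]
  refine Finset.sum_congr rfl fun i _ => Finset.sum_congr rfl fun j _ => ?_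
  have h3 := innerBilin_secondCov_homothety g g' hψ hiso hYev (basisVec i) (basisVec j) e
  rw [covDeriv_eq g' hF, covDeriv_eq g (hψ.comp hF)]
  rw [hFy] at h3
  have h4 : secondCov g ((ψ ∘ F) ∘ (extChartAt (𝓡 m) p).symm) y (basisVec i) (basisVec j) =
    secondCov g (ψ ∘ F ∘ (extChartAt (𝓡 m) p).symm) y (basisVec i) (basisVec j) := rfl
  -- The factor `c` of the second fundamental form cancels the `c⁻¹` of the inverse Gram matrix. No
  -- square root occurs because `dψ(e)` is not renormalized.
  rw [h3, h4, Matrix.smul_apply, smul_eq_mul]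
  field_simp

end Isometry

/-! ### Uniqueness of the normal direction. -/

section Normal

variable {n m : ℕ} {M : Type*} [TopologicalSpace M] [ChartedSpace (EuclideanSpace ℝ (Fin n)) M]
  [IsManifold (𝓡 n) ∞ M] (g : Metric n M)

lemma innerBilin_pos (q : M) {u : EuclideanSpace ℝ (Fin n)} (hu : u ≠ 0) :
    0 < innerBilin g q u u := g.pos q u hu

lemma gramMatrix_det_ne_zero {q : M} {d : Fin m → EuclideanSpace ℝ (Fin n)}
    (hd : LinearIndependent ℝ d) :
    (Matrix.of fun i j => innerBilin g q (d i) (d j)).det ≠ 0 := by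
  have hB := posDef_of_linearIndependent (chartForm g q (extChartAt (𝓡 n) q q))
    (fun u v => chartForm_symm g _ _ u v)
    (fun u hu => by
      rw [chartForm_self]
      exact g.pos _ _ hu) hd
  have h : (Matrix.of fun i j => innerBilin g q (d i) (d j)) =
      Matrix.of fun i j => chartForm g q (extChartAt (𝓡 n) q q) (d i) (d j) := by
    ext i j
    simp only [Matrix.of_apply, chartForm_self]
    rfl
  rw [h]
  exact hB.det_pos.ne'

lemma linearIndependent_apply_basisVec
    {d : EuclideanSpace ℝ (Fin m) →ₗ[ℝ] EuclideanSpace ℝ (Fin n)} (hd : Function.Injective d) :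
    LinearIndependent ℝ fun i => d (basisVec i) := by
  have h1 := (EuclideanSpace.basisFun (Fin m) ℝ).toBasis.linearIndependent.map' d
    (LinearMap.ker_eq_bot.2 hd)
  have h2 : (d ∘ (EuclideanSpace.basisFun (Fin m) ℝ).toBasis) = fun i => d (basisVec i) := by
    ext i : 1
    simp
  rwa [h2] at h1

/-- A normal vector of a hypersurface is a multiple of the unit normal. -/
lemma normal_eq_smul (hn : n = m + 1) {q : M}
    {d : EuclideanSpace ℝ (Fin m) →ₗ[ℝ] EuclideanSpace ℝ (Fin n)} (hd : Function.Injective d)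
    {ν η : EuclideanSpace ℝ (Fin n)} (hν : innerBilin g q ν ν = 1)
    (hνd : ∀ v, innerBilin g q ν (d v) = 0) (hη : ∀ v, innerBilin g q η (d v) = 0) :
    η = innerBilin g q η ν • ν := by
  have hli := linearIndependent_apply_basisVec hd
  have h := frame_expansion (by simp [hn]) (innerBilin g q) (innerBilin_symm g q)
    (fun u hu => innerBilin_pos g q hu) hli hν (fun i => hνd _) (gramMatrix_det_ne_zero g hli) η
  simpa [hη] using h

lemma meanCurvature_smul {S : Type*} [TopologicalSpace S]
    [ChartedSpace (EuclideanSpace ℝ (Fin m)) S] (F : S → M) (p : S) (c : ℝ)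
    (e : EuclideanSpace ℝ (Fin n)) :
    meanCurvature g m F p (c • e : EuclideanSpace ℝ (Fin n)) = c * meanCurvature g m F p e := by
  have h : ∀ a : EuclideanSpace ℝ (Fin n), meanCurvature g m F p a =
    ∑ i, ∑ j, (gram g F p (extChartAt (𝓡 m) p p))⁻¹ i j *
      innerBilin g (F p) (covDeriv g F p i j) a := fun _ => rfl
  simp only [h, map_smul, smul_eq_mul, Finset.mul_sum]
  refine Finset.sum_congr rfl fun i _ => Finset.sum_congr rfl fun j _ => ?_
  ring

end Normal

/-! ### The normalized flow moves with velocity `∇f + H ν`. -/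

section NormalizedFlow

variable {n m : ℕ} {M : Type*} [TopologicalSpace M] [ChartedSpace (EuclideanSpace ℝ (Fin n)) M]
  [IsManifold (𝓡 n) ∞ M] {g : Metric n M}
  {S : Type*} [TopologicalSpace S] [ChartedSpace (EuclideanSpace ℝ (Fin m)) S]
  [IsManifold (𝓡 m) ∞ S]
  {w f : M → ℝ} {T : ℝ} {ψ : ℝ → Diffeomorph (𝓡 n) (𝓡 n) M M ∞}
  {gbar : ℝ → Metric n M} {wbar : ℝ → M → ℝ}
  {x : ℝ → S → M} {e : ∀ (t : ℝ) (p : S), TangentSpace (𝓡 n) (x t p)}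

lemma unnormalized_time_mem (hT : 0 < T) {s : ℝ} (hs : s ∈ Ici (-Real.log T)) :
    T - Real.exp (-s) ∈ Ico 0 T := by
  have h1 : Real.exp (-s) ≤ T := by
    rw [← Real.le_log_iff_exp_le hT]
    linarith [mem_Ici.1 hs]
  exact ⟨by linarith, by linarith [Real.exp_pos (-s)]⟩

lemma contMDiffOn_normalizedFlow (hT : 0 < T)
    (hsol : IsShrinkingSelfSimilarSolution g w f T ψ gbar wbar)
    (hmcf : IsMeanCurvatureFlow m gbar T x e) :
    ContMDiffOn (𝓘(ℝ, ℝ).prod (𝓡 m)) (𝓡 n) ∞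
      (fun z : ℝ × S => normalizedFlow T ψ x z.1 z.2) (Ici (-Real.log T) ×ˢ univ) := by
  have ht : ContMDiff (𝓘(ℝ, ℝ).prod (𝓡 m)) 𝓘(ℝ, ℝ) ∞
      (fun z : ℝ × S => T - Real.exp (-z.1)) := by
    have h : ContDiff ℝ ∞ (fun s : ℝ => T - Real.exp (-s)) :=
      contDiff_const.sub (Real.contDiff_exp.comp contDiff_neg)
    exact h.contMDiff.comp contMDiff_fst
  have h1 : ContMDiffOn (𝓘(ℝ, ℝ).prod (𝓡 m)) (𝓡 n) ∞
      (fun z : ℝ × S => x (T - Real.exp (-z.1)) z.2) (Ici (-Real.log T) ×ˢ univ) :=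
    hmcf.smooth.comp (ht.prodMk contMDiff_snd).contMDiffOn
      fun z hz => ⟨unnormalized_time_mem hT hz.1, mem_univ _⟩
  exact hsol.smooth_flow.comp (ht.contMDiffOn.prodMk h1)
    fun z hz => ⟨(unnormalized_time_mem hT hz.1).2, mem_univ _⟩

lemma contMDiff_slice_of_contMDiffOn {J : Set ℝ} {X : ℝ → S → M}
    (hX : ContMDiffOn (𝓘(ℝ, ℝ).prod (𝓡 m)) (𝓡 n) ∞ (fun z : ℝ × S => X z.1 z.2) (J ×ˢ univ))
    {s : ℝ} (hs : s ∈ J) : ContMDiff (𝓡 m) (𝓡 n) ∞ (X s) := by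
  rw [← contMDiffOn_univ]
  exact hX.comp (contMDiff_const.prodMk contMDiff_id).contMDiffOn fun p _ => ⟨hs, mem_univ _⟩

lemma innerBilin_gbar (hsol : IsShrinkingSelfSimilarSolution g w f T ψ gbar wbar) {t : ℝ}
    (ht : t < T) (q : M) (u v : EuclideanSpace ℝ (Fin n)) :
    innerBilin (gbar t) q u v = (T - t) * innerBilin g (ψ t q)
      (mfderiv (𝓡 n) (𝓡 n) (ψ t) q u) (mfderiv (𝓡 n) (𝓡 n) (ψ t) q v) :=
  hsol.metric_eq t ht q u v

/-- A kernel vector of `dψ_t` would have zero length for `gbar t`, by the self-similarity of the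
metric. -/
lemma mfderiv_flow_injective (hsol : IsShrinkingSelfSimilarSolution g w f T ψ gbar wbar) {t : ℝ}
    (ht : t < T) (q : M) : Function.Injective (mfderiv (𝓡 n) (𝓡 n) (ψ t) q) := by
  refine (injective_iff_map_eq_zero _).2 fun u hu => ?_
  by_contra h
  have h1 := innerBilin_pos (gbar t) q h
  have h2 := innerBilin_gbar hsol ht q u u
  have h3 : innerBilin (gbar t) q u u = 0 := by
    refine h2.trans ?_
    have h4 : innerBilin g (ψ t q) (mfderiv (𝓡 n) (𝓡 n) (ψ t) q u)
        (mfderiv (𝓡 n) (𝓡 n) (ψ t) q u) = 0 :=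
      (congrArg (fun a => innerBilin g (ψ t q) a a) hu).trans
        (LinearMap.map_zero₂ (innerBilin g (ψ t q)) 0)
    exact (congrArg ((T - t) * ·) h4).trans (mul_zero _)
  exact h1.ne' h3

lemma mfderiv_normalizedFlow_apply (hT : 0 < T)
    (hmcf : IsMeanCurvatureFlow m gbar T x e) {s : ℝ} (hs : s ∈ Ici (-Real.log T)) (p : S)
    (v : EuclideanSpace ℝ (Fin m)) :
    mfderiv (𝓡 m) (𝓡 n) (normalizedFlow T ψ x s) p v =
      mfderiv (𝓡 n) (𝓡 n) (ψ (T - Real.exp (-s))) (x (T - Real.exp (-s)) p)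
        (mfderiv (𝓡 m) (𝓡 n) (x (T - Real.exp (-s))) p v) := by
  have h1 := contMDiff_slice_of_contMDiffOn hmcf.smooth (unnormalized_time_mem hT hs)
  have h2 := mfderiv_comp p ((ψ (T - Real.exp (-s))).contMDiff.mdifferentiableAt (by simp))
    (h1.mdifferentiableAt (by simp) (x := p))
  exact congrArg (fun L => L v) h2

lemma mfderiv_normalizedFlow_injective (hT : 0 < T)
    (hsol : IsShrinkingSelfSimilarSolution g w f T ψ gbar wbar)
    (hmcf : IsMeanCurvatureFlow m gbar T x e) {s : ℝ} (hs : s ∈ Ici (-Real.log T)) (p : S) :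
    Function.Injective (mfderiv (𝓡 m) (𝓡 n) (normalizedFlow T ψ x s) p) := by
  have ht := unnormalized_time_mem hT hs
  intro u v huv
  have hu := mfderiv_normalizedFlow_apply (ψ := ψ) hT hmcf hs p u
  have hv := mfderiv_normalizedFlow_apply (ψ := ψ) hT hmcf hs p v
  exact hmcf.immersion _ ht p (mfderiv_flow_injective hsol ht.2 _ (hu.symm.trans (huv.trans hv)))

/-- The velocity of the normalized flow. -/
lemma velocity_normalizedFlow (hT : 0 < T)
    (hsol : IsShrinkingSelfSimilarSolution g w f T ψ gbar wbar)
    (hmcf : IsMeanCurvatureFlow m gbar T x e) {s : ℝ} (hs : s ∈ Ici (-Real.log T)) (p : S)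
    (v : EuclideanSpace ℝ (Fin n)) :
    innerBilin g (normalizedFlow T ψ x s p) (mfderivWithin 𝓘(ℝ, ℝ) (𝓡 n)
      (fun σ => normalizedFlow T ψ x σ p) (Ici (-Real.log T)) s (1 : ℝ)) v =
    diffLin f (normalizedFlow T ψ x s p) v +
      Real.exp (-s) * (meanCurvature (gbar (T - Real.exp (-s))) m (x (T - Real.exp (-s))) p
        (e (T - Real.exp (-s)) p) * innerBilin g (normalizedFlow T ψ x s p)
      (mfderiv (𝓡 n) (𝓡 n) (ψ (T - Real.exp (-s))) (x (T - Real.exp (-s)) p)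
        (e (T - Real.exp (-s)) p)) v) := by
  set t := T - Real.exp (-s) with ht_def
  have ht : t ∈ Ico 0 T := unnormalized_time_mem hT hs
  have hexp : T - t = Real.exp (-s) := by rw [ht_def]; ring
  let J := Ici (-Real.log T)
  have hu : UniqueMDiffWithinAt 𝓘(ℝ, ℝ) J s :=
    (uniqueDiffOn_Ici _ s hs).uniqueMDiffWithinAt
  let θ : ℝ → ℝ := fun σ => T - Real.exp (-σ)
  -- The time change satisfies `dt/ds = exp (-s) = T - t`; everything stays one-sided to cover the
  -- initial time.
  have hθ : HasMFDerivWithinAt 𝓘(ℝ, ℝ) 𝓘(ℝ, ℝ) θ J s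
      (ContinuousLinearMap.toSpanSingleton ℝ (Real.exp (-s))) := by
    have h1 : HasDerivAt θ (Real.exp (-s)) s := by
      have := ((hasDerivAt_neg s).exp).const_sub T
      simpa using this
    exact h1.hasFDerivAt.hasFDerivWithinAt.hasMFDerivWithinAt
  have hx : MDifferentiableWithinAt 𝓘(ℝ, ℝ) (𝓡 n) (fun τ => x τ p) (Ico 0 T) t := by
    have h1 : ContMDiffOn 𝓘(ℝ, ℝ) (𝓡 n) ∞ (fun τ => x τ p) (Ico 0 T) :=
      hmcf.smooth.comp (contMDiff_id.prodMk contMDiff_const).contMDiffOn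
        fun τ hτ => ⟨hτ, mem_univ _⟩
    exact (h1 t ht).mdifferentiableWithinAt (by simp)
  have hmaps : J ⊆ θ ⁻¹' Ico 0 T := fun σ hσ => unnormalized_time_mem hT hσ
  have hxθ := HasMFDerivWithinAt.comp s (hx.hasMFDerivWithinAt :
    HasMFDerivWithinAt 𝓘(ℝ, ℝ) (𝓡 n) (fun τ => x τ p) (Ico 0 T) (θ s) _) hθ hmaps
  have hγ := hθ.prodMk hxθ
  have hΨ : MDifferentiableAt (𝓘(ℝ, ℝ).prod (𝓡 n)) (𝓡 n) (fun z : ℝ × M => ψ z.1 z.2)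
      (t, x t p) := by
    have hmem : Iio T ×ˢ univ ∈ nhds (t, x t p) :=
      (isOpen_Iio.prod isOpen_univ).mem_nhds ⟨ht.2, mem_univ _⟩
    exact (hsol.smooth_flow.contMDiffAt hmem).mdifferentiableAt (by simp)
  have hc := HasMFDerivAt.comp_hasMFDerivWithinAt s (hΨ.hasMFDerivAt :
    HasMFDerivAt (𝓘(ℝ, ℝ).prod (𝓡 n)) (𝓡 n) (fun z : ℝ × M => ψ z.1 z.2)
      ((θ s, ((fun τ => x τ p) ∘ θ) s)) _) hγ
  have h1 := hc.mfderivWithin hu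
  -- All derivatives are named as maps between model spaces, so that vectors based at points written
  -- in different ways can be added.
  obtain ⟨V, hV⟩ : ∃ V : ℝ →L[ℝ] EuclideanSpace ℝ (Fin n),
    V = mfderivWithin 𝓘(ℝ, ℝ) (𝓡 n) (fun τ => x τ p) (Ico 0 T) t := ⟨_, rfl⟩
  obtain ⟨A, hA⟩ : ∃ A : ℝ →L[ℝ] EuclideanSpace ℝ (Fin n),
    A = mfderiv 𝓘(ℝ, ℝ) (𝓡 n) (fun τ => ψ τ (x t p)) t := ⟨_, rfl⟩
  obtain ⟨W, hW⟩ : ∃ W : EuclideanSpace ℝ (Fin n), W = mfderivWithin 𝓘(ℝ, ℝ) (𝓡 n)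
      (fun σ => normalizedFlow T ψ x σ p) (Ici (-Real.log T)) s (1 : ℝ) := ⟨_, rfl⟩
  have h2 : W = mfderiv (𝓘(ℝ, ℝ).prod (𝓡 n)) (𝓡 n) (fun z : ℝ × M => ψ z.1 z.2) (t, x t p)
        (((1 : ℝ) • Real.exp (-s), mfderivWithin 𝓘(ℝ, ℝ) (𝓡 n) (fun τ => x τ p) (Ico 0 T) t
          ((1 : ℝ) • Real.exp (-s))) : ℝ × EuclideanSpace ℝ (Fin n)) := by
    rw [hW]
    exact congrArg (fun L => L (1 : ℝ)) h1
  obtain ⟨b, hb⟩ : ∃ b : EuclideanSpace ℝ (Fin n), b = mfderivWithin 𝓘(ℝ, ℝ) (𝓡 n)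
    (fun τ => x τ p) (Ico 0 T) t ((1 : ℝ) • Real.exp (-s)) := ⟨_, rfl⟩
  have h3 := mfderiv_prod_eq_add_apply hΨ
    (v := (((1 : ℝ) • Real.exp (-s), b) : ℝ × EuclideanSpace ℝ (Fin n)))
  obtain ⟨G, hG⟩ : ∃ G : EuclideanSpace ℝ (Fin n), G = grad g f (ψ t (x t p)) := ⟨_, rfl⟩
  obtain ⟨D, hD⟩ : ∃ D : EuclideanSpace ℝ (Fin n) →L[ℝ] EuclideanSpace ℝ (Fin n),
    D = mfderiv (𝓡 n) (𝓡 n) (ψ t) (x t p) := ⟨_, rfl⟩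
  obtain ⟨η, hη⟩ : ∃ η : EuclideanSpace ℝ (Fin n), η = e t p := ⟨_, rfl⟩
  obtain ⟨H, hH⟩ : ∃ H : ℝ, H = meanCurvature (gbar t) m (x t) p (e t p) := ⟨_, rfl⟩
  have hVH : V 1 = H • η := by
    rw [hV, hH, hη]
    exact hmcf.evolution t ht p
  have hAG : A 1 = (1 / (T - t)) • G := by
    rw [hA, hG]
    exact hsol.flow_eq t ht.2 (x t p)
  have hlin : ∀ (L : ℝ →L[ℝ] EuclideanSpace ℝ (Fin n)) (r : ℝ), L r = r • L 1 := fun L r => by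
    rw [← map_smul, smul_eq_mul, mul_one]
  have h4 : W = A ((1 : ℝ) • Real.exp (-s)) + D (V ((1 : ℝ) • Real.exp (-s))) := by
    rw [hA, hD, hV]
    rw [hb] at h3
    exact h2.trans h3
  -- The factor `exp (-s) = T - t` of the time change cancels the `1 / (T - t)` in the flow equation
  -- of `ψ`, leaving exactly `∇f`.
  rw [hlin A, hlin V, hAG, hVH, hexp, one_smul, smul_smul, mul_one_div_cancel (Real.exp_pos _).ne',
    one_smul, smul_smul, map_smul] at h4
  obtain ⟨q, hq⟩ : ∃ q, q = normalizedFlow T ψ x s p := ⟨_, rfl⟩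
  have h5 : innerBilin g q G v = diffLin f q v := by
    rw [hG, hq]
    exact innerBilin_grad g hsol.smooth_f _ v
  have h6 : innerBilin g q W v = diffLin f q v + Real.exp (-s) * (H * innerBilin g q (D η) v) := by
    rw [h4, map_add, map_smul, LinearMap.add_apply, h5, LinearMap.smul_apply, smul_eq_mul]
    ring
  rw [hW, hD, hη, hH, hq] at h6
  exact h6

/-- The normalized flow moves with velocity `∇ f + H ν`. -/
lemma normalizedFlow_evolution (hn : n = m + 1) (hT : 0 < T)
    (hsol : IsShrinkingSelfSimilarSolution g w f T ψ gbar wbar)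
    (hmcf : IsMeanCurvatureFlow m gbar T x e) {s : ℝ} (hs : s ∈ Ici (-Real.log T)) (p : S)
    {ν : EuclideanSpace ℝ (Fin n)}
    (hν : IsUnitNormal g m (normalizedFlow T ψ x s) p ν)
    (v : EuclideanSpace ℝ (Fin n)) :
    innerBilin g (normalizedFlow T ψ x s p) (mfderivWithin 𝓘(ℝ, ℝ) (𝓡 n)
      (fun σ => normalizedFlow T ψ x σ p) (Ici (-Real.log T)) s (1 : ℝ)) v =
    diffLin f (normalizedFlow T ψ x s p) v +
      meanCurvature g m (normalizedFlow T ψ x s) p ν *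
        innerBilin g (normalizedFlow T ψ x s p) ν v := by
  rw [velocity_normalizedFlow hT hsol hmcf hs p v]
  have ht := unnormalized_time_mem hT hs
  have hpos : 0 < T - (T - Real.exp (-s)) := by linarith [ht.2]
  have hinj := mfderiv_normalizedFlow_injective hT hsol hmcf hs p
  have hd := mfderiv_normalizedFlow_apply (ψ := ψ) hT hmcf hs p
  have hH := meanCurvature_homothety g (gbar (T - Real.exp (-s))) (ψ _).contMDiff hpos
    (innerBilin_gbar hsol ht.2) (contMDiff_slice_of_contMDiffOn hmcf.smooth ht) p
    (e (T - Real.exp (-s)) p)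
  have hη1 := innerBilin_gbar hsol ht.2 (x (T - Real.exp (-s)) p)
  have hη2 := hmcf.unit_normal _ ht p
  set t := T - Real.exp (-s) with ht_def
  have hexp : T - t = Real.exp (-s) := by rw [ht_def]; ring
  obtain ⟨D, hD⟩ : ∃ D : EuclideanSpace ℝ (Fin m) →L[ℝ] EuclideanSpace ℝ (Fin n),
    D = mfderiv (𝓡 m) (𝓡 n) (normalizedFlow T ψ x s) p := ⟨_, rfl⟩
  obtain ⟨η, hη⟩ : ∃ η : EuclideanSpace ℝ (Fin n),
    η = mfderiv (𝓡 n) (𝓡 n) (ψ t) (x t p) (e t p) := ⟨_, rfl⟩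
  obtain ⟨q, hq⟩ : ∃ q, q = normalizedFlow T ψ x s p := ⟨_, rfl⟩
  have hqψ : q = ψ t (x t p) := hq
  have hνν : innerBilin g q ν ν = 1 := by
    rw [hq]; exact hν.1
  have hνD : ∀ u, innerBilin g q ν (D u) = 0 := fun u => by
    rw [hq, hD]; exact hν.2 u
  have hηD : ∀ u, innerBilin g q η (D u) = 0 := fun u => by
    rw [hqψ, hη, hD]
    have h1 := (hη1 (e t p) (mfderiv (𝓡 m) (𝓡 n) (x t) p u)).symm.trans (hη2.2 u)
    have h2 := (mul_eq_zero.1 h1).resolve_left hpos.ne'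
    exact (congrArg (innerBilin g (ψ t (x t p))
      (mfderiv (𝓡 n) (𝓡 n) (ψ t) (x t p) (e t p))) (hd u)).trans h2
  have hηη : Real.exp (-s) * innerBilin g q η η = 1 := by
    rw [hqψ, hη, ← hexp]
    exact (hη1 (e t p) (e t p)).symm.trans hη2.1
  have hDi : Function.Injective D.toLinearMap := by
    rw [hD]; exact hinj
  have hc := normal_eq_smul g hn hDi hνν hνD hηD
  set c := innerBilin g q η ν with hc_def
  -- The vector `dψ(e) = c • ν` has squared length `exp s` in `g`. Only `c ^ 2` is determined, since
  -- `ν` may be either unit normal.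
  have hc2 : Real.exp (-s) * c ^ 2 = 1 := by
    rw [hc] at hηη
    simp only [map_smul, LinearMap.smul_apply, hνν, smul_eq_mul] at hηη
    linarith
  have hHη : meanCurvature (gbar t) m (x t) p (e t p) =
      c * meanCurvature g m (normalizedFlow T ψ x s) p ν := by
    rw [← meanCurvature_smul, ← hc, hη]
    exact hH.symm
  -- One factor `c` comes from the mean curvature and one from the normal, so only `c ^ 2` enters.
  have h6 : Real.exp (-s) * (meanCurvature (gbar t) m (x t) p (e t p) * innerBilin g q η v) =
      meanCurvature g m (normalizedFlow T ψ x s) p ν * innerBilin g q ν v := by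
    rw [hHη, hc, map_smul, LinearMap.smul_apply, smul_eq_mul]
    linear_combination (meanCurvature g m (normalizedFlow T ψ x s) p ν * innerBilin g q ν v) * hc2
  rw [hη, hq] at h6
  exact congrArg (diffLin f (normalizedFlow T ψ x s p) v + ·) h6

end NormalizedFlow

/-! ### Families of immersions as maps on time × space. -/

section Slices

open Filter Topology

variable {n m : ℕ} {M : Type*} [TopologicalSpace M] [ChartedSpace (EuclideanSpace ℝ (Fin n)) M]
  {S : Type*} [TopologicalSpace S] [ChartedSpace (EuclideanSpace ℝ (Fin m)) S]

/-- A family of maps in the chart of `S` at `q`, with the parameter as an additional variable. -/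
def chartFamily (m : ℕ) {S : Type*} [TopologicalSpace S]
    [ChartedSpace (EuclideanSpace ℝ (Fin m)) S] (X : ℝ → S → M) (q : S)
    (z : ℝ × EuclideanSpace ℝ (Fin m)) : M :=
  X z.1 ((extChartAt (𝓡 m) q).symm z.2)

variable [IsManifold (𝓡 m) ∞ S] {J : Set ℝ} {X : ℝ → S → M}

lemma contMDiffOn_chartFamily
    (hX : ContMDiffOn (𝓘(ℝ, ℝ).prod (𝓡 m)) (𝓡 n) ∞ (fun z : ℝ × S => X z.1 z.2) (J ×ˢ univ))
    (q : S) : ContMDiffOn 𝓘(ℝ, ℝ × EuclideanSpace ℝ (Fin m)) (𝓡 n) ∞ (chartFamily m X q)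
      (J ×ˢ (extChartAt (𝓡 m) q).target) := by
  have h1 : ContMDiffOn 𝓘(ℝ, ℝ × EuclideanSpace ℝ (Fin m)) (𝓡 m) ∞
      (fun z : ℝ × EuclideanSpace ℝ (Fin m) => (extChartAt (𝓡 m) q).symm z.2)
      (J ×ˢ (extChartAt (𝓡 m) q).target) :=
    (contMDiffOn_extChartAt_symm q).comp contDiff_snd.contMDiff.contMDiffOn fun z hz => hz.2
  exact hX.comp (contDiff_fst.contMDiff.contMDiffOn.prodMk h1) fun z hz => ⟨hz.1, mem_univ _⟩

lemma uniqueDiffOn_prod_target (hJ : UniqueDiffOn ℝ J) (q : S) :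
    UniqueDiffOn ℝ (J ×ˢ (extChartAt (𝓡 m) q).target) :=
  hJ.prod (isOpen_extChartAt_target q).uniqueDiffOn

/-- The chart target is open, so in the space directions the derivative relative to the product set
is an ordinary one, even at an endpoint of `J`. -/
lemma mfderivWithin_chartFamily_space
    (hX : ContMDiffOn (𝓘(ℝ, ℝ).prod (𝓡 m)) (𝓡 n) ∞ (fun z : ℝ × S => X z.1 z.2) (J ×ˢ univ))
    {q : S} {s : ℝ} (hs : s ∈ J) {y : EuclideanSpace ℝ (Fin m)}
    (hy : y ∈ (extChartAt (𝓡 m) q).target) (v : EuclideanSpace ℝ (Fin m)) :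
    (mfderivWithin 𝓘(ℝ, ℝ × EuclideanSpace ℝ (Fin m)) (𝓡 n) (chartFamily m X q)
      (J ×ˢ (extChartAt (𝓡 m) q).target) (s, y) ((0, v) : ℝ × EuclideanSpace ℝ (Fin m)) :
      EuclideanSpace ℝ (Fin n)) =
    mfderiv (𝓡 m) (𝓡 n) (X s ∘ (extChartAt (𝓡 m) q).symm) y v := by
  have h1 := (((contMDiffOn_chartFamily hX q) (s, y) ⟨hs, hy⟩).mdifferentiableWithinAt
    (by simp)).hasMFDerivWithinAt
  have h2 : HasMFDerivWithinAt (𝓡 m) 𝓘(ℝ, ℝ × EuclideanSpace ℝ (Fin m))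
      (fun y : EuclideanSpace ℝ (Fin m) => (s, y)) (extChartAt (𝓡 m) q).target y
      (ContinuousLinearMap.inr ℝ ℝ (EuclideanSpace ℝ (Fin m))) :=
    (hasFDerivAt_prodMk_right s y).hasFDerivWithinAt.hasMFDerivWithinAt
  have h3 := (HasMFDerivWithinAt.comp y h1 h2 fun y' hy' => ⟨hs, hy'⟩).hasMFDerivAt
    ((isOpen_extChartAt_target q).mem_nhds hy)
  exact (congrArg (fun L => L v) h3.mfderiv).symm

lemma mfderivWithin_chartFamily_time (hJ : UniqueDiffOn ℝ J)
    (hX : ContMDiffOn (𝓘(ℝ, ℝ).prod (𝓡 m)) (𝓡 n) ∞ (fun z : ℝ × S => X z.1 z.2) (J ×ˢ univ))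
    {q : S} {s : ℝ} (hs : s ∈ J) {y : EuclideanSpace ℝ (Fin m)}
    (hy : y ∈ (extChartAt (𝓡 m) q).target) :
    (mfderivWithin 𝓘(ℝ, ℝ × EuclideanSpace ℝ (Fin m)) (𝓡 n) (chartFamily m X q)
      (J ×ˢ (extChartAt (𝓡 m) q).target) (s, y) ((1, 0) : ℝ × EuclideanSpace ℝ (Fin m)) :
      EuclideanSpace ℝ (Fin n)) =
    mfderivWithin 𝓘(ℝ, ℝ) (𝓡 n) (fun σ => X σ ((extChartAt (𝓡 m) q).symm y)) J s (1 : ℝ) := by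
  have h1 := (((contMDiffOn_chartFamily hX q) (s, y) ⟨hs, hy⟩).mdifferentiableWithinAt
    (by simp)).hasMFDerivWithinAt
  have h2 : HasMFDerivWithinAt 𝓘(ℝ, ℝ) 𝓘(ℝ, ℝ × EuclideanSpace ℝ (Fin m))
      (fun σ : ℝ => (σ, y)) J s
      (ContinuousLinearMap.inl ℝ ℝ (EuclideanSpace ℝ (Fin m))) :=
    (hasFDerivAt_prodMk_left s y).hasFDerivWithinAt.hasMFDerivWithinAt
  have hm : J ⊆ (fun σ : ℝ => (σ, y)) ⁻¹' (J ×ˢ (extChartAt (𝓡 m) q).target) := fun σ hσ => ⟨hσ, hy⟩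
  have h3 := HasMFDerivWithinAt.comp s h1 h2 hm
  exact (congrArg (fun L => L (1 : ℝ)) (h3.mfderivWithin (hJ s hs).uniqueMDiffWithinAt)).symm

variable [IsManifold (𝓡 n) ∞ M] (g : Metric n M)

/-- The inclusion of a time slice is affine, so the correction term of `secondCov_comp` vanishes. -/
lemma secondCov_chartFamily {q : S} {s : ℝ} {y : EuclideanSpace ℝ (Fin m)}
    (hY : ContMDiffAt 𝓘(ℝ, ℝ × EuclideanSpace ℝ (Fin m)) (𝓡 n) ∞ (chartFamily m X q) (s, y))
    (v w : EuclideanSpace ℝ (Fin m)) :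
    secondCov g (chartFamily m X q) (s, y) (0, v) (0, w) =
      secondCov g (X s ∘ (extChartAt (𝓡 m) q).symm) y v w := by
  let ι : EuclideanSpace ℝ (Fin m) → ℝ × EuclideanSpace ℝ (Fin m) := fun y => (s, y)
  have hd : ∀ y, fderiv ℝ ι y = ContinuousLinearMap.inr ℝ ℝ (EuclideanSpace ℝ (Fin m)) :=
    fun y => (hasFDerivAt_prodMk_right s y).fderiv
  have hdd : fderiv ℝ (fderiv ℝ ι) y v w = 0 := by
    have : fderiv ℝ ι = fun _ => ContinuousLinearMap.inr ℝ ℝ (EuclideanSpace ℝ (Fin m)) :=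
      funext hd
    rw [this]
    simp
  have h := secondCov_comp g (τ := ι) (z := y) hY (contDiff_prodMk_right s).contDiffAt v w
  rw [hdd, hd, map_zero, add_zero] at h
  exact h.symm

/-- The Gram matrix of a family of maps. -/
lemma pairingWithin_chartFamily_space
    (hX : ContMDiffOn (𝓘(ℝ, ℝ).prod (𝓡 m)) (𝓡 n) ∞ (fun z : ℝ × S => X z.1 z.2) (J ×ˢ univ))
    {q : S} {z : ℝ × EuclideanSpace ℝ (Fin m)} (hz : z ∈ J ×ˢ (extChartAt (𝓡 m) q).target)
    (i j : Fin m) :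
    pairingWithin g (chartFamily m X q) (J ×ˢ (extChartAt (𝓡 m) q).target) z
      (0, basisVec i) (0, basisVec j) = gram g (X z.1) q z.2 i j := by
  have h1 := mfderivWithin_chartFamily_space hX hz.1 hz.2 (basisVec i)
  have h2 := mfderivWithin_chartFamily_space hX hz.1 hz.2 (basisVec j)
  exact congrArg₂ (fun a b => innerBilin g (chartFamily m X q z) a b) h1 h2

end Slices

/-! ### Integrals against compactly supported cutoffs. -/

section CompactlySupported

open Filter Topology

variable {E : Type*} [NormedAddCommGroup E] [NormedSpace ℝ E] {χ : E → ℝ} {O : Set E}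

/-- Outside `O` the product vanishes in a neighbourhood, whatever values `φ` takes there. -/
lemma continuousOn_cutoff_mul {A : Type*} [TopologicalSpace A] (hχ : Continuous χ) (hO : IsOpen O)
    (hχO : tsupport χ ⊆ O)
    {J : Set A} {φ : A × E → ℝ} (hφ : ContinuousOn φ (J ×ˢ O)) :
    ContinuousOn (fun z : A × E => χ z.2 * φ z) (J ×ˢ univ) := by
  rintro z ⟨hz, -⟩
  by_cases h : z.2 ∈ O
  · have hmem : J ×ˢ O ∈ 𝓝[J ×ˢ univ] z := by
      have h1 : univ ×ˢ O ∈ 𝓝 z := (isOpen_univ.prod hO).mem_nhds ⟨mem_univ _, h⟩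
      filter_upwards [mem_nhdsWithin_of_mem_nhds h1, self_mem_nhdsWithin] with a ha hb
        using ⟨hb.1, ha.2⟩
    exact (hχ.comp continuous_snd).continuousWithinAt.mul
      ((hφ z ⟨hz, h⟩).mono_of_mem_nhdsWithin hmem)
  · have h0 : ∀ᶠ a in 𝓝 z, χ a.2 * φ a = 0 := by
      have h1 : (tsupport χ)ᶜ ∈ 𝓝 z.2 :=
        (isClosed_tsupport χ).isOpen_compl.mem_nhds fun h' => h (hχO h')
      filter_upwards [continuous_snd.continuousAt.preimage_mem_nhds h1] with a ha
      rw [image_eq_zero_of_notMem_tsupport ha, zero_mul]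
    have h2 : ContinuousAt (fun a : A × E => χ a.2 * φ a) z :=
      (continuousAt_const (y := (0 : ℝ))).congr (by filter_upwards [h0] with a ha using ha.symm)
    exact h2.continuousWithinAt

lemma continuous_cutoff_mul (hχ : Continuous χ) (hO : IsOpen O) (hχO : tsupport χ ⊆ O)
    {φ : E → ℝ} (hφ : ContinuousOn φ O) : Continuous fun y => χ y * φ y := by
  have h := continuousOn_cutoff_mul (A := Unit) hχ hO hχO (J := univ) (φ := fun z => φ z.2)
    (hφ.comp continuousOn_snd fun z hz => hz.2)
  rw [← continuousOn_univ]
  exact h.comp (f := fun y : E => ((), y)) (by fun_prop) fun y _ => by simp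

variable [FiniteDimensional ℝ E] [MeasurableSpace E] [BorelSpace E] (μ : Measure E)
  [μ.IsAddHaarMeasure]

lemma integrable_cutoff_mul (hχ : Continuous χ) (hc : HasCompactSupport χ) (hO : IsOpen O)
    (hχO : tsupport χ ⊆ O) {φ : E → ℝ} (hφ : ContinuousOn φ O) :
    Integrable (fun y => χ y * φ y) μ :=
  (continuous_cutoff_mul hχ hO hχO hφ).integrable_of_hasCompactSupport hc.mul_right

lemma continuousOn_integral_cutoff_mul (hχ : Continuous χ) (hc : HasCompactSupport χ)
    (hO : IsOpen O) (hχO : tsupport χ ⊆ O) {J : Set ℝ} {φ : ℝ × E → ℝ}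
    (hφ : ContinuousOn φ (J ×ˢ O)) :
    ContinuousOn (fun s => ∫ y, χ y * φ (s, y) ∂μ) J :=
  continuousOn_integral_of_compact_support hc.isCompact (f := fun s y => χ y * φ (s, y))
    (continuousOn_cutoff_mul hχ hO hχO hφ)
    fun s y _ hy => by rw [image_eq_zero_of_notMem_tsupport hy, zero_mul]

lemma hasDerivAt_integral_cutoff_mul (hχ : Continuous χ) (hc : HasCompactSupport χ)
    (hO : IsOpen O) (hχO : tsupport χ ⊆ O) {J : Set ℝ} (hJ : IsOpen J) {φ : ℝ × E → ℝ}
    (hφ : ContDiffOn ℝ 1 φ (J ×ˢ O)) {s : ℝ} (hs : s ∈ J) :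
    HasDerivAt (fun s => ∫ y, χ y * φ (s, y) ∂μ) (∫ y, χ y * fderiv ℝ φ (s, y) (1, 0) ∂μ) s := by
  have hφ' : ContinuousOn (fun z => fderiv ℝ φ z (1, 0)) (J ×ˢ O) :=
    (hφ.continuousOn_fderiv_of_isOpen (hJ.prod hO) le_rfl).clm_apply continuousOn_const
  have h1 := continuousOn_cutoff_mul hχ hO hχO hφ.continuousOn
  have h2 := continuousOn_cutoff_mul hχ hO hχO hφ'
  have slice : ∀ {ξ : ℝ × E → ℝ}, ContinuousOn ξ (J ×ˢ univ) → ∀ {σ}, σ ∈ J →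
      Continuous fun y => ξ (σ, y) := fun hξ σ hσ => by
    rw [← continuousOn_univ]
    exact hξ.comp (f := fun y : E => (σ, y)) (by fun_prop) fun y _ => ⟨hσ, mem_univ _⟩
  obtain ⟨ε, hε, hεJ⟩ := Metric.nhds_basis_closedBall.mem_iff.1 (hJ.mem_nhds hs)
  have hK : IsCompact (Metric.closedBall s ε ×ˢ tsupport χ) :=
    (isCompact_closedBall s ε).prod hc.isCompact
  -- The dominating function is this maximum over a compact time interval times the support, cut off
  -- outside the support.
  obtain ⟨C, hC⟩ := hK.exists_bound_of_continuousOn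
    (h2.mono (prod_mono hεJ (subset_univ _)))
  refine (hasDerivAt_integral_of_dominated_loc_of_deriv_le
    (F := fun s y => χ y * φ (s, y)) (F' := fun s y => χ y * fderiv ℝ φ (s, y) (1, 0))
    (bound := (tsupport χ).indicator fun _ => C) (Metric.closedBall_mem_nhds s hε) ?_ ?_ ?_ ?_ ?_
    ?_).2
  · filter_upwards [hJ.mem_nhds hs] with σ hσ
    exact (slice h1 hσ).aestronglyMeasurable
  · exact (slice h1 hs).integrable_of_hasCompactSupport hc.mul_right
  · exact (slice h2 hs).aestronglyMeasurable
  · refine Eventually.of_forall fun y σ hσ => ?_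
    by_cases hy : y ∈ tsupport χ
    · rw [indicator_of_mem hy]
      exact hC (σ, y) ⟨hσ, hy⟩
    · rw [indicator_of_notMem hy, image_eq_zero_of_notMem_tsupport hy, zero_mul, norm_zero]
  · exact (integrable_indicator_iff (isClosed_tsupport χ).measurableSet).2
      (integrableOn_const hc.isCompact.measure_ne_top)
  · refine Eventually.of_forall fun y σ hσ => ?_
    by_cases hy : y ∈ tsupport χ
    · have h3 : HasFDerivAt φ (fderiv ℝ φ (σ, y)) (σ, y) :=
        ((hφ.contDiffAt ((hJ.prod hO).mem_nhds ⟨hεJ hσ, hχO hy⟩)).differentiableAt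
          (by simp)).hasFDerivAt
      have h4 : HasDerivAt (fun σ : ℝ => (σ, y)) ((1 : ℝ), (0 : E)) σ :=
        (hasDerivAt_id σ).prodMk (hasDerivAt_const σ y)
      exact (h3.comp_hasDerivAt σ h4).const_mul (χ y)
    · simp only [image_eq_zero_of_notMem_tsupport hy, zero_mul]
      exact hasDerivAt_const _ _

/-- Integration by parts has no boundary term because of the cutoff, and regularity of `Z` is only
required on `O`, which contains the support. -/
lemma integral_cutoff_mul_fderiv (hχ : ContDiff ℝ 1 χ) (hc : HasCompactSupport χ)
    (hO : IsOpen O) (hχO : tsupport χ ⊆ O) {Z : E → ℝ} (hZ : ContDiffOn ℝ 1 Z O) (v : E) :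
    ∫ y, χ y * fderiv ℝ Z y v ∂μ = -∫ y, fderiv ℝ χ y v * Z y ∂μ := by
  have hχ' : Continuous fun y => fderiv ℝ χ y v :=
    (hχ.continuous_fderiv one_ne_zero).clm_apply continuous_const
  have hc' : HasCompactSupport fun y => fderiv ℝ χ y v := hc.fderiv_apply ℝ v
  have hs' : tsupport (fun y => fderiv ℝ χ y v) ⊆ O :=
    (tsupport_fderiv_apply_subset ℝ v).trans hχO
  refine integral_mul_fderiv_eq_neg_fderiv_mul_of_integrable ?_ ?_ ?_
    (fun x _ => hχ.differentiable (by simp) x)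
    (fun x hx => (hZ.contDiffAt (hO.mem_nhds (hχO hx))).differentiableAt (by simp))
  · exact integrable_cutoff_mul μ hχ' hc' hO hs' hZ.continuousOn
  · exact integrable_cutoff_mul μ hχ.continuous hc hO hχO
      ((hZ.continuousOn_fderiv_of_isOpen hO le_rfl).clm_apply continuousOn_const)
  · exact integrable_cutoff_mul μ hχ.continuous hc hO hχO hZ.continuousOn

end CompactlySupported

/-! ### Partitions of unity and cutoffs in charts. -/

section Partition

open Filter Topology

variable {n m : ℕ} {M : Type*} [TopologicalSpace M] [ChartedSpace (EuclideanSpace ℝ (Fin n)) M]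
  [IsManifold (𝓡 n) ∞ M] (g : Metric n M)
  {S : Type*} [TopologicalSpace S] [T2Space S] [CompactSpace S]
  [ChartedSpace (EuclideanSpace ℝ (Fin m)) S] [IsManifold (𝓡 m) ∞ S]

lemma exists_finite_partition_of_unity (m : ℕ) (S : Type*) [TopologicalSpace S] [T2Space S]
    [CompactSpace S] [ChartedSpace (EuclideanSpace ℝ (Fin m)) S] [IsManifold (𝓡 m) ∞ S] :
    ∃ (t : Finset S) (ρ : t → S → ℝ), (∀ i, ContMDiff (𝓡 m) 𝓘(ℝ, ℝ) ∞ (ρ i)) ∧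
      (∀ i : t, tsupport (ρ i) ⊆ (extChartAt (𝓡 m) (i : S)).source) ∧ ∀ p, ∑ i, ρ i p = 1 := by
  obtain ⟨t, ht⟩ := isCompact_univ.elim_finite_subcover
    (fun q : S => (extChartAt (𝓡 m) q).source) (fun q => isOpen_extChartAt_source q)
    (fun q _ => mem_iUnion.2 ⟨q, mem_extChartAt_source q⟩)
  obtain ⟨ρ, hρ⟩ := SmoothPartitionOfUnity.exists_isSubordinate (𝓡 m) (isClosed_univ (X := S))
    (fun i : t => (extChartAt (𝓡 m) (i : S)).source) (fun i => isOpen_extChartAt_source _)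
    (fun p hp => by
      obtain ⟨i, hi, h⟩ := mem_iUnion₂.1 (ht hp)
      exact mem_iUnion.2 ⟨⟨i, hi⟩, h⟩)
  refine ⟨t, fun i => ρ i, fun i => (ρ i).contMDiff, hρ, fun p => ?_⟩
  rw [← finsum_eq_sum_of_fintype]
  exact ρ.sum_eq_one (mem_univ p)

/-- A function supported in the domain of a chart, transported to the model space. -/
def chartCutoff (m : ℕ) {S : Type*} [TopologicalSpace S]
    [ChartedSpace (EuclideanSpace ℝ (Fin m)) S] (ρ : S → ℝ) (q : S) :
    EuclideanSpace ℝ (Fin m) → ℝ :=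
  (extChartAt (𝓡 m) q).target.indicator (ρ ∘ (extChartAt (𝓡 m) q).symm)

variable {ρ : S → ℝ} {q : S}

lemma chartCutoff_apply {y : EuclideanSpace ℝ (Fin m)} (hy : y ∈ (extChartAt (𝓡 m) q).target) :
    chartCutoff m ρ q y = ρ ((extChartAt (𝓡 m) q).symm y) := indicator_of_mem hy _

lemma isCompact_image_tsupport (hρ : tsupport ρ ⊆ (extChartAt (𝓡 m) q).source) :
    IsCompact (extChartAt (𝓡 m) q '' tsupport ρ) :=
  (isClosed_tsupport ρ).isCompact.image_of_continuousOn
    ((continuousOn_extChartAt (I := 𝓡 m) q).mono hρ)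

lemma tsupport_chartCutoff_subset_image (hρ : tsupport ρ ⊆ (extChartAt (𝓡 m) q).source) :
    tsupport (chartCutoff m ρ q) ⊆ extChartAt (𝓡 m) q '' tsupport ρ := by
  refine closure_minimal (fun y hy => ?_) (isCompact_image_tsupport hρ).isClosed
  have hyt : y ∈ (extChartAt (𝓡 m) q).target := by
    by_contra h
    exact hy (indicator_of_notMem h _)
  refine ⟨(extChartAt (𝓡 m) q).symm y, subset_tsupport _ ?_, (extChartAt (𝓡 m) q).right_inv hyt⟩
  rw [Function.mem_support, ← chartCutoff_apply (ρ := ρ) hyt]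
  exact hy

lemma tsupport_chartCutoff_subset (hρ : tsupport ρ ⊆ (extChartAt (𝓡 m) q).source) :
    tsupport (chartCutoff m ρ q) ⊆ (extChartAt (𝓡 m) q).target := by
  refine (tsupport_chartCutoff_subset_image hρ).trans ?_
  rintro _ ⟨p, hp, rfl⟩
  exact (extChartAt (𝓡 m) q).map_source (hρ hp)

lemma hasCompactSupport_chartCutoff (hρ : tsupport ρ ⊆ (extChartAt (𝓡 m) q).source) :
    HasCompactSupport (chartCutoff m ρ q) :=
  (isCompact_image_tsupport hρ).of_isClosed_subset (isClosed_tsupport _)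
    (tsupport_chartCutoff_subset_image hρ)

lemma chartCutoff_eventuallyEq {y : EuclideanSpace ℝ (Fin m)}
    (hy : y ∈ (extChartAt (𝓡 m) q).target) :
    chartCutoff m ρ q =ᶠ[𝓝 y] ρ ∘ (extChartAt (𝓡 m) q).symm := by
  filter_upwards [(isOpen_extChartAt_target q).mem_nhds hy] with z hz using chartCutoff_apply hz

lemma contDiff_chartCutoff (hs : ContMDiff (𝓡 m) 𝓘(ℝ, ℝ) ∞ ρ)
    (hρ : tsupport ρ ⊆ (extChartAt (𝓡 m) q).source) : ContDiff ℝ ∞ (chartCutoff m ρ q) := by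
  refine contDiff_iff_contDiffAt.2 fun y => ?_
  by_cases hy : y ∈ (extChartAt (𝓡 m) q).target
  · exact (contDiffAt_comp_chart_symm hy hs).congr_of_eventuallyEq (chartCutoff_eventuallyEq hy)
  · have h1 : (tsupport (chartCutoff m ρ q))ᶜ ∈ 𝓝 y :=
      (isClosed_tsupport _).isOpen_compl.mem_nhds fun h => hy (tsupport_chartCutoff_subset hρ h)
    refine (contDiffAt_const (c := (0 : ℝ))).congr_of_eventuallyEq ?_
    filter_upwards [h1] with z hz using image_eq_zero_of_notMem_tsupport hz

variable [MeasurableSpace S] [BorelSpace S] {F : S → M}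

lemma continuousOn_mul_comp_chart_symm {φ : S → ℝ}
    (hφ : ContinuousOn φ (extChartAt (𝓡 m) q).source) (hF : ContMDiff (𝓡 m) (𝓡 n) ∞ F) :
    ContinuousOn (fun y => φ ((extChartAt (𝓡 m) q).symm y) * √(gram g F q y).det)
      (extChartAt (𝓡 m) q).target :=
  (hφ.comp (continuousOn_extChartAt_symm q) (extChartAt (𝓡 m) q).mapsTo_symm).mul
    (continuousOn_sqrt_det_gram g hF q)

lemma cutoff_mul_eq_indicator {φ : S → ℝ} (y : EuclideanSpace ℝ (Fin m)) :
    chartCutoff m ρ q y * (φ ((extChartAt (𝓡 m) q).symm y) * √(gram g F q y).det) =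
      (extChartAt (𝓡 m) q).target.indicator (fun y => (ρ ((extChartAt (𝓡 m) q).symm y) *
        φ ((extChartAt (𝓡 m) q).symm y)) * √(gram g F q y).det) y := by
  by_cases hy : y ∈ (extChartAt (𝓡 m) q).target
  · rw [indicator_of_mem hy, chartCutoff_apply hy, mul_assoc]
  · rw [indicator_of_notMem hy, chartCutoff, indicator_of_notMem hy, zero_mul]

lemma integral_cutoff_areaMeasure (hs : Continuous ρ)
    (hρ : tsupport ρ ⊆ (extChartAt (𝓡 m) q).source) {φ : S → ℝ}
    (hφ : ContinuousOn φ (extChartAt (𝓡 m) q).source) (hF : ContMDiff (𝓡 m) (𝓡 n) ∞ F) :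
    ∫ p, ρ p * φ p ∂(areaMeasure g m F) = ∫ y, chartCutoff m ρ q y *
      (φ ((extChartAt (𝓡 m) q).symm y) * √(gram g F q y).det) := by
  simp_rw [cutoff_mul_eq_indicator g]
  rw [integral_indicator (isOpen_extChartAt_target q).measurableSet]
  refine integral_areaMeasure_eq g hF (hs.continuousOn.mul hφ) fun p hp => ?_
  rw [image_eq_zero_of_notMem_tsupport fun h => hp (hρ h), zero_mul]

lemma integrable_cutoff_areaMeasure (hs : ContMDiff (𝓡 m) 𝓘(ℝ, ℝ) ∞ ρ)
    (hρ : tsupport ρ ⊆ (extChartAt (𝓡 m) q).source) {φ : S → ℝ}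
    (hφ : ContinuousOn φ (extChartAt (𝓡 m) q).source) (hF : ContMDiff (𝓡 m) (𝓡 n) ∞ F) :
    Integrable (fun p => ρ p * φ p) (areaMeasure g m F) := by
  refine (integrable_areaMeasure_iff g hF (hs.continuous.continuousOn.mul hφ) fun p hp => ?_).2 ?_
  · rw [Pi.mul_apply, image_eq_zero_of_notMem_tsupport fun h => hp (hρ h), zero_mul]
  · rw [← integrable_indicator_iff (isOpen_extChartAt_target q).measurableSet]
    have h := integrable_cutoff_mul volume (contDiff_chartCutoff hs hρ).continuous
      (hasCompactSupport_chartCutoff hρ) (isOpen_extChartAt_target q)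
      (tsupport_chartCutoff_subset hρ) (continuousOn_mul_comp_chart_symm g hφ hF)
    simp_rw [cutoff_mul_eq_indicator g] at h
    exact h

end Partition

/-! ### The divergence theorem on the closed hypersurface. -/

section Divergence

open Filter Topology

variable {n m : ℕ} {M : Type*} [TopologicalSpace M] [ChartedSpace (EuclideanSpace ℝ (Fin n)) M]
  [IsManifold (𝓡 n) ∞ M] (g : Metric n M)
  {S : Type*} [TopologicalSpace S] [ChartedSpace (EuclideanSpace ℝ (Fin m)) S]

lemma continuous_of_comp_chart_symm {φ : S → ℝ}
    (h : ∀ q, ContinuousOn (φ ∘ (extChartAt (𝓡 m) q).symm) (extChartAt (𝓡 m) q).target) :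
    Continuous φ := by
  refine continuous_iff_continuousAt.2 fun p => ?_
  have h1 : ContinuousOn ((φ ∘ (extChartAt (𝓡 m) p).symm) ∘ extChartAt (𝓡 m) p)
      (extChartAt (𝓡 m) p).source :=
    (h p).comp (continuousOn_extChartAt p) (extChartAt (𝓡 m) p).mapsTo
  have hs := (isOpen_extChartAt_source (I := 𝓡 m) p).mem_nhds (mem_extChartAt_source p)
  refine (h1.continuousAt hs).congr ?_
  filter_upwards [hs] with x hx
  simp only [Function.comp_apply, (extChartAt (𝓡 m) p).left_inv hx]

lemma partials_eq_zero_of_notMem_tsupport {ρ : S → ℝ} {q : S} {y : EuclideanSpace ℝ (Fin m)}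
    (hy : y ∈ (extChartAt (𝓡 m) q).target) (hρ : (extChartAt (𝓡 m) q).symm y ∉ tsupport ρ)
    (i : Fin m) : partials ρ q y i = 0 := by
  have h : ρ ∘ (extChartAt (𝓡 m) q).symm =ᶠ[𝓝 y] fun _ => (0 : ℝ) := by
    filter_upwards [(continuousAt_chart_symm hy).preimage_mem_nhds
      ((isClosed_tsupport ρ).isOpen_compl.mem_nhds hρ)] with z hz
      using image_eq_zero_of_notMem_tsupport (f := ρ) hz
  rw [partials, pd, h.fderiv_eq]
  simp

variable [IsManifold (𝓡 m) ∞ S]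

lemma continuousOn_partials {u : S → ℝ} (hu : ContMDiff (𝓡 m) 𝓘(ℝ, ℝ) ∞ u) (q : S) (i : Fin m) :
    ContinuousOn (fun y => partials u q y i) (extChartAt (𝓡 m) q).target := by
  intro y hy
  have h := (contDiffAt_comp_chart_symm hy hu).fderiv_right (m := 1) one_add_one_le_infty
  exact (h.continuousAt.clm_apply continuousAt_const).continuousWithinAt

lemma sum_partials_eq_zero {ι : Type*} [Fintype ι] {ρ : ι → S → ℝ}
    (hs : ∀ k, ContMDiff (𝓡 m) 𝓘(ℝ, ℝ) ∞ (ρ k)) (h1 : ∀ p, ∑ k, ρ k p = 1) {q : S}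
    {y : EuclideanSpace ℝ (Fin m)} (hy : y ∈ (extChartAt (𝓡 m) q).target) (i : Fin m) :
    ∑ k, partials (ρ k) q y i = 0 := by
  have h : fderiv ℝ (fun z => ∑ k, (ρ k ∘ (extChartAt (𝓡 m) q).symm) z) y =
      ∑ k, fderiv ℝ (ρ k ∘ (extChartAt (𝓡 m) q).symm) y :=
    fderiv_fun_sum fun k _ => (contDiffAt_comp_chart_symm hy (hs k)).differentiableAt (by simp)
  have h2 : (fun z => ∑ k, (ρ k ∘ (extChartAt (𝓡 m) q).symm) z) = fun _ => (1 : ℝ) :=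
    funext fun z => h1 _
  rw [h2, fderiv_fun_const] at h
  have h3 := congrArg (fun L => L (basisVec i)) h
  simp only [Pi.zero_apply, _root_.zero_apply, _root_.sum_apply] at h3
  exact h3.symm

/-- The scalar product of the gradients of `u` and `v`, weighted by `exp (-v)`. -/
def weightedInner (m : ℕ) {S : Type*} [TopologicalSpace S]
    [ChartedSpace (EuclideanSpace ℝ (Fin m)) S] (F : S → M) (u v : S → ℝ) (p : S) : ℝ :=
  Real.exp (-v p) * contraction (gram g F p (extChartAt (𝓡 m) p p))
    (Matrix.of fun i j => partials u p (extChartAt (𝓡 m) p p) i *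
      partials v p (extChartAt (𝓡 m) p p) j)

variable {F : S → M}

lemma weightedInner_chart (hF : ContMDiff (𝓡 m) (𝓡 n) ∞ F)
    (hi : ∀ p, Function.Injective (mfderiv (𝓡 m) (𝓡 n) F p)) {u v : S → ℝ}
    (hu : ContMDiff (𝓡 m) 𝓘(ℝ, ℝ) ∞ u) (hv : ContMDiff (𝓡 m) 𝓘(ℝ, ℝ) ∞ v) {q : S}
    {y : EuclideanSpace ℝ (Fin m)} (hy : y ∈ (extChartAt (𝓡 m) q).target) :
    weightedInner g m F u v ((extChartAt (𝓡 m) q).symm y) =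
      Real.exp (-v ((extChartAt (𝓡 m) q).symm y)) * contraction (gram g F q y)
        (Matrix.of fun i j => partials u q y i * partials v q y j) := by
  rw [contraction_partials_change g hy (mem_extChartAt_source ((extChartAt (𝓡 m) q).symm y))
    hF hi hu hv]
  rfl

/-- The definition uses a different chart at each point; chart independence allows a fixed chart
near a given point, where every factor is continuous. -/
lemma continuous_weightedInner (hF : ContMDiff (𝓡 m) (𝓡 n) ∞ F)
    (hi : ∀ p, Function.Injective (mfderiv (𝓡 m) (𝓡 n) F p)) {u v : S → ℝ}
    (hu : ContMDiff (𝓡 m) 𝓘(ℝ, ℝ) ∞ u) (hv : ContMDiff (𝓡 m) 𝓘(ℝ, ℝ) ∞ v) :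
    Continuous (weightedInner g m F u v) := by
  refine continuous_of_comp_chart_symm (m := m) fun q => ?_
  have h : ContinuousOn (fun y => Real.exp (-v ((extChartAt (𝓡 m) q).symm y)) *
      ∑ i, ∑ j, (gram g F q y)⁻¹ i j * (partials u q y i * partials v q y j))
      (extChartAt (𝓡 m) q).target := by
    refine ContinuousOn.mul ?_ (continuousOn_finsetSum _ fun i _ => continuousOn_finsetSum _
      fun j _ => ContinuousOn.mul ?_
        ((continuousOn_partials hu q i).mul (continuousOn_partials hv q j)))
    · exact Real.continuous_exp.comp_continuousOn
        (hv.continuous.comp_continuousOn (continuousOn_extChartAt_symm q)).neg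
    · refine (contDiffOn_inv_apply (k := 0) (fun i j => contDiffOn_zero.2 (continuousOn_gram g hF q i j))
        (fun y hy => (gram_posDef g hy hF hi).det_pos.ne') i j).continuousOn
  exact h.congr fun y hy => weightedInner_chart g hF hi hu hv hy

variable [T2Space S] [CompactSpace S] [MeasurableSpace S] [BorelSpace S]
  {ι : Type*} [Fintype ι] {c : ι → S} {ρ : ι → S → ℝ}

/-- Continuous functions are integrable, and their integrals can be computed in charts. -/
lemma integrable_and_integral_eq_sum (hs : ∀ k, ContMDiff (𝓡 m) 𝓘(ℝ, ℝ) ∞ (ρ k))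
    (hρ : ∀ k, tsupport (ρ k) ⊆ (extChartAt (𝓡 m) (c k)).source) (h1 : ∀ p, ∑ k, ρ k p = 1)
    (hF : ContMDiff (𝓡 m) (𝓡 n) ∞ F) {φ : S → ℝ} (hφ : Continuous φ) :
    Integrable φ (areaMeasure g m F) ∧ ∫ p, φ p ∂(areaMeasure g m F) =
      ∑ k, ∫ y, chartCutoff m (ρ k) (c k) y *
        (φ ((extChartAt (𝓡 m) (c k)).symm y) * √(gram g F (c k) y).det) := by
  have hsum : φ = fun p => ∑ k, ρ k p * φ p := funext fun p => by
    rw [← Finset.sum_mul, h1, one_mul]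
  have hint := fun k => integrable_cutoff_areaMeasure g (hs k) (hρ k) hφ.continuousOn hF
  constructor
  · rw [hsum]
    exact integrable_finsetSum _ fun k _ => hint k
  · conv_lhs => rw [hsum]
    rw [integral_finsetSum _ fun k _ => hint k]
    exact Finset.sum_congr rfl fun k _ =>
      integral_cutoff_areaMeasure g (hs k).continuous (hρ k) hφ.continuousOn hF

/-- The divergence theorem on a closed manifold, in terms of a partition of unity. -/
lemma sum_integral_fderiv_chartCutoff_eq_zero (hs : ∀ k, ContMDiff (𝓡 m) 𝓘(ℝ, ℝ) ∞ (ρ k))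
    (hρ : ∀ k, tsupport (ρ k) ⊆ (extChartAt (𝓡 m) (c k)).source) (h1 : ∀ p, ∑ k, ρ k p = 1)
    (hF : ContMDiff (𝓡 m) (𝓡 n) ∞ F)
    (hi : ∀ p, Function.Injective (mfderiv (𝓡 m) (𝓡 n) F p)) {v : S → ℝ}
    (hv : ContMDiff (𝓡 m) 𝓘(ℝ, ℝ) ∞ v) :
    ∑ k, ∫ y, ∑ i, fderiv ℝ (chartCutoff m (ρ k) (c k)) y (basisVec i) *
      (Real.exp (-v ((extChartAt (𝓡 m) (c k)).symm y)) * √(gram g F (c k) y).det *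
        ∑ j, (gram g F (c k) y)⁻¹ i j * partials v (c k) y j) = 0 := by
  have hw := fun k => continuous_weightedInner g hF hi (hs k) hv
  have hw0 : ∀ k, ∀ p ∉ (extChartAt (𝓡 m) (c k)).source, weightedInner g m F (ρ k) v p = 0 := by
    intro k p hp
    have h : ∀ i, partials (ρ k) p (extChartAt (𝓡 m) p p) i = 0 := fun i => by
      refine partials_eq_zero_of_notMem_tsupport (mem_extChartAt_target p) ?_ i
      rw [extChartAt_to_inv]
      exact fun h => hp (hρ k h)
    simp only [weightedInner, contraction, Matrix.of_apply, h, zero_mul, mul_zero,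
      Finset.sum_const_zero]
  -- Each chart integral is the global integral of `exp (-v) ⟨∇ρ k, ∇v⟩`, an integrand that no
  -- longer refers to the chart and can be summed over `k` pointwise.
  have hk : ∀ k, ∫ y, ∑ i, fderiv ℝ (chartCutoff m (ρ k) (c k)) y (basisVec i) *
      (Real.exp (-v ((extChartAt (𝓡 m) (c k)).symm y)) * √(gram g F (c k) y).det *
        ∑ j, (gram g F (c k) y)⁻¹ i j * partials v (c k) y j) =
      ∫ p, weightedInner g m F (ρ k) v p ∂(areaMeasure g m F) := by
    intro k
    rw [integral_areaMeasure_eq g hF (hw k).continuousOn (hw0 k),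
      ← integral_indicator (isOpen_extChartAt_target _).measurableSet]
    refine integral_congr_ae (Eventually.of_forall fun y => ?_)
    by_cases hy : y ∈ (extChartAt (𝓡 m) (c k)).target
    · simp only [indicator_of_mem hy]
      rw [weightedInner_chart g hF hi (hs k) hv hy, contraction, mul_assoc, Finset.sum_mul,
        Finset.mul_sum]
      refine Finset.sum_congr rfl fun i _ => ?_
      rw [(chartCutoff_eventuallyEq hy).fderiv_eq]
      have hp : fderiv ℝ (ρ k ∘ (extChartAt (𝓡 m) (c k)).symm) y (basisVec i) =
        partials (ρ k) (c k) y i := rfl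
      rw [hp, Finset.mul_sum, Finset.mul_sum, Finset.sum_mul, Finset.mul_sum]
      refine Finset.sum_congr rfl fun j _ => ?_
      rw [Matrix.of_apply]
      ring
    · simp only [indicator_of_notMem hy]
      refine Finset.sum_eq_zero fun i _ => ?_
      have h : y ∉ tsupport (chartCutoff m (ρ k) (c k)) :=
        fun h => hy (tsupport_chartCutoff_subset (hρ k) h)
      rw [image_eq_zero_of_notMem_tsupport (f := fderiv ℝ (chartCutoff m (ρ k) (c k)))
        fun h' => h (tsupport_fderiv_subset ℝ h'), _root_.zero_apply, zero_mul]
  simp_rw [hk]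
  rw [← integral_finsetSum _ fun k _ => (integrable_and_integral_eq_sum g hs hρ h1 hF (hw k)).1]
  -- The summed integrand is linear in `∑ ∇ρ k`, the gradient of the constant `1`.
  refine integral_eq_zero_of_ae (Eventually.of_forall fun p => ?_)
  simp only [weightedInner, contraction, Matrix.of_apply, Pi.zero_apply]
  rw [← Finset.mul_sum, Finset.sum_comm]
  refine mul_eq_zero_of_right _ (Finset.sum_eq_zero fun i _ => ?_)
  rw [Finset.sum_comm]
  refine Finset.sum_eq_zero fun j _ => ?_
  rw [← Finset.mul_sum, ← Finset.sum_mul, sum_partials_eq_zero hs h1 (mem_extChartAt_target p),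
    zero_mul, mul_zero]

end Divergence

/-! ### Drifted mean curvature flows and their normal speed. -/

section Evolution

open Filter Topology

variable {n m : ℕ} {M : Type*} [TopologicalSpace M] [ChartedSpace (EuclideanSpace ℝ (Fin n)) M]
  [IsManifold (𝓡 n) ∞ M]
  {S : Type*} [TopologicalSpace S] [ChartedSpace (EuclideanSpace ℝ (Fin m)) S]

/-- A smooth family of immersed hypersurfaces with unit normal `ν` moving with velocity
`∇ f + H ν`. -/
structure IsDriftedMeanCurvatureFlow (m : ℕ) {S : Type*} [TopologicalSpace S]
    [ChartedSpace (EuclideanSpace ℝ (Fin m)) S] (g : Metric n M) (f : M → ℝ) (J : Set ℝ)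
    (X : ℝ → S → M) (ν : ∀ (s : ℝ) (p : S), TangentSpace (𝓡 n) (X s p)) : Prop where
  smooth_function : ContMDiff (𝓡 n) 𝓘(ℝ, ℝ) ∞ f
  smooth : ContMDiffOn (𝓘(ℝ, ℝ).prod (𝓡 m)) (𝓡 n) ∞ (fun z : ℝ × S => X z.1 z.2) (J ×ˢ univ)
  immersion : ∀ s ∈ J, ∀ p, Function.Injective (mfderiv (𝓡 m) (𝓡 n) (X s) p)
  unit_normal : ∀ s ∈ J, ∀ p, IsUnitNormal g m (X s) p (ν s p)
  evolution : ∀ s ∈ J, ∀ p (v : EuclideanSpace ℝ (Fin n)),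
    innerBilin g (X s p) (mfderivWithin 𝓘(ℝ, ℝ) (𝓡 n) (fun σ => X σ p) J s (1 : ℝ)) v =
      diffLin f (X s p) v + meanCurvature g m (X s) p (ν s p) * innerBilin g (X s p) (ν s p) v

variable [IsManifold (𝓡 m) ∞ S] {g : Metric n M} {f : M → ℝ} {J : Set ℝ} {X : ℝ → S → M}
  {ν : ∀ (s : ℝ) (p : S), TangentSpace (𝓡 n) (X s p)}

lemma contDiffOn_gram_family (hJ : UniqueDiffOn ℝ J)
    (hX : ContMDiffOn (𝓘(ℝ, ℝ).prod (𝓡 m)) (𝓡 n) ∞ (fun z : ℝ × S => X z.1 z.2) (J ×ˢ univ))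
    (q : S) (i j : Fin m) :
    ContDiffOn ℝ ∞ (fun z : ℝ × EuclideanSpace ℝ (Fin m) => gram g (X z.1) q z.2 i j)
      (J ×ˢ (extChartAt (𝓡 m) q).target) :=
  (contDiffOn_pairingWithin g (uniqueDiffOn_prod_target hJ q) (contMDiffOn_chartFamily hX q)
    (0, basisVec i) (0, basisVec j)).congr
    fun _ hz => (pairingWithin_chartFamily_space g hX hz i j).symm

/-- The weighted area density of a family of immersions in a chart. -/
def familyDensity (m : ℕ) {S : Type*} [TopologicalSpace S]
    [ChartedSpace (EuclideanSpace ℝ (Fin m)) S] (g : Metric n M) (f : M → ℝ)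
    (X : ℝ → S → M) (q : S) : ℝ × EuclideanSpace ℝ (Fin m) → ℝ :=
  weightedDensity (fun z => gram g (X z.1) q z.2) (f ∘ chartFamily m X q)

/-- The squared normal speed of a family of hypersurfaces in a chart. -/
def normalSpeedSq (m : ℕ) {S : Type*} [TopologicalSpace S]
    [ChartedSpace (EuclideanSpace ℝ (Fin m)) S] (g : Metric n M) (J : Set ℝ)
    (X : ℝ → S → M) (q : S) (z : ℝ × EuclideanSpace ℝ (Fin m)) : ℝ :=
  pairingWithin g (chartFamily m X q) (J ×ˢ (extChartAt (𝓡 m) q).target) z (1, 0) (1, 0) -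
    ∑ k, ∑ l, (gram g (X z.1) q z.2)⁻¹ k l *
      (pairingWithin g (chartFamily m X q) (J ×ˢ (extChartAt (𝓡 m) q).target) z
        (1, 0) (0, basisVec k) *
      pairingWithin g (chartFamily m X q) (J ×ˢ (extChartAt (𝓡 m) q).target) z
        (1, 0) (0, basisVec l))

namespace IsDriftedMeanCurvatureFlow

lemma smooth_slice (h : IsDriftedMeanCurvatureFlow m g f J X ν) {s : ℝ} (hs : s ∈ J) :
    ContMDiff (𝓡 m) (𝓡 n) ∞ (X s) :=
  contMDiff_slice_of_contMDiffOn h.smooth hs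

lemma det_gram_ne_zero (h : IsDriftedMeanCurvatureFlow m g f J X ν) {s : ℝ} (hs : s ∈ J) {q : S}
    {y : EuclideanSpace ℝ (Fin m)}
    (hy : y ∈ (extChartAt (𝓡 m) q).target) : (gram g (X s) q y).det ≠ 0 :=
  (gram_posDef g hy (h.smooth_slice hs) (h.immersion s hs)).det_pos.ne'

lemma contDiffOn_familyDensity (h : IsDriftedMeanCurvatureFlow m g f J X ν) (hJ : UniqueDiffOn ℝ J) (q : S) :
    ContDiffOn ℝ ∞ (familyDensity m g f X q) (J ×ˢ (extChartAt (𝓡 m) q).target) :=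
  contDiffOn_weightedDensity (contDiffOn_gram_family hJ h.smooth q)
    (h.smooth_function.comp_contMDiffOn (contMDiffOn_chartFamily h.smooth q)).contDiffOn
    fun _ hz => h.det_gram_ne_zero hz.1 hz.2

lemma contDiffOn_normalSpeedSq (h : IsDriftedMeanCurvatureFlow m g f J X ν) (hJ : UniqueDiffOn ℝ J) (q : S) :
    ContDiffOn ℝ ∞ (normalSpeedSq m g J X q) (J ×ˢ (extChartAt (𝓡 m) q).target) := by
  have hp := contDiffOn_pairingWithin g (uniqueDiffOn_prod_target hJ q)
    (contMDiffOn_chartFamily h.smooth q)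
  refine (hp _ _).sub (ContDiffOn.sum fun k _ => ContDiffOn.sum fun l _ =>
    ContDiffOn.mul ?_ ((hp _ _).mul (hp _ _)))
  exact contDiffOn_inv_apply (contDiffOn_gram_family hJ h.smooth q)
    (fun z hz => h.det_gram_ne_zero hz.1 hz.2) k l

lemma innerBilin_normal_chart (h : IsDriftedMeanCurvatureFlow m g f J X ν) {s : ℝ} (hs : s ∈ J) {q : S}
    {y : EuclideanSpace ℝ (Fin m)}
    (hy : y ∈ (extChartAt (𝓡 m) q).target) (v : EuclideanSpace ℝ (Fin m)) :
    innerBilin g (X s ((extChartAt (𝓡 m) q).symm y)) (ν s ((extChartAt (𝓡 m) q).symm y))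
      (mfderiv (𝓡 m) (𝓡 n) (X s ∘ (extChartAt (𝓡 m) q).symm) y v) = 0 :=
  (congrArg (innerBilin g _ _) (mfderiv_comp_chart_symm hy (h.smooth_slice hs) v)).trans
    ((h.unit_normal s hs _).2 _)

lemma mfderiv_chart_injective (h : IsDriftedMeanCurvatureFlow m g f J X ν) {s : ℝ} (hs : s ∈ J) {q : S}
    {y : EuclideanSpace ℝ (Fin m)}
    (hy : y ∈ (extChartAt (𝓡 m) q).target) :
    Function.Injective (mfderiv (𝓡 m) (𝓡 n) (X s ∘ (extChartAt (𝓡 m) q).symm) y) := by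
  intro v w hvw
  have hv := mfderiv_comp_chart_symm hy (h.smooth_slice hs) v
  have hw := mfderiv_comp_chart_symm hy (h.smooth_slice hs) w
  exact mfderiv_chart_symm_injective hy (h.immersion s hs _ (hv.symm.trans (hvw.trans hw)))

/-- Pythagoras: the squared velocity minus its squared tangential part is the squared normal
component, which is `H + df(ν)`. The left side does not involve `ν`, and this is where the
smoothness of the right side comes from. -/
lemma normalSpeedSq_eq (h : IsDriftedMeanCurvatureFlow m g f J X ν) (hn : n = m + 1)
    (hJ : UniqueDiffOn ℝ J) {s : ℝ} (hs : s ∈ J) {q : S} {y : EuclideanSpace ℝ (Fin m)} (hy : y ∈ (extChartAt (𝓡 m) q).target) :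
    normalSpeedSq m g J X q (s, y) =
      (meanCurvature g m (X s) ((extChartAt (𝓡 m) q).symm y)
          (ν s ((extChartAt (𝓡 m) q).symm y)) +
        diff f (X s ((extChartAt (𝓡 m) q).symm y)) (ν s ((extChartAt (𝓡 m) q).symm y))) ^ 2 := by
  set p := (extChartAt (𝓡 m) q).symm y with hp
  have hev := h.evolution s hs p
  obtain ⟨W, hW⟩ : ∃ W : EuclideanSpace ℝ (Fin n),
    W = mfderivWithin 𝓘(ℝ, ℝ) (𝓡 n) (fun σ => X σ p) J s (1 : ℝ) := ⟨_, rfl⟩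
  obtain ⟨D, hD⟩ : ∃ D : EuclideanSpace ℝ (Fin m) →L[ℝ] EuclideanSpace ℝ (Fin n),
    D = mfderiv (𝓡 m) (𝓡 n) (X s ∘ (extChartAt (𝓡 m) q).symm) y := ⟨_, rfl⟩
  obtain ⟨N, hN⟩ : ∃ N : EuclideanSpace ℝ (Fin n), N = ν s p := ⟨_, rfl⟩
  obtain ⟨H, hH⟩ : ∃ H : ℝ, H = meanCurvature g m (X s) p (ν s p) := ⟨_, rfl⟩
  set B := innerBilin g (X s p) with hB
  have hWt := mfderivWithin_chartFamily_time hJ h.smooth hs hy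
  have hWs := mfderivWithin_chartFamily_space h.smooth hs hy
  have h00 : pairingWithin g (chartFamily m X q) (J ×ˢ (extChartAt (𝓡 m) q).target) (s, y)
      (1, 0) (1, 0) = B W W := by
    rw [hW]
    exact congrArg₂ (fun a b => B a b) hWt hWt
  have h0k : ∀ k, pairingWithin g (chartFamily m X q) (J ×ˢ (extChartAt (𝓡 m) q).target) (s, y)
      (1, 0) (0, basisVec k) = B W (D (basisVec k)) := fun k => by
    rw [hW, hD]
    exact congrArg₂ (fun a b => B a b) hWt (hWs (basisVec k))
  have hG : gram g (X s) q y = Matrix.of fun i j => B (D (basisVec i)) (D (basisVec j)) := by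
    rw [hD]; rfl
  have hNN : B N N = 1 := by
    rw [hN]; exact (h.unit_normal s hs p).1
  have hND : ∀ v, B N (D v) = 0 := fun v => by
    rw [hN, hD]; exact h.innerBilin_normal_chart hs hy v
  have hWN : B W N = H + diffLin f (X s p) N := by
    rw [hW, hev N, ← hH, ← hN, hNN]
    ring
  have hDi : Function.Injective D.toLinearMap := by
    rw [hD]; exact h.mfderiv_chart_injective hs hy
  have hli := linearIndependent_apply_basisVec hDi
  have hexp := frame_expansion (by simp [hn]) B (innerBilin_symm g _)
    (fun u hu => innerBilin_pos g _ hu) hli hNN (fun i => hND _) (gramMatrix_det_ne_zero g hli) W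
  have hWW : B W W = (∑ k, ∑ l, (gram g (X s) q y)⁻¹ k l *
      (B W (D (basisVec k)) * B W (D (basisVec l)))) + B W N ^ 2 := by
    have h1 := congrArg (B W) hexp
    rw [h1, map_add, map_sum, map_smul, hG]
    simp only [map_sum, map_smul, smul_eq_mul]
    rw [sq]
    congr 1
    refine Finset.sum_congr rfl fun k _ => Finset.sum_congr rfl fun l _ => ?_
    exact mul_assoc _ _ _
  have hfin : normalSpeedSq m g J X q (s, y) = (H + diffLin f (X s p) N) ^ 2 := by
    rw [normalSpeedSq, h00]
    simp only [h0k]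
    rw [hWW, hWN]
    ring
  rw [hH, hN] at hfin
  exact hfin

end IsDriftedMeanCurvatureFlow

end Evolution

/-! ### Evolution of the density of a drifted mean curvature flow. -/

section DensityEvolution

open Filter Topology

variable {n m : ℕ} {M : Type*} [TopologicalSpace M] [ChartedSpace (EuclideanSpace ℝ (Fin n)) M]
  [IsManifold (𝓡 n) ∞ M]
  {S : Type*} [TopologicalSpace S] [ChartedSpace (EuclideanSpace ℝ (Fin m)) S]
  [IsManifold (𝓡 m) ∞ S] {g : Metric n M} {f : M → ℝ} {J : Set ℝ} {X : ℝ → S → M}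
  {ν : ∀ (s : ℝ) (p : S), TangentSpace (𝓡 n) (X s p)}

lemma fderiv_slice {E F : Type*} [NormedAddCommGroup E] [NormedSpace ℝ E] [NormedAddCommGroup F]
    [NormedSpace ℝ F] {Φ : ℝ × E → F} {s : ℝ} {y : E} (hΦ : DifferentiableAt ℝ Φ (s, y)) (v : E) :
    fderiv ℝ (fun y => Φ (s, y)) y v = fderiv ℝ Φ (s, y) (0, v) := by
  have h := hΦ.hasFDerivAt.comp y (hasFDerivAt_prodMk_right (𝕜 := ℝ) s y)
  exact congrArg (fun L => L v) h.fderiv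

/-- The weighted gradient of the drift function in a chart. -/
def gradientDensity (m : ℕ) {S : Type*} [TopologicalSpace S]
    [ChartedSpace (EuclideanSpace ℝ (Fin m)) S] (g : Metric n M) (f : M → ℝ)
    (F : S → M) (q : S) (i : Fin m) (y : EuclideanSpace ℝ (Fin m)) : ℝ :=
  Real.exp (-(f ∘ F) ((extChartAt (𝓡 m) q).symm y)) * √(gram g F q y).det *
    ∑ j, (gram g F q y)⁻¹ i j * partials (f ∘ F) q y j

namespace IsDriftedMeanCurvatureFlow

lemma contDiffOn_gradientDensity (h : IsDriftedMeanCurvatureFlow m g f J X ν) {s : ℝ} (hs : s ∈ J)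
    (q : S) (i : Fin m) :
    ContDiffOn ℝ ∞ (gradientDensity m g f (X s) q i) (extChartAt (𝓡 m) q).target := by
  have hG : ∀ i j, ContDiffOn ℝ ∞ (fun y => gram g (X s) q y i j) (extChartAt (𝓡 m) q).target :=
    fun i j => contDiffOn_pairing g (isOpen_extChartAt_target q)
      (fun _ hy => (contMDiffAt_comp_chart_symm hy (h.smooth_slice hs)).contMDiffWithinAt) _ _
  have hd : ∀ y ∈ (extChartAt (𝓡 m) q).target, (gram g (X s) q y).det ≠ 0 :=
    fun y hy => h.det_gram_ne_zero hs hy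
  have hU : ContDiffOn ℝ ∞ ((f ∘ X s) ∘ (extChartAt (𝓡 m) q).symm) (extChartAt (𝓡 m) q).target :=
    fun y hy => (contDiffAt_comp_chart_symm hy
      (h.smooth_function.comp (h.smooth_slice hs))).contDiffWithinAt
  refine (contDiffOn_weightedDensity hG hU hd).mul
    (ContDiffOn.sum fun j _ => (contDiffOn_inv_apply hG hd i j).mul ?_)
  exact (hU.fderiv_of_isOpen (isOpen_extChartAt_target q) (by simp)).clm_apply contDiffOn_const

/-- The evolution of the weighted area density. -/
lemma fderiv_familyDensity (h : IsDriftedMeanCurvatureFlow m g f J X ν) (hn : n = m + 1)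
    (hJ : UniqueDiffOn ℝ J) {I : Set ℝ} (hI : IsOpen I) (hIJ : I ⊆ J) {s : ℝ} (hs : s ∈ I) {q : S}
    {y : EuclideanSpace ℝ (Fin m)} (hy : y ∈ (extChartAt (𝓡 m) q).target) :
    fderiv ℝ (familyDensity m g f X q) (s, y) (1, 0) =
      -(normalSpeedSq m g J X q (s, y) * familyDensity m g f X q (s, y)) +
        ∑ i, fderiv ℝ (gradientDensity m g f (X s) q i) y (basisVec i) := by
  let E : Fin m → ℝ × EuclideanSpace ℝ (Fin m) := fun i => (0, basisVec i)
  set Y := chartFamily m X q with hYdef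
  set Ω : Set (ℝ × EuclideanSpace ℝ (Fin m)) := I ×ˢ (extChartAt (𝓡 m) q).target with hΩdef
  have hΩ : IsOpen Ω := hI.prod (isOpen_extChartAt_target q)
  have hz : (s, y) ∈ Ω := ⟨hs, hy⟩
  have hsub : Ω ⊆ J ×ˢ (extChartAt (𝓡 m) q).target := prod_mono hIJ subset_rfl
  have hY : ContMDiffOn 𝓘(ℝ, ℝ × EuclideanSpace ℝ (Fin m)) (𝓡 n) ∞ Y Ω :=
    (contMDiffOn_chartFamily h.smooth q).mono hsub
  -- Times are restricted to the open set `I`, so the one-sided derivatives are ordinary ones and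
  -- `fderiv_weightedDensity_frameGram` applies.
  have hwithin : ∀ z ∈ Ω, mfderivWithin 𝓘(ℝ, ℝ × EuclideanSpace ℝ (Fin m)) (𝓡 n) Y
      (J ×ˢ (extChartAt (𝓡 m) q).target) z = mfderiv 𝓘(ℝ, ℝ × EuclideanSpace ℝ (Fin m)) (𝓡 n) Y z :=
    fun z hz => mfderivWithin_of_mem_nhds (mem_of_superset (hΩ.mem_nhds hz) hsub)
  have hspace : ∀ z ∈ Ω, ∀ v : EuclideanSpace ℝ (Fin m),
      (mfderiv 𝓘(ℝ, ℝ × EuclideanSpace ℝ (Fin m)) (𝓡 n) Y z ((0, v) : ℝ × EuclideanSpace ℝ (Fin m)) :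
        EuclideanSpace ℝ (Fin n)) =
      mfderiv (𝓡 m) (𝓡 n) (X z.1 ∘ (extChartAt (𝓡 m) q).symm) z.2 v := fun z hz v => by
    rw [← hwithin z hz]
    exact mfderivWithin_chartFamily_space h.smooth (hIJ hz.1) hz.2 v
  have htime : ∀ z ∈ Ω, (mfderiv 𝓘(ℝ, ℝ × EuclideanSpace ℝ (Fin m)) (𝓡 n) Y z
      ((1, 0) : ℝ × EuclideanSpace ℝ (Fin m)) : EuclideanSpace ℝ (Fin n)) =
      mfderivWithin 𝓘(ℝ, ℝ) (𝓡 n) (fun σ => X σ ((extChartAt (𝓡 m) q).symm z.2)) J z.1 (1 : ℝ) :=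
    fun z hz => by
    rw [← hwithin z hz]
    exact mfderivWithin_chartFamily_time hJ h.smooth (hIJ hz.1) hz.2
  have hgram : ∀ z ∈ Ω, frameGram g Y E z = gram g (X z.1) q z.2 := fun z hz => by
    ext i j
    exact congrArg₂ (fun a b => innerBilin g (Y z) a b) (hspace z hz _) (hspace z hz _)
  have hU : ContDiffOn ℝ ∞ (f ∘ Y) Ω := (h.smooth_function.comp_contMDiffOn hY).contDiffOn
  have hUd : ∀ z ∈ Ω, DifferentiableAt ℝ (f ∘ Y) z := fun z hz =>
    (hU.contDiffAt (hΩ.mem_nhds hz)).differentiableAt (by simp)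
  have hdens : ∀ z ∈ Ω, weightedDensity (frameGram g Y E) (f ∘ Y) z = familyDensity m g f X q z :=
    fun z hz => by rw [familyDensity, weightedDensity, weightedDensity, hgram z hz]
  set p := (extChartAt (𝓡 m) q).symm y with hp
  have hνE : ∀ z ∈ Ω, ∀ i, innerBilin g (Y z) (ν z.1 ((extChartAt (𝓡 m) q).symm z.2))
      (mfderiv 𝓘(ℝ, ℝ × EuclideanSpace ℝ (Fin m)) (𝓡 n) Y z (E i)) = 0 := fun z hz i =>
    (congrArg (innerBilin g _ _) (hspace z hz _)).trans
      (h.innerBilin_normal_chart (hIJ hz.1) hz.2 _)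
  have hev : ∀ z ∈ Ω, ∀ w, innerBilin g (Y z)
      (mfderiv 𝓘(ℝ, ℝ × EuclideanSpace ℝ (Fin m)) (𝓡 n) Y z (1, 0)) w = diffLin f (Y z) w +
        meanCurvature g m (X z.1) ((extChartAt (𝓡 m) q).symm z.2)
          (ν z.1 ((extChartAt (𝓡 m) q).symm z.2)) *
          innerBilin g (Y z) (ν z.1 ((extChartAt (𝓡 m) q).symm z.2)) w := fun z hz w =>
    (congrArg (fun a => innerBilin g (Y z) a w) (htime z hz)).trans
      (h.evolution z.1 (hIJ hz.1) _ w)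
  -- Paired with a tangent vector, the velocity `∇f + H ν` loses its normal term.
  have htan : ∀ z ∈ Ω, ∀ i, pairing g Y z (E i) (1, 0) = fderiv ℝ (f ∘ Y) z (E i) := by
    intro z hz i
    rw [fderiv_comp_eq_diff h.smooth_function ((hY.contMDiffAt (hΩ.mem_nhds hz)).mdifferentiableAt
      (by simp))]
    refine (innerBilin_symm g _ _ _).trans ((hev z hz _).trans ?_)
    have h0 := congrArg (fun a => diffLin f (Y z) (mfderiv 𝓘(ℝ, ℝ × EuclideanSpace ℝ (Fin m)) (𝓡 n)
      Y z (E i)) + meanCurvature g m (X z.1) ((extChartAt (𝓡 m) q).symm z.2)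
          (ν z.1 ((extChartAt (𝓡 m) q).symm z.2)) * a) (hνE z hz i)
    refine h0.trans ?_
    simp only [mul_zero, add_zero]
    rfl
  have hli : LinearIndependent ℝ fun i =>
      (mfderiv 𝓘(ℝ, ℝ × EuclideanSpace ℝ (Fin m)) (𝓡 n) Y (s, y) (E i) :
        EuclideanSpace ℝ (Fin n)) := by
    have h1 := linearIndependent_apply_basisVec
      (d := (mfderiv (𝓡 m) (𝓡 n) (X s ∘ (extChartAt (𝓡 m) q).symm) y).toLinearMap)
      (h.mfderiv_chart_injective (hIJ hs) hy)
    exact (congrArg (fun d : Fin m → EuclideanSpace ℝ (Fin n) => LinearIndependent ℝ d)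
      (funext fun i => hspace (s, y) hz (basisVec i))).mpr h1
  have hκ : extChartAt (𝓡 m) q p = y := (extChartAt (𝓡 m) q).right_inv hy
  have hH : meanCurvature g m (X s) p (ν s p) = contraction (frameGram g Y E (s, y))
      (Matrix.of fun i j => innerBilin g (Y (s, y)) (secondCov g Y (s, y) (E i) (E j)) (ν s p)) := by
    rw [meanCurvature_eq_contraction g (h.smooth_slice (hIJ hs)) (h.immersion s (hIJ hs))
      ((extChartAt (𝓡 m) q).map_target hy) (ν s p) (fun v => (h.unit_normal s (hIJ hs) p).2 v),
      hκ, hgram _ hz]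
    congr 1
    ext i j
    exact congrArg (fun a => innerBilin g (X s p) a (ν s p)) (secondCov_chartFamily g
      (hY.contMDiffAt (hΩ.mem_nhds hz)) (basisVec i) (basisVec j)).symm
  have main := fderiv_weightedDensity_frameGram g hn h.smooth_function hΩ hz hY (1, 0) E
    (fun z hz => by
      rw [hgram z hz]
      exact gram_posDef g hz.2 (h.smooth_slice (hIJ hz.1)) (h.immersion z.1 (hIJ hz.1)))
    hli htan (ν s p) (h.unit_normal s (hIJ hs) p).1 (hνE _ hz) _ hH (hev _ hz)
  have hev1 : weightedDensity (frameGram g Y E) (f ∘ Y) =ᶠ[𝓝 (s, y)] familyDensity m g f X q := by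
    filter_upwards [hΩ.mem_nhds hz] with z hz using hdens z hz
  -- The fields `E i` have no time component, so the divergence is taken within the slice at time
  -- `s`.
  have hlast : ∀ i, fderiv ℝ (fun y => weightedDensity (frameGram g Y E) (f ∘ Y) y *
      ∑ j, (frameGram g Y E y)⁻¹ i j * fderiv ℝ (f ∘ Y) y (E j)) (s, y) (E i) =
      fderiv ℝ (gradientDensity m g f (X s) q i) y (basisVec i) := by
    intro i
    have hG : ∀ k l, ContDiffOn ℝ ∞ (fun z => frameGram g Y E z k l) Ω := fun k l =>
      contDiffOn_pairing g hΩ hY _ _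
    have hd : ∀ z ∈ Ω, (frameGram g Y E z).det ≠ 0 := fun z hz => by
      rw [hgram z hz]
      exact h.det_gram_ne_zero (hIJ hz.1) hz.2
    have hsm : ContDiffOn ℝ ∞ (fun y => weightedDensity (frameGram g Y E) (f ∘ Y) y *
        ∑ j, (frameGram g Y E y)⁻¹ i j * fderiv ℝ (f ∘ Y) y (E j)) Ω :=
      (contDiffOn_weightedDensity hG hU hd).mul (ContDiffOn.sum fun j _ =>
        (contDiffOn_inv_apply hG hd i j).mul
          ((hU.fderiv_of_isOpen hΩ (by simp)).clm_apply contDiffOn_const))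
    rw [← fderiv_slice ((hsm.contDiffAt (hΩ.mem_nhds hz)).differentiableAt (by simp))]
    have heq : (fun y' => weightedDensity (frameGram g Y E) (f ∘ Y) (s, y') *
        ∑ j, (frameGram g Y E (s, y'))⁻¹ i j * fderiv ℝ (f ∘ Y) (s, y') (E j)) =ᶠ[𝓝 y]
        gradientDensity m g f (X s) q i := by
      filter_upwards [(isOpen_extChartAt_target q).mem_nhds hy] with y' hy'
      have hz' : (s, y') ∈ Ω := ⟨hs, hy'⟩
      rw [hdens _ hz', hgram _ hz', gradientDensity]
      congr 1
      refine Finset.sum_congr rfl fun j _ => ?_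
      congr 1
      exact (fderiv_slice (hUd _ hz') (basisVec j)).symm
    rw [heq.fderiv_eq]
  rw [hev1.fderiv_eq, hev1.self_of_nhds] at main
  simp only [hlast] at main
  rw [main, h.normalSpeedSq_eq hn hJ (hIJ hs) hy, ← neg_mul]
  rfl

end IsDriftedMeanCurvatureFlow

end DensityEvolution

/-! ### First variation of the weighted area. -/

section FirstVariation

open Filter Topology

variable {n m : ℕ} {M : Type*} [TopologicalSpace M] [ChartedSpace (EuclideanSpace ℝ (Fin n)) M]
  [IsManifold (𝓡 n) ∞ M]
  {S : Type*} [TopologicalSpace S] [ChartedSpace (EuclideanSpace ℝ (Fin m)) S]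
  [IsManifold (𝓡 m) ∞ S] {g : Metric n M} {f : M → ℝ} {J : Set ℝ} {X : ℝ → S → M}
  {ν : ∀ (s : ℝ) (p : S), TangentSpace (𝓡 n) (X s p)}

/-- The squared speed of the flow, weighted by `exp (-f)`. -/
def weightedSpeedSq (m : ℕ) {S : Type*} [TopologicalSpace S]
    [ChartedSpace (EuclideanSpace ℝ (Fin m)) S] (g : Metric n M) (f : M → ℝ) (F : S → M)
    (ν : ∀ p : S, TangentSpace (𝓡 n) (F p)) (p : S) : ℝ :=
  (meanCurvature g m F p (ν p) + diff f (F p) (ν p)) ^ 2 * Real.exp (-f (F p))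

namespace IsDriftedMeanCurvatureFlow

lemma slice_mapsTo {s : ℝ} (hs : s ∈ J) (q : S) :
    MapsTo (fun y : EuclideanSpace ℝ (Fin m) => (s, y)) (extChartAt (𝓡 m) q).target
      (J ×ˢ (extChartAt (𝓡 m) q).target) := fun _ hy => ⟨hs, hy⟩

lemma continuousOn_slice {Φ : ℝ × EuclideanSpace ℝ (Fin m) → ℝ} {q : S}
    (hΦ : ContinuousOn Φ (J ×ˢ (extChartAt (𝓡 m) q).target)) {s : ℝ} (hs : s ∈ J) :
    ContinuousOn (fun y => Φ (s, y)) (extChartAt (𝓡 m) q).target :=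
  hΦ.comp (by fun_prop) (slice_mapsTo hs q)

lemma continuous_weight (h : IsDriftedMeanCurvatureFlow m g f J X ν) {s : ℝ} (hs : s ∈ J) :
    Continuous fun p => Real.exp (-f (X s p)) :=
  Real.continuous_exp.comp (h.smooth_function.continuous.comp (h.smooth_slice hs).continuous).neg

lemma weightedSpeedSq_chart (h : IsDriftedMeanCurvatureFlow m g f J X ν) (hn : n = m + 1)
    (hJ : UniqueDiffOn ℝ J) {s : ℝ} (hs : s ∈ J) {q : S} {y : EuclideanSpace ℝ (Fin m)}
    (hy : y ∈ (extChartAt (𝓡 m) q).target) :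
    weightedSpeedSq m g f (X s) (ν s) ((extChartAt (𝓡 m) q).symm y) =
      normalSpeedSq m g J X q (s, y) * Real.exp (-f (X s ((extChartAt (𝓡 m) q).symm y))) := by
  rw [h.normalSpeedSq_eq hn hJ hs hy]
  rfl

/-- The normal `ν` need not be continuous in `p`; continuity is read off from `normalSpeedSq`. -/
lemma continuous_weightedSpeedSq (h : IsDriftedMeanCurvatureFlow m g f J X ν) (hn : n = m + 1)
    (hJ : UniqueDiffOn ℝ J) {s : ℝ} (hs : s ∈ J) :
    Continuous (weightedSpeedSq m g f (X s) (ν s)) := by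
  refine continuous_of_comp_chart_symm (m := m) fun q => ?_
  have h1 := continuousOn_slice (h.contDiffOn_normalSpeedSq hJ q).continuousOn hs
  exact (h1.mul ((h.continuous_weight hs).comp_continuousOn
    (continuousOn_extChartAt_symm q))).congr fun y hy => h.weightedSpeedSq_chart hn hJ hs hy

variable [T2Space S] [CompactSpace S] [MeasurableSpace S] [BorelSpace S]
  {ι : Type*} [Fintype ι] {c : ι → S} {ρ : ι → S → ℝ}

lemma integral_weight_eq_sum (h : IsDriftedMeanCurvatureFlow m g f J X ν)
    (hs : ∀ k, ContMDiff (𝓡 m) 𝓘(ℝ, ℝ) ∞ (ρ k))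
    (hρ : ∀ k, tsupport (ρ k) ⊆ (extChartAt (𝓡 m) (c k)).source) (h1 : ∀ p, ∑ k, ρ k p = 1)
    {s : ℝ} (hsJ : s ∈ J) :
    ∫ p, Real.exp (-f (X s p)) ∂(areaMeasure g m (X s)) =
      ∑ k, ∫ y, chartCutoff m (ρ k) (c k) y * familyDensity m g f X (c k) (s, y) :=
  (integrable_and_integral_eq_sum g hs hρ h1 (h.smooth_slice hsJ) (h.continuous_weight hsJ)).2

lemma integral_weightedSpeedSq_eq_sum (h : IsDriftedMeanCurvatureFlow m g f J X ν)
    (hn : n = m + 1) (hJ : UniqueDiffOn ℝ J) (hs : ∀ k, ContMDiff (𝓡 m) 𝓘(ℝ, ℝ) ∞ (ρ k))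
    (hρ : ∀ k, tsupport (ρ k) ⊆ (extChartAt (𝓡 m) (c k)).source) (h1 : ∀ p, ∑ k, ρ k p = 1)
    {s : ℝ} (hsJ : s ∈ J) :
    ∫ p, weightedSpeedSq m g f (X s) (ν s) p ∂(areaMeasure g m (X s)) =
      ∑ k, ∫ y, chartCutoff m (ρ k) (c k) y *
        (normalSpeedSq m g J X (c k) (s, y) * familyDensity m g f X (c k) (s, y)) := by
  rw [(integrable_and_integral_eq_sum g hs hρ h1 (h.smooth_slice hsJ)
    (h.continuous_weightedSpeedSq hn hJ hsJ)).2]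
  refine Finset.sum_congr rfl fun k _ => integral_congr_ae (Eventually.of_forall fun y => ?_)
  by_cases hy : y ∈ (extChartAt (𝓡 m) (c k)).target
  · simp only
    rw [h.weightedSpeedSq_chart hn hJ hsJ hy, mul_assoc (normalSpeedSq m g J X (c k) (s, y))]
    rfl
  · simp only [chartCutoff, indicator_of_notMem hy, zero_mul]

/-- The density evolution, tested against a cutoff: the divergence is moved onto the cutoff, in the
form in which the contributions of all charts cancel. -/
lemma integral_cutoff_fderiv_familyDensity (h : IsDriftedMeanCurvatureFlow m g f J X ν)
    (hn : n = m + 1) (hJ : UniqueDiffOn ℝ J) {I : Set ℝ} (hI : IsOpen I) (hIJ : I ⊆ J)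
    {r : S → ℝ} {q : S} (hs : ContMDiff (𝓡 m) 𝓘(ℝ, ℝ) ∞ r)
    (hr : tsupport r ⊆ (extChartAt (𝓡 m) q).source) {s : ℝ} (hsI : s ∈ I) :
    ∫ y, chartCutoff m r q y * fderiv ℝ (familyDensity m g f X q) (s, y) (1, 0) =
      -(∫ y, chartCutoff m r q y *
        (normalSpeedSq m g J X q (s, y) * familyDensity m g f X q (s, y))) -
      ∫ y, ∑ i, fderiv ℝ (chartCutoff m r q) y (basisVec i) *
        gradientDensity m g f (X s) q i y := by
  have hsJ := hIJ hsI
  have hO := isOpen_extChartAt_target (I := 𝓡 m) q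
  have hχ := contDiff_chartCutoff hs hr
  have hc := hasCompactSupport_chartCutoff (m := m) hr
  have hsub := tsupport_chartCutoff_subset (m := m) hr
  have hZ := fun i => (h.contDiffOn_gradientDensity hsJ q i).of_le (m := 1) (by simp)
  have hQ := continuousOn_slice ((h.contDiffOn_normalSpeedSq hJ q).continuousOn.mul
    (h.contDiffOn_familyDensity hJ q).continuousOn) hsJ
  have hiQ : Integrable (fun y => -(chartCutoff m r q y *
      (normalSpeedSq m g J X q (s, y) * familyDensity m g f X q (s, y)))) :=
    (integrable_cutoff_mul volume hχ.continuous hc hO hsub hQ).neg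
  have hiZ := fun i => integrable_cutoff_mul volume hχ.continuous hc hO hsub
    (((hZ i).continuousOn_fderiv_of_isOpen hO le_rfl).clm_apply
      (continuousOn_const (c := (basisVec i : EuclideanSpace ℝ (Fin m)))))
  have hiZ' : ∀ i, Integrable (fun y => fderiv ℝ (chartCutoff m r q) y (basisVec i) *
      gradientDensity m g f (X s) q i y) := fun i =>
    integrable_cutoff_mul volume ((hχ.continuous_fderiv (by simp)).clm_apply continuous_const)
      (hc.fderiv_apply ℝ (basisVec i)) hO
      ((tsupport_fderiv_apply_subset ℝ (basisVec i)).trans hsub) (hZ i).continuousOn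
  have hcongr : ∀ y, chartCutoff m r q y * fderiv ℝ (familyDensity m g f X q) (s, y) (1, 0) =
      -(chartCutoff m r q y *
        (normalSpeedSq m g J X q (s, y) * familyDensity m g f X q (s, y))) +
      ∑ i, chartCutoff m r q y *
        fderiv ℝ (gradientDensity m g f (X s) q i) y (basisVec i) := by
    intro y
    by_cases hy : y ∈ (extChartAt (𝓡 m) q).target
    · rw [h.fderiv_familyDensity hn hJ hI hIJ hsI hy, mul_add, Finset.mul_sum, mul_neg]
    · simp only [chartCutoff, indicator_of_notMem hy, zero_mul, neg_zero, Finset.sum_const_zero,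
        add_zero]
  simp_rw [hcongr]
  rw [integral_add hiQ (integrable_finsetSum _ fun i _ => hiZ i), integral_neg,
    integral_finsetSum _ fun i _ => hiZ i, integral_finsetSum _ fun i _ => hiZ' i, sub_eq_add_neg,
    ← Finset.sum_neg_distrib]
  congr 1
  exact Finset.sum_congr rfl fun i _ =>
    integral_cutoff_mul_fderiv volume (hχ.of_le (by simp)) hc hO hsub (hZ i) _

/-- The first variation of the weighted area. -/
theorem hasDerivWithinAt_weightedArea {a : ℝ}
    (h : IsDriftedMeanCurvatureFlow m g f (Ici a) X ν) (hn : n = m + 1) {s : ℝ} (hs : s ∈ Ici a) :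
    HasDerivWithinAt (fun σ => ∫ p, Real.exp (-f (X σ p)) ∂(areaMeasure g m (X σ)))
      (-∫ p, weightedSpeedSq m g f (X s) (ν s) p ∂(areaMeasure g m (X s))) (Ici a) s := by
  obtain ⟨t, ρ, hρs, hρ, h1⟩ := exists_finite_partition_of_unity m S
  have hJ : UniqueDiffOn ℝ (Ici a) := uniqueDiffOn_Ici a
  have hA := fun {σ : ℝ} (hσ : σ ∈ Ici a) => h.integral_weight_eq_sum hρs hρ h1 hσ
  have hR := fun {σ : ℝ} (hσ : σ ∈ Ici a) => h.integral_weightedSpeedSq_eq_sum hn hJ hρs hρ h1 hσ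
  have hχ := fun k => (contDiff_chartCutoff (hρs k) (hρ k)).continuous
  have hc := fun k => hasCompactSupport_chartCutoff (m := m) (hρ k)
  have hO := fun k : t => isOpen_extChartAt_target (I := 𝓡 m) (k : S)
  have hsub := fun k => tsupport_chartCutoff_subset (m := m) (hρ k)
  have hAc : ContinuousOn (fun σ => ∫ p, Real.exp (-f (X σ p)) ∂(areaMeasure g m (X σ)))
      (Ici a) :=
    (continuousOn_finsetSum Finset.univ fun k _ => continuousOn_integral_cutoff_mul volume (hχ k)
      (hc k) (hO k) (hsub k) (h.contDiffOn_familyDensity hJ k).continuousOn).congr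
      fun σ hσ => hA hσ
  -- Continuity of the future derivative up to the initial time, available because `normalSpeedSq`
  -- is smooth on the closed time interval.
  have hRc : ContinuousOn (fun σ => ∫ p, weightedSpeedSq m g f (X σ) (ν σ) p
      ∂(areaMeasure g m (X σ))) (Ici a) :=
    (continuousOn_finsetSum Finset.univ fun k _ => continuousOn_integral_cutoff_mul volume (hχ k)
      (hc k) (hO k) (hsub k) ((h.contDiffOn_normalSpeedSq hJ k).continuousOn.mul
        (h.contDiffOn_familyDensity hJ k).continuousOn)).congr fun σ hσ => hR hσ
  have hint : ∀ σ ∈ Ioi a, HasDerivAt (fun σ => ∫ p, Real.exp (-f (X σ p))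
      ∂(areaMeasure g m (X σ)))
      (-∫ p, weightedSpeedSq m g f (X σ) (ν σ) p ∂(areaMeasure g m (X σ))) σ := by
    intro σ hσ
    have hIJ : Ioi a ⊆ Ici a := Ioi_subset_Ici_self
    have hd := HasDerivAt.fun_sum (u := Finset.univ) fun k _ =>
      hasDerivAt_integral_cutoff_mul volume (hχ k) (hc k) (hO k) (hsub k) isOpen_Ioi
        (((h.contDiffOn_familyDensity hJ (k : S)).of_le (m := 1) (by simp)).mono
          (prod_mono hIJ subset_rfl)) hσ
    have hzero := sum_integral_fderiv_chartCutoff_eq_zero g hρs hρ h1 (h.smooth_slice (hIJ hσ))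
      (h.immersion σ (hIJ hσ)) (h.smooth_function.comp (h.smooth_slice (hIJ hσ)))
    simp_rw [h.integral_cutoff_fderiv_familyDensity hn hJ isOpen_Ioi hIJ (hρs _) (hρ _) hσ] at hd
    rw [Finset.sum_sub_distrib, Finset.sum_neg_distrib, ← hR (hIJ hσ)] at hd
    have hzero' : ∑ k, ∫ y, ∑ i, fderiv ℝ (chartCutoff m (ρ k) (k : S)) y (basisVec i) *
        gradientDensity m g f (X σ) (k : S) i y = 0 := hzero
    rw [hzero', sub_zero] at hd
    refine hd.congr_of_eventuallyEq ?_
    filter_upwards [Ioi_mem_nhds hσ] with τ hτ using hA (hIJ hτ)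
  rcases eq_or_lt_of_le (mem_Ici.1 hs) with rfl | hlt
  -- At the initial time the evolution equation of the density is not at hand; the right derivative
  -- is the limit of the interior derivatives.
  · refine hasDerivWithinAt_Ici_of_tendsto_deriv (s := Ioi a)
      (fun σ hσ => (hint σ hσ).differentiableAt.differentiableWithinAt)
      ((hAc a hs).mono Ioi_subset_Ici_self) self_mem_nhdsWithin ?_
    have hlim := ((hRc a hs).mono Ioi_subset_Ici_self).neg
    refine Tendsto.congr' ?_ hlim
    filter_upwards [self_mem_nhdsWithin] with σ hσ using (hint σ hσ).deriv.symm
  · exact (hint s hlt).hasDerivWithinAt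

end IsDriftedMeanCurvatureFlow

end FirstVariation

/-! ### Application to the normalized flow. -/

lemma isDriftedMeanCurvatureFlow_normalizedFlow {n m : ℕ} {M : Type*} [TopologicalSpace M]
    [ChartedSpace (EuclideanSpace ℝ (Fin n)) M] [IsManifold (𝓡 n) ∞ M] {g : Metric n M}
    {S : Type*} [TopologicalSpace S] [ChartedSpace (EuclideanSpace ℝ (Fin m)) S]
    [IsManifold (𝓡 m) ∞ S] {w f : M → ℝ} {T : ℝ} {ψ : ℝ → Diffeomorph (𝓡 n) (𝓡 n) M M ∞}
    {gbar : ℝ → Metric n M} {wbar : ℝ → M → ℝ}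
    {x : ℝ → S → M} {e : ∀ (t : ℝ) (p : S), TangentSpace (𝓡 n) (x t p)}
    {ν : ∀ (s : ℝ) (p : S), TangentSpace (𝓡 n) (normalizedFlow T ψ x s p)}
    (hn : n = m + 1) (hT : 0 < T)
    (hsol : IsShrinkingSelfSimilarSolution g w f T ψ gbar wbar)
    (hmcf : IsMeanCurvatureFlow m gbar T x e)
    (hν : ∀ s ∈ Ici (-Real.log T), ∀ p : S,
      IsUnitNormal g m (normalizedFlow T ψ x s) p (ν s p)) :
    IsDriftedMeanCurvatureFlow m g f (Ici (-Real.log T)) (normalizedFlow T ψ x) ν where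
  smooth_function := hsol.smooth_f
  smooth := contMDiffOn_normalizedFlow hT hsol hmcf
  immersion _ hs p := mfderiv_normalizedFlow_injective hT hsol hmcf hs p
  unit_normal := hν
  evolution _ hs p v := normalizedFlow_evolution hn hT hsol hmcf hs p (hν _ hs p) v

end ExtRicciMCF

end

theorem lemma3p4 {n : ℕ} (hn : 3 ≤ n)
    {M : Type*} [TopologicalSpace M] [T2Space M] [SecondCountableTopology M]
    [ChartedSpace (EuclideanSpace ℝ (Fin n)) M] [IsManifold (𝓡 n) ∞ M]
    {S : Type*} [TopologicalSpace S] [T2Space S] [CompactSpace S]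
    [ChartedSpace (EuclideanSpace ℝ (Fin (n - 1))) S] [IsManifold (𝓡 (n - 1)) ∞ S]
    [MeasurableSpace S] [BorelSpace S]
    (g : ExtRicciMCF.Metric n M) (w f : M → ℝ) (T : ℝ) (hT : 0 < T)
    (ψ : ℝ → Diffeomorph (𝓡 n) (𝓡 n) M M ∞)
    (gbar : ℝ → ExtRicciMCF.Metric n M) (wbar : ℝ → M → ℝ)
    (hsol : ExtRicciMCF.IsShrinkingSelfSimilarSolution g w f T ψ gbar wbar)
    (x : ℝ → S → M) (e : ∀ (t : ℝ) (p : S), TangentSpace (𝓡 n) (x t p))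
    (hmcf : ExtRicciMCF.IsMeanCurvatureFlow (n - 1) gbar T x e)
    (ν : ∀ (s : ℝ) (p : S), TangentSpace (𝓡 n) (ExtRicciMCF.normalizedFlow T ψ x s p))
    (hν : ∀ s ∈ Ici (-Real.log T), ∀ p : S,
      ExtRicciMCF.IsUnitNormal g (n - 1) (ExtRicciMCF.normalizedFlow T ψ x s) p (ν s p)) :
    ∀ s ∈ Ici (-Real.log T),
      Integrable (fun p => Real.exp (-f (ExtRicciMCF.normalizedFlow T ψ x s p)))
        (ExtRicciMCF.areaMeasure g (n - 1) (ExtRicciMCF.normalizedFlow T ψ x s)) ∧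
      Integrable (fun p =>
          (ExtRicciMCF.meanCurvature g (n - 1) (ExtRicciMCF.normalizedFlow T ψ x s) p (ν s p)
            + ExtRicciMCF.diff f (ExtRicciMCF.normalizedFlow T ψ x s p) (ν s p)) ^ 2
          * Real.exp (-f (ExtRicciMCF.normalizedFlow T ψ x s p)))
        (ExtRicciMCF.areaMeasure g (n - 1) (ExtRicciMCF.normalizedFlow T ψ x s)) ∧
      HasDerivWithinAt
        (fun σ => ∫ p, Real.exp (-f (ExtRicciMCF.normalizedFlow T ψ x σ p))
          ∂(ExtRicciMCF.areaMeasure g (n - 1) (ExtRicciMCF.normalizedFlow T ψ x σ)))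
        (-∫ p, (ExtRicciMCF.meanCurvature g (n - 1) (ExtRicciMCF.normalizedFlow T ψ x s) p (ν s p)
            + ExtRicciMCF.diff f (ExtRicciMCF.normalizedFlow T ψ x s p) (ν s p)) ^ 2
          * Real.exp (-f (ExtRicciMCF.normalizedFlow T ψ x s p))
          ∂(ExtRicciMCF.areaMeasure g (n - 1) (ExtRicciMCF.normalizedFlow T ψ x s)))
        (Ici (-Real.log T)) s := by
  have hn' : n = n - 1 + 1 := by omega
  have h := ExtRicciMCF.isDriftedMeanCurvatureFlow_normalizedFlow hn' hT hsol hmcf hν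
  obtain ⟨t, ρ, hρs, hρ, h1⟩ := ExtRicciMCF.exists_finite_partition_of_unity (n - 1) S
  intro s hs
  -- Both integrands are continuous on the compact hypersurface, hence integrable.
  exact ⟨(ExtRicciMCF.integrable_and_integral_eq_sum g hρs hρ h1 (h.smooth_slice hs)
      (h.continuous_weight hs)).1,
    (ExtRicciMCF.integrable_and_integral_eq_sum g hρs hρ h1 (h.smooth_slice hs)
      (h.continuous_weightedSpeedSq hn' (uniqueDiffOn_Ici _) hs)).1,
    h.hasDerivWithinAt_weightedArea hn' hs⟩
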